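/- Let $M>0$. Let $r:\mathbb R\to(2M,\infty)$ be the inverse of the Regge--Wheeler coordinate $s(r)=r+2M\log(r-2M)$, put $F(s)=1-\frac{2M}{r(s)}$, and let $G=-\partial_s^2+\frac{2MF(s)}{r(s)^3}$. Let $p\in(2,1+\sqrt2)$, $f(s)=F(s)\,r(s)^{1-p}$ and $R>0$. Let $s_0:(0,\infty)\to(-\infty,0)$ be a function such that $$\lim_{\varepsilon\searrow0}\varepsilon^A|s_0(\varepsilon)|=\infty\qquad\text{for every }A>0 .$$ Let $\varepsilon>0$ and let $(v_0,v_1)\in H^2(\mathbb R)\times H^1(\mathbb R)$ be real-valued with, for $j=0,1$, $$v_j\ge0\ \text{ almost everywhere},\qquad v_j(s)=0\ \text{ for } |s-s_0(\varepsilon)|>R,\qquad \int_{\mathbb R}v_j(s)\,ds\ge\varepsilon .$$ Then there exist a finite $T>0$ and a solution $v\in\bigcap_{k=0}^{2}C^k([0,T);H^{2-k}(\mathbb R))$ of $$v_{tt}+Gv=f|v|^p\ \text{ in }[0,T)\times\mathbb R,\qquad v(0,\cdot)=v_0,\quad v_t(0,\cdot)=v_1,$$ such that $$\lim_{t\nearrow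 T}\Bigl(\|v(t)\|_{H^2(\mathbb R)}+\|v_t(t)\|_{H^1(\mathbb R)}+\|v_{tt}(t)\|_{L^2(\mathbb R)}\Bigr)=\infty .$$ -/

import Mathlib

open MeasureTheory Filter Topology Set
open scoped ContDiff

noncomputable section

/-! ## Schwarzschild geometry in the Regge-Wheeler coordinate -/

/-- The Regge-Wheeler coordinate `s(r) = r + 2M log (r - 2M)` on `r > 2M`. -/
def reggeWheeler (M r : ℝ) : ℝ := r + 2 * M * Real.log (r - 2 * M)

theorem reggeWheeler_bijOn {M : ℝ} (hM : 0 < M) :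
    BijOn (reggeWheeler M) (Ioi (2 * M)) univ := by
  have hcont : ContinuousOn (reggeWheeler M) (Ioi (2 * M)) := by
    unfold reggeWheeler
    refine continuousOn_id.add (continuousOn_const.mul (ContinuousOn.log (by fun_prop) ?_))
    intro x hx
    have : 2 * M < x := hx
    linarith
  refine ⟨fun _ _ => mem_univ _, ?_, ?_⟩
  · have hmono : StrictMonoOn (reggeWheeler M) (Ioi (2 * M)) := by
      intro x hx y _ hxy
      have hx' : 2 * M < x := hx
      have : Real.log (x - 2 * M) < Real.log (y - 2 * M) :=
        Real.log_lt_log (by linarith) (by linarith)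
      unfold reggeWheeler
      nlinarith
    exact hmono.injOn
  · intro s _
    -- a point with value at most `s`, and one with value at least `s`
    set δ := Real.exp ((s - 2 * M - 1) / (2 * M)) with hδ
    have hδ0 : 0 < δ := Real.exp_pos _
    have ha : reggeWheeler M (2 * M + min 1 δ) ≤ s := by
      have hm : 0 < min 1 δ := lt_min one_pos hδ0
      have h1 : min 1 δ ≤ 1 := min_le_left _ _
      have h2 : Real.log (min 1 δ) ≤ (s - 2 * M - 1) / (2 * M) := by
        rw [← Real.log_exp ((s - 2 * M - 1) / (2 * M))]
        exact Real.log_le_log hm (min_le_right _ _)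
      have h3 : 2 * M * Real.log (min 1 δ) ≤ s - 2 * M - 1 := by
        rw [le_div_iff₀ (by positivity)] at h2
        linarith
      unfold reggeWheeler
      rw [add_sub_cancel_left]
      linarith
    have hb : s ≤ reggeWheeler M (2 * M + 1 + |s|) := by
      have h1 : 0 ≤ Real.log (2 * M + 1 + |s| - 2 * M) :=
        Real.log_nonneg (by have := abs_nonneg s; linarith)
      have h2 : 0 ≤ 2 * M * Real.log (2 * M + 1 + |s| - 2 * M) := by positivity
      have := le_abs_self s
      unfold reggeWheeler
      linarith
    have hma : 2 * M + min 1 δ ∈ Ioi (2 * M) := by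
      have : 0 < min 1 δ := lt_min one_pos hδ0
      simpa using this
    have hmb : 2 * M + 1 + |s| ∈ Ioi (2 * M) := by
      have := abs_nonneg s
      simp only [mem_Ioi]
      linarith
    exact isPreconnected_Ioi.intermediate_value hma hmb hcont ⟨ha, hb⟩

/-- The area radius `r(s)`: the inverse of `s(r)`, with values in `(2M, ∞)`. -/
def areaRadius (M s : ℝ) : ℝ := Function.invFunOn (reggeWheeler M) (Ioi (2 * M)) s

theorem areaRadius_gt {M : ℝ} (hM : 0 < M) (s : ℝ) : 2 * M < areaRadius M s :=
  Function.invFunOn_mem ((reggeWheeler_bijOn hM).surjOn (mem_univ s))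

theorem reggeWheeler_areaRadius {M : ℝ} (hM : 0 < M) (s : ℝ) :
    reggeWheeler M (areaRadius M s) = s :=
  Function.invFunOn_eq ((reggeWheeler_bijOn hM).surjOn (mem_univ s))

/-- `F(s) = 1 - 2M / r(s)`. -/
def lapseF (M s : ℝ) : ℝ := 1 - 2 * M / areaRadius M s

/-- The potential `2MF / r³` of the operator `G = -∂ₛ² + 2MF / r³`. -/
def potentialW (M s : ℝ) : ℝ := 2 * M * lapseF M s / areaRadius M s ^ 3

/-- The weight `f(s) = F(s) r(s)^(1-p)` of the nonlinearity. -/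
def nonlinWeight (M p s : ℝ) : ℝ := lapseF M s * areaRadius M s ^ (1 - p)

/-! ## Sobolev spaces on the line -/

/-- The real Hilbert space `L²(ℝ)`. -/
abbrev L2R : Type := Lp ℝ 2 (volume : Measure ℝ)

/-- `w` is the weak derivative of `u` on `ℝ`. -/
def IsWeakDeriv (u w : L2R) : Prop :=
  ∀ φ : ℝ → ℝ, ContDiff ℝ ∞ φ → HasCompactSupport φ →
    (∫ s, u s * deriv φ s) = - ∫ s, w s * φ s

theorem L2R.integrable_mul (u : L2R) {φ : ℝ → ℝ} (hφ : Continuous φ)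
    (hc : HasCompactSupport φ) : Integrable (fun s => u s * φ s) :=
  MemLp.integrable_mul (p := 2) (q := 2) (Lp.memLp u) (hφ.memLp_of_hasCompactSupport hc)

/-- The Sobolev space `H^k(ℝ)`, `k ∈ ℕ`. An element is the tuple `(u, ∂u, …, ∂^k u)` of a function
`u ∈ L²` and its weak derivatives up to order `k`, all in `L²`; the norm is the usual
`(∑_{i ≤ k} ‖∂^i u‖²_{L²})^{1/2}`. -/
def SobolevH (k : ℕ) : Submodule ℝ (PiLp 2 (fun _ : Fin (k + 1) => L2R)) where
  carrier := {u | ∀ i : Fin k, IsWeakDeriv (u i.castSucc) (u i.succ)}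
  zero_mem' := by
    intro i φ _ _
    have h : ∀ g : ℝ → ℝ, ∫ s, (0 : L2R) s * g s = 0 := by
      intro g
      refine integral_eq_zero_of_ae ?_
      filter_upwards [Lp.coeFn_zero ℝ 2 (volume : Measure ℝ)] with s hs
      simp only [hs, Pi.zero_apply, zero_mul]
    simp only [PiLp.zero_apply, h, neg_zero]
  add_mem' := by
    intro u w hu hw i φ hφ hc
    have key : ∀ (a b : L2R) (g : ℝ → ℝ), Continuous g → HasCompactSupport g →
        ∫ s, (a + b : L2R) s * g s = (∫ s, a s * g s) + ∫ s, b s * g s := by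
      intro a b g hg hgc
      rw [← integral_add (a.integrable_mul hg hgc) (b.integrable_mul hg hgc)]
      apply integral_congr_ae
      filter_upwards [Lp.coeFn_add a b] with s hs
      rw [hs, Pi.add_apply, add_mul]
    have h1 := hu i φ hφ hc
    have h2 := hw i φ hφ hc
    simp only [PiLp.add_apply]
    rw [key _ _ _ (hφ.continuous_deriv (by simp)) hc.deriv, key _ _ _ hφ.continuous hc, h1, h2]
    ring
  smul_mem' := by
    intro c u hu i φ hφ hc
    have key : ∀ (a : L2R) (g : ℝ → ℝ),
        ∫ s, (c • a : L2R) s * g s = c * ∫ s, a s * g s := by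
      intro a g
      rw [← integral_const_mul]
      apply integral_congr_ae
      filter_upwards [Lp.coeFn_smul c a] with s hs
      simp [hs, mul_assoc]
    have h1 := hu i φ hφ hc
    simp only [PiLp.smul_apply]
    rw [key, key, h1]
    ring

/-- The weak derivative `∂^i u ∈ L²(ℝ)`, `i ≤ k`, of `u ∈ H^k(ℝ)`. For `i = 0` this is the
inclusion of `H^k(ℝ)` in `L²(ℝ)`. -/
def SobolevH.D {k : ℕ} (i : Fin (k + 1)) : SobolevH k →L[ℝ] L2R :=
  (PiLp.proj 2 (fun _ : Fin (k + 1) => L2R) i).comp (SobolevH k).subtypeL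

/-- The inclusion `H^(k+1)(ℝ) ⊆ H^k(ℝ)`. -/
def SobolevH.incl (k : ℕ) : SobolevH (k + 1) →L[ℝ] SobolevH k :=
  ContinuousLinearMap.codRestrict
    (((PiLp.continuousLinearEquiv 2 ℝ (fun _ : Fin (k + 1) => L2R)).symm :
        (Fin (k + 1) → L2R) →L[ℝ] PiLp 2 (fun _ : Fin (k + 1) => L2R)).comp
      (ContinuousLinearMap.pi fun i : Fin (k + 1) => SobolevH.D i.castSucc))
    (SobolevH k)
    (fun u i => u.2 i.castSucc)

theorem SobolevH.D_incl {k : ℕ} (i : Fin (k + 1)) (u : SobolevH (k + 1)) :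
    SobolevH.D i (SobolevH.incl k u) = SobolevH.D i.castSucc u := rfl

/-! ## The semilinear wave equation -/

/-- `∂ₜv` as a curve in `H¹(ℝ)` (one-sided at `t = 0`), for a curve `v` in `H²(ℝ)`. -/
def timeDeriv (T : ℝ) (v : ℝ → SobolevH 2) (t : ℝ) : SobolevH 1 :=
  derivWithin (fun τ => SobolevH.incl 1 (v τ)) (Ico 0 T) t

/-- `∂ₜ²v` as a curve in `L²(ℝ)` (one-sided at `t = 0`), for a curve `v` in `H²(ℝ)`. -/
def timeDeriv2 (T : ℝ) (v : ℝ → SobolevH 2) (t : ℝ) : L2R :=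
  iteratedDerivWithin 2 (fun τ => SobolevH.D 0 (v τ)) (Ico 0 T) t

/-- `v ∈ ⋂_{k=0}^{2} C^k([0,T); H^{2-k}(ℝ))` solves `v_tt + G v = f |v|^p` on `[0,T) × ℝ` with
`v(0) = v₀` and `v_t(0) = v₁`. -/
structure IsSolution (M p T : ℝ) (v₀ : SobolevH 2) (v₁ : SobolevH 1) (v : ℝ → SobolevH 2) :
    Prop where
  continuousOn : ContinuousOn v (Ico 0 T)
  contDiffOn_one : ContDiffOn ℝ 1 (fun t => SobolevH.incl 1 (v t)) (Ico 0 T)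
  contDiffOn_two : ContDiffOn ℝ 2 (fun t => SobolevH.D 0 (v t)) (Ico 0 T)
  equation : ∀ t ∈ Ico 0 T, ∀ᵐ s : ℝ,
    timeDeriv2 T v t s + (- SobolevH.D 2 (v t) s + potentialW M s * SobolevH.D 0 (v t) s)
      = nonlinWeight M p s * |SobolevH.D 0 (v t) s| ^ p
  initial_value : v 0 = v₀
  initial_velocity : timeDeriv T v 0 = v₁

/-- The conditions on one datum `h = v₀` or `h = v₁`: it is non-negative, vanishes for
`|s - c| > R`, and has integral at least `ε`. -/
structure IsAdmissibleDatum (c R ε : ℝ) (h : L2R) : Prop where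
  nonneg : ∀ᵐ s : ℝ, 0 ≤ h s
  support : ∀ᵐ s : ℝ, R < |s - c| → h s = 0
  integral_ge : ε ≤ ∫ s, h s

end

/-!
The solution is the maximal solution of an ordinary differential equation in `H¹(ℝ)³`; finite
lifespan follows from a test function argument that contradicts existence on `[0, T]` for large `T`.

*Local theory.* With `N(v) = f |v|^p - W v`, where `W = 2MF/r³`, the equation is `v_tt - v_ss = N(v)`.
The functions `v_t + v_s` and `v_t - v_s` are transported with speed one, so pulling them back along
the translations gives unknowns `A`, `B` for which the system for `(A, B, v)` has a vector field that
is Lipschitz on balls of `H¹(ℝ)³` (`waveField`; the nonlinearity is treated in `nlinH1`, by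
the embedding of `H¹` in `L^∞`). Its maximal integral curve exists for all time or its norm blows up
(`exists_isIntegralCurveOn_tendsto_norm_atTop`), it gives a solution with values in `H²(ℝ)`
(`exists_isStrongWave`), and an iteration outside the light cone gives finite speed of propagation
(`IsIntegralCurveOn.eq_zero_outside`). By the latter, test functions on the line need not
have compact support.

*Exponential growth.* The equation `φ'' = (M⁻² + W) φ` has a solution of the size of `exp(s/M)`,
since `∫ W` is small (`exists_exponential_solution`). As the data are non-negative, `∫ v(t) φ ds`
grows at least like `exp(t/M)` (`IsWeakWave.exp_growth`). Young's inequality turns this into a lower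
bound of order `T^(2-p)` for `n(t) = ∫ f |v(t)|^p r ds`, `t ≤ T/8` (`IsWeakWave.exists_le_source`);
note that no sign of `v` is known at positive times.

*Contradiction.* The function `r` is a stationary solution of the linear equation. With
`σ = -2M log F ≥ 0` and a smooth cut-off `η` that is `1` on `(-∞, 1/2]` and `0` on `[1, ∞)`, the
linear wave operator maps `r η((t + σ)/T)` to `r (1 - (2M/r)⁴) η''/T²`, which is bounded by a
multiple of `F |η''|/T` on the light cone. The factor `F`, also present in `f`, is what makes it
possible to absorb this error in the nonlinearity near the horizon; if `η = ζ⁴` the error is at most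
half of `∫ f |v|^p r η ds` plus a multiple of `T^(1 - 2/(p-1))` (`IsWeakWave.exists_error_le`).
Pairing the equation with this function over `[0, T]`, the boundary terms at `t = 0` have a good
sign and those at `t = T` vanish, so that `T · T^(2-p)` is at most a multiple of
`T · T^(1 - 2/(p-1))`. For `p < 1 + √2`, that is `(p-1)² < 2`, this fails for large `T`
(`exists_not_isWeakWave`).
-/

noncomputable section

/-! ### Maximal solutions of ordinary differential equations in Banach spaces -/

section ODE

open Metric
open scoped NNReal

variable {E : Type*} [NormedAddCommGroup E] [NormedSpace ℝ E]

theorem IsIntegralCurveOn.concat {Γ : ℝ → E → E} {x y : ℝ → E} {a b d : ℝ} (hab : a ≤ b)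
    (hbd : b ≤ d) (hx : IsIntegralCurveOn x Γ (Icc a b)) (hy : IsIntegralCurveOn y Γ (Icc b d))
    (hxy : x b = y b) :
    IsIntegralCurveOn (fun t => if t ≤ b then x t else y t) Γ (Icc a d) := by
  have e1 : EqOn (fun t => if t ≤ b then x t else y t) x (Icc a b) := fun t ht => if_pos ht.2
  have e2 : EqOn (fun t => if t ≤ b then x t else y t) y (Icc b d) := by
    intro t ht
    rcases ht.1.eq_or_lt with rfl | h
    · simp [hxy]
    · exact if_neg (not_le.mpr h)
  intro t ht
  rw [← Icc_union_Icc_eq_Icc hab hbd]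
  rcases lt_trichotomy t b with h | rfl | h
  · have hm : t ∈ Icc a b := ⟨ht.1, h.le⟩
    refine HasDerivWithinAt.union ?_ ?_
    · have := (hx t hm).congr_of_mem e1 hm
      rwa [← e1 hm] at this
    · exact hasDerivWithinAt_iff_hasFDerivWithinAt.mpr (HasFDerivWithinAt.of_notMem_closure <| by
        rw [isClosed_Icc.closure_eq]; exact fun h' => absurd h'.1 (not_le.mpr h))
  · have hm1 : t ∈ Icc a t := ⟨ht.1, le_rfl⟩
    have hm2 : t ∈ Icc t d := ⟨le_rfl, ht.2⟩
    refine HasDerivWithinAt.union ?_ ?_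
    · have := (hx t hm1).congr_of_mem e1 hm1
      rwa [← e1 hm1] at this
    · have := (hy t hm2).congr_of_mem e2 hm2
      rwa [← e2 hm2] at this
  · have hm : t ∈ Icc b d := ⟨h.le, ht.2⟩
    refine HasDerivWithinAt.union ?_ ?_
    · exact hasDerivWithinAt_iff_hasFDerivWithinAt.mpr (HasFDerivWithinAt.of_notMem_closure <| by
        rw [isClosed_Icc.closure_eq]; exact fun h' => absurd h'.2 (not_le.mpr h))
    · have := (hy t hm).congr_of_mem e2 hm
      rwa [← e2 hm] at this

/-- Two integral curves of a vector field that is Lipschitz on balls agree if they agree at the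
left end point. -/
theorem IsIntegralCurveOn.eqOn_Icc {Γ : ℝ → E → E}
    (hL : ∀ B : ℝ, ∃ K : ℝ≥0, ∀ t, LipschitzOnWith K (Γ t) (closedBall 0 B))
    {x y : ℝ → E} {a b : ℝ} (hx : IsIntegralCurveOn x Γ (Icc a b))
    (hy : IsIntegralCurveOn y Γ (Icc a b)) (hxy : x a = y a) : EqOn x y (Icc a b) := by
  have cx : ContinuousOn x (Icc a b) := fun t ht => (hx t ht).continuousWithinAt
  have cy : ContinuousOn y (Icc a b) := fun t ht => (hy t ht).continuousWithinAt
  obtain ⟨B1, hB1⟩ := isCompact_Icc.exists_bound_of_continuousOn cx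
  obtain ⟨B2, hB2⟩ := isCompact_Icc.exists_bound_of_continuousOn cy
  obtain ⟨K, hK⟩ := hL (max B1 B2)
  have hI : ∀ t ∈ Ico a b, Icc a b ∈ 𝓝[Ici t] t := fun t ht => by
    filter_upwards [Icc_mem_nhdsGE ht.2] with s hs using ⟨ht.1.trans hs.1, hs.2⟩
  refine ODE_solution_unique_of_mem_Icc_right (v := Γ) (s := fun _ => closedBall 0 (max B1 B2))
    (fun t _ => hK t) cx (fun t ht => ?_) (fun t ht => ?_) cy (fun t ht => ?_) (fun t ht => ?_) hxy
  · exact (hx t (Ico_subset_Icc_self ht)).mono_of_mem_nhdsWithin (hI t ht)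
  · simpa using (hB1 t (Ico_subset_Icc_self ht)).trans (le_max_left _ _)
  · exact (hy t (Ico_subset_Icc_self ht)).mono_of_mem_nhdsWithin (hI t ht)
  · simpa using (hB2 t (Ico_subset_Icc_self ht)).trans (le_max_right _ _)

/-- Local existence on a time interval whose length depends only on a bound for the initial value. -/
theorem exists_isIntegralCurveOn_of_norm_le [CompleteSpace E] {Γ : ℝ → E → E}
    (hc : ∀ x, Continuous fun t => Γ t x)
    (hL : ∀ B : ℝ, ∃ K : ℝ≥0, ∀ t, LipschitzOnWith K (Γ t) (closedBall 0 B))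
    (hb : ∀ B : ℝ, ∃ C : ℝ≥0, ∀ t, ∀ x ∈ closedBall (0 : E) B, ‖Γ t x‖ ≤ C) (B : ℝ) :
    ∃ δ : ℝ, 0 < δ ∧ ∀ (t₀ : ℝ) (y : E), ‖y‖ ≤ B →
      ∃ α : ℝ → E, α t₀ = y ∧ IsIntegralCurveOn α Γ (Icc t₀ (t₀ + δ)) := by
  obtain ⟨K, hK⟩ := hL (B + 1)
  obtain ⟨C, hC⟩ := hb (B + 1)
  have hC0 : (0 : ℝ) < C + 1 := by positivity
  refine ⟨1 / (C + 1), by positivity, fun t₀ y hy => ?_⟩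
  have hsub : closedBall y ((1 : ℝ≥0) : ℝ) ⊆ closedBall (0 : E) (B + 1) := by
    refine closedBall_subset_closedBall' ?_
    rw [dist_zero_right]
    simp only [NNReal.coe_one]
    linarith
  have hmem : t₀ ∈ Icc t₀ (t₀ + 1 / ((C : ℝ) + 1)) :=
    ⟨le_rfl, by have : 0 < 1 / ((C : ℝ) + 1) := by positivity
                linarith⟩
  have hpl : IsPicardLindelof Γ (⟨t₀, hmem⟩ : Icc t₀ (t₀ + 1 / ((C : ℝ) + 1))) y 1 0 C K :=
    { lipschitzOnWith := fun t _ => (hK t).mono hsub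
      continuousOn := fun x _ => (hc x).continuousOn
      norm_le := fun t _ x hx => hC t x (hsub hx)
      mul_max_le := by
        simp only [add_sub_cancel_left, sub_self, NNReal.coe_one, NNReal.coe_zero, sub_zero]
        rw [max_eq_left (by positivity), mul_one_div, div_le_one hC0]
        linarith }
  obtain ⟨α, h1, h2⟩ := hpl.exists_eq_forall_mem_Icc_hasDerivWithinAt₀
  exact ⟨α, h1, h2⟩

/-- **Blow-up alternative.** If a vector field is bounded and Lipschitz on balls, uniformly in
time, and its integral curve from `x₀` cannot be continued up to the time `T'`, then the norm of
the maximal integral curve tends to infinity in finite time. -/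
theorem exists_isIntegralCurveOn_tendsto_norm_atTop [CompleteSpace E] {Γ : ℝ → E → E}
    (hc : ∀ x, Continuous fun t => Γ t x)
    (hL : ∀ B : ℝ, ∃ K : ℝ≥0, ∀ t, LipschitzOnWith K (Γ t) (closedBall 0 B))
    (hb : ∀ B : ℝ, ∃ C : ℝ≥0, ∀ t, ∀ x ∈ closedBall (0 : E) B, ‖Γ t x‖ ≤ C)
    (x₀ : E) {T' : ℝ}
    (hno : ¬ ∃ x : ℝ → E, x 0 = x₀ ∧ IsIntegralCurveOn x Γ (Icc 0 T')) :
    ∃ T : ℝ, 0 < T ∧ ∃ x : ℝ → E, x 0 = x₀ ∧ IsIntegralCurveOn x Γ (Ico 0 T) ∧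
      Tendsto (fun t => ‖x t‖) (𝓝[<] T) atTop := by
  set S : Set ℝ := {T | ∃ x : ℝ → E, x 0 = x₀ ∧ IsIntegralCurveOn x Γ (Icc 0 T)} with hS
  have hdown : ∀ T ∈ S, ∀ T1, T1 ≤ T → T1 ∈ S := by
    rintro T ⟨x, hx0, hx⟩ T1 h
    exact ⟨x, hx0, hx.mono (Icc_subset_Icc_right h)⟩
  have hbdd : BddAbove S := ⟨T', fun T hT => le_of_not_gt fun h => hno (hdown T hT T' h.le)⟩
  obtain ⟨δ₀, hδ₀, hloc₀⟩ := exists_isIntegralCurveOn_of_norm_le hc hL hb ‖x₀‖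
  have hδS : δ₀ ∈ S := by
    obtain ⟨α, h1, h2⟩ := hloc₀ 0 x₀ le_rfl
    rw [zero_add] at h2
    exact ⟨α, h1, h2⟩
  set T := sSup S with hT
  have hTpos : 0 < T := hδ₀.trans_le (le_csSup hbdd hδS)
  have hlt : ∀ t < T, t ∈ S := fun t ht => by
    obtain ⟨T1, h1, h2⟩ := exists_lt_of_lt_csSup ⟨δ₀, hδS⟩ ht
    exact hdown T1 h1 t h2.le
  have hchoice : ∀ t, ∃ x : ℝ → E, t ∈ S → x 0 = x₀ ∧ IsIntegralCurveOn x Γ (Icc 0 t) := by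
    intro t
    by_cases h : t ∈ S
    · obtain ⟨x, hx⟩ := h
      exact ⟨x, fun _ => hx⟩
    · exact ⟨fun _ => 0, fun h' => absurd h' h⟩
  choose X hX using hchoice
  have heq : ∀ T1 ∈ S, EqOn (fun t => X t t) (X T1) (Icc 0 T1) := by
    intro T1 h1 t ht
    have htS := hdown T1 h1 t ht.2
    exact (hX t htS).2.eqOn_Icc hL ((hX T1 h1).2.mono (Icc_subset_Icc_right ht.2))
      ((hX t htS).1.trans (hX T1 h1).1.symm) ⟨ht.1, le_rfl⟩
  refine ⟨T, hTpos, fun t => X t t, (hX 0 (hlt 0 hTpos)).1, fun t ht => ?_, ?_⟩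
  · obtain ⟨T1, h1, h2⟩ := exists_between ht.2
    have hm : t ∈ Icc 0 T1 := ⟨ht.1, h1.le⟩
    have h3 := ((hX T1 (hlt T1 h2)).2 t hm).congr_of_mem (heq T1 (hlt T1 h2)) hm
    rw [← heq T1 (hlt T1 h2) hm] at h3
    refine h3.mono_of_mem_nhdsWithin ?_
    filter_upwards [mem_nhdsWithin_of_mem_nhds (Iio_mem_nhds h1), self_mem_nhdsWithin]
      with s hs hs' using ⟨hs'.1, le_of_lt hs⟩
  · rw [Filter.tendsto_atTop]
    by_contra! hcon
    obtain ⟨B, hB⟩ := hcon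
    obtain ⟨δ, hδ, hloc⟩ := exists_isIntegralCurveOn_of_norm_le hc hL hb B
    -- close to `T` there is a time at which the curve lies in the ball of radius `B`
    have hnear : ∀ᶠ t in 𝓝[<] T, t ∈ Ioo (max 0 (T - δ)) T :=
      Ioo_mem_nhdsLT (max_lt hTpos (by linarith))
    obtain ⟨t₀, ht1, ht2⟩ := (hB.and_eventually hnear).exists
    have ht0 : 0 < t₀ := (le_max_left _ _).trans_lt ht2.1
    have htδ : T - δ < t₀ := (le_max_right _ _).trans_lt ht2.1
    obtain ⟨α, h1, h2⟩ := hloc t₀ (X t₀ t₀) ht1.le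
    have h3 := (hX t₀ (hlt t₀ ht2.2)).2.concat ht0.le (by linarith : t₀ ≤ t₀ + δ) h2 h1.symm
    have h4 : t₀ + δ ∈ S := ⟨_, by simp [ht0.le, (hX t₀ (hlt t₀ ht2.2)).1], h3⟩
    linarith [le_csSup hbdd h4]

end ODE

/-! ### Translations and test functions in `L²(ℝ)` -/

open scoped RealInnerProductSpace

/-- The translation `(shift t u)(s) = u(s + t)` on `L²(ℝ)`. -/
def shift (t : ℝ) : L2R →ₗᵢ[ℝ] L2R :=
  Lp.compMeasurePreservingₗᵢ ℝ (fun s => s + t) (measurePreserving_add_right volume t)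

theorem coeFn_shift (t : ℝ) (u : L2R) : shift t u =ᵐ[volume] fun s => u (s + t) :=
  Lp.coeFn_compMeasurePreserving u (measurePreserving_add_right volume t)

theorem ae_add_right {P : ℝ → Prop} (h : ∀ᵐ s : ℝ, P s) (t : ℝ) : ∀ᵐ s : ℝ, P (s + t) :=
  (measurePreserving_add_right volume t).quasiMeasurePreserving.ae h

theorem shift_shift (t t' : ℝ) (u : L2R) : shift t (shift t' u) = shift (t + t') u := by
  apply Lp.ext
  filter_upwards [coeFn_shift t (shift t' u), ae_add_right (coeFn_shift t' u) t,
    coeFn_shift (t + t') u] with s h1 h2 h3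
  rw [h1, h2, h3, add_assoc]

theorem shift_zero (u : L2R) : shift 0 u = u := by
  apply Lp.ext
  filter_upwards [coeFn_shift 0 u] with s h1
  rw [h1, add_zero]

theorem continuous_shift : Continuous fun q : ℝ × L2R => shift q.1 q.2 := by
  let g : C(ℝ, C(ℝ, ℝ)) :=
    (ContinuousMap.mk (fun a : ℝ × ℝ => a.2 + a.1) (by fun_prop)).curry
  have hm : ∀ q : ℝ × L2R, MeasurePreserving (g q.1) (volume : Measure ℝ) volume :=
    fun q => measurePreserving_add_right volume q.1
  exact continuous_snd.compMeasurePreservingLp (g := fun q : ℝ × L2R => g q.1)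
    (g.continuous.comp continuous_fst) hm (by norm_num)

theorem inner_shift (t : ℝ) (u w : L2R) : ⟪shift t u, w⟫ = ⟪u, shift (-t) w⟫ := by
  rw [← (shift (-t)).inner_map_map, shift_shift, neg_add_cancel, shift_zero]

/-- The class in `L²(ℝ)` of a square integrable function, and `0` for any other function. -/
def toL2 (g : ℝ → ℝ) : L2R := by
  classical exact if h : MemLp g 2 volume then h.toLp g else 0

theorem toL2_eq {g : ℝ → ℝ} (h : MemLp g 2 volume) : toL2 g = h.toLp g := dif_pos h

theorem coeFn_toL2 {g : ℝ → ℝ} (h : MemLp g 2 volume) : toL2 g =ᵐ[volume] g := by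
  rw [toL2_eq h]
  exact h.coeFn_toLp

theorem inner_eq_integral (u w : L2R) : ⟪u, w⟫ = ∫ s, u s * w s := by
  rw [L2.inner_def]
  exact integral_congr_ae (Eventually.of_forall fun s => by
    simp [mul_comm])

theorem inner_toL2 (u : L2R) {g : ℝ → ℝ} (h : MemLp g 2 volume) :
    ⟪u, toL2 g⟫ = ∫ s, u s * g s := by
  rw [inner_eq_integral]
  exact integral_congr_ae ((coeFn_toL2 h).mono fun s hs => by simp only [hs])

theorem norm_sq_eq_integral (u : L2R) : ‖u‖ ^ 2 = ∫ s, u s ^ 2 := by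
  rw [← real_inner_self_eq_norm_sq, inner_eq_integral]
  exact integral_congr_ae (Eventually.of_forall fun s => by simp only; ring)

theorem shift_toL2 {g : ℝ → ℝ} (h : MemLp g 2 volume) (t : ℝ) :
    shift t (toL2 g) = toL2 fun s => g (s + t) := by
  have h' : MemLp (fun s => g (s + t)) 2 volume :=
    h.comp_measurePreserving (measurePreserving_add_right volume t)
  apply Lp.ext
  filter_upwards [coeFn_shift t (toL2 g), ae_add_right (coeFn_toL2 h) t, coeFn_toL2 h']
    with s h1 h2 h3
  rw [h1, h2, h3]

theorem HasCompactSupport.memLp_two {g : ℝ → ℝ} (hc : HasCompactSupport g) (hg : Continuous g) :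
    MemLp g 2 volume := hg.memLp_of_hasCompactSupport hc

/-- A smooth function with compact support. -/
structure IsTest (φ : ℝ → ℝ) : Prop where
  smooth : ContDiff ℝ ∞ φ
  supp : HasCompactSupport φ

namespace IsTest

variable {φ : ℝ → ℝ}

protected theorem continuous (h : IsTest φ) : Continuous φ := h.smooth.continuous

protected theorem memLp (h : IsTest φ) : MemLp φ 2 volume := h.supp.memLp_two h.continuous

protected theorem deriv (h : IsTest φ) : IsTest (deriv φ) :=
  ⟨h.smooth.deriv' , h.supp.deriv⟩

theorem hasDerivAt (h : IsTest φ) (s : ℝ) : HasDerivAt φ (deriv φ s) s :=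
  ((h.smooth.differentiable (by simp)) s).hasDerivAt

theorem comp_add (h : IsTest φ) (t : ℝ) : IsTest fun s => φ (s + t) :=
  ⟨h.smooth.comp (contDiff_id.add contDiff_const),
    h.supp.comp_homeomorph (Homeomorph.addRight t)⟩

theorem exists_bound (h : IsTest φ) : ∃ C, ∀ s, |φ s| ≤ C := by
  obtain ⟨C, hC⟩ := h.supp.exists_bound_of_continuous h.continuous
  exact ⟨C, hC⟩

theorem exists_support_bound (h : IsTest φ) : ∃ L : ℝ, 0 < L ∧ ∀ s, L ≤ |s| → φ s = 0 := by
  obtain ⟨L, hL0, hL⟩ := h.supp.isCompact.isBounded.subset_ball_lt 0 0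
  refine ⟨L, hL0, fun s hs => image_eq_zero_of_notMem_tsupport fun h' => ?_⟩
  have := hL h'
  rw [mem_ball_zero_iff, Real.norm_eq_abs] at this
  exact absurd hs (not_le.mpr this)

end IsTest

theorem isWeakDeriv_iff {u w : L2R} :
    IsWeakDeriv u w ↔ ∀ φ, IsTest φ → ⟪u, toL2 (deriv φ)⟫ = -⟪w, toL2 φ⟫ := by
  constructor
  · intro h φ hφ
    rw [inner_toL2 u hφ.deriv.memLp, inner_toL2 w hφ.memLp]
    exact h φ hφ.smooth hφ.supp
  · intro h φ h1 h2
    have hφ : IsTest φ := ⟨h1, h2⟩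
    rw [← inner_toL2 u hφ.deriv.memLp, ← inner_toL2 w hφ.memLp]
    exact h φ hφ

theorem eq_zero_of_inner_test {u : L2R} (h : ∀ φ, IsTest φ → ⟪u, toL2 φ⟫ = 0) : u = 0 := by
  rw [Lp.eq_zero_iff_ae_eq_zero]
  refine ae_eq_zero_of_integral_contDiff_smul_eq_zero
    ((Lp.memLp u).locallyIntegrable (by norm_num)) fun φ h1 h2 => ?_
  have := h φ ⟨h1, h2⟩
  rw [inner_toL2 u (IsTest.memLp ⟨h1, h2⟩)] at this
  simpa [mul_comm] using this

theorem IsWeakDeriv.unique {u w w' : L2R} (h : IsWeakDeriv u w) (h' : IsWeakDeriv u w') :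
    w = w' := by
  rw [← sub_eq_zero]
  refine eq_zero_of_inner_test fun φ hφ => ?_
  rw [inner_sub_left]
  linarith [isWeakDeriv_iff.mp h φ hφ, isWeakDeriv_iff.mp h' φ hφ]

theorem isClosed_isWeakDeriv : IsClosed {q : L2R × L2R | IsWeakDeriv q.1 q.2} := by
  simp only [isWeakDeriv_iff, ofPred_forall]
  refine isClosed_iInter fun φ => isClosed_iInter fun _ => ?_
  exact isClosed_eq (by fun_prop) (by fun_prop)

/-- Second order Taylor bound. -/
theorem abs_taylor_le {g g' g'' : ℝ → ℝ} {C : ℝ} (h1 : ∀ x, HasDerivAt g (g' x) x)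
    (h2 : ∀ x, HasDerivAt g' (g'' x) x) (hC : ∀ x, |g'' x| ≤ C) (x h : ℝ) :
    |g (x + h) - g x - h * g' x| ≤ C * h ^ 2 := by
  have hC0 : 0 ≤ C := (abs_nonneg _).trans (hC 0)
  have hlip : ∀ y, |g' y - g' x| ≤ C * |y - x| := fun y => by
    have := convex_univ.norm_image_sub_le_of_norm_hasDerivWithin_le
      (fun z _ => (h2 z).hasDerivWithinAt) (fun z _ => hC z) (mem_univ x) (mem_univ y)
    simpa using this
  have hd : ∀ y ∈ uIcc x (x + h), HasDerivWithinAt (fun y => g y - y * g' x) (g' y - g' x)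
      (uIcc x (x + h)) y := fun y _ => by
    have h3 : HasDerivAt (fun y => y * g' x) (g' x) y := by
      simpa using (hasDerivAt_id y).mul_const (g' x)
    exact ((h1 y).sub h3).hasDerivWithinAt
  have := (convex_uIcc x (x + h)).norm_image_sub_le_of_norm_hasDerivWithin_le hd
    (C := C * |h|) (fun y hy => ?_) left_mem_uIcc right_mem_uIcc
  · simp only [Real.norm_eq_abs, add_sub_cancel_left] at this
    calc _ = |g (x + h) - (x + h) * g' x - (g x - x * g' x)| := by ring_nf
      _ ≤ C * |h| * |h| := this
      _ = C * h ^ 2 := by rw [mul_assoc, abs_mul_abs_self, sq]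
  · refine (hlip y).trans (mul_le_mul_of_nonneg_left ?_ hC0)
    have := abs_sub_left_of_mem_uIcc hy
    simpa using this

/-- A curve of square integrable functions whose first order Taylor expansion in time has a
remainder that is quadratic, with a square integrable constant, is differentiable in `L²`. -/
theorem hasDerivAt_toL2 {A : ℝ → ℝ → ℝ} {B k : ℝ → ℝ} {t : ℝ} (hA : ∀ t, MemLp (A t) 2 volume)
    (hB : MemLp B 2 volume) (hk : MemLp k 2 volume)
    (h : ∀ h : ℝ, |h| ≤ 1 → ∀ s, |A (t + h) s - A t s - h * B s| ≤ h ^ 2 * k s) :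
    HasDerivAt (fun t => toL2 (A t)) (toL2 B) t := by
  rw [hasDerivAt_iff_isLittleO_nhds_zero]
  have hO : (fun h : ℝ => toL2 (A (t + h)) - toL2 (A t) - h • toL2 B) =O[𝓝 0]
      fun h : ℝ => h ^ 2 := by
    refine Asymptotics.IsBigO.of_bound ‖toL2 k‖ ?_
    filter_upwards [Metric.closedBall_mem_nhds (0 : ℝ) one_pos] with x hx
    have hx1 : |x| ≤ 1 := by simpa using hx
    calc ‖toL2 (A (t + x)) - toL2 (A t) - x • toL2 B‖ ≤ ‖(x ^ 2) • toL2 k‖ := by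
          apply Lp.norm_le_norm_of_ae_le
          filter_upwards [Lp.coeFn_sub (toL2 (A (t + x)) - toL2 (A t)) (x • toL2 B),
            Lp.coeFn_sub (toL2 (A (t + x))) (toL2 (A t)), Lp.coeFn_smul x (toL2 B),
            Lp.coeFn_smul (x ^ 2) (toL2 k), coeFn_toL2 (hA (t + x)), coeFn_toL2 (hA t),
            coeFn_toL2 hB, coeFn_toL2 hk] with s e1 e2 e3 e4 e5 e6 e7 e8
          rw [e1, Pi.sub_apply, e2, Pi.sub_apply, e3, e4, Pi.smul_apply, Pi.smul_apply, e5, e6,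
            e7, e8]
          simp only [smul_eq_mul, Real.norm_eq_abs]
          exact (h x hx1 s).trans (le_abs_self _)
      _ = ‖toL2 k‖ * ‖x ^ 2‖ := by rw [norm_smul, mul_comm]
  refine hO.trans_isLittleO ?_
  simpa using Asymptotics.isLittleO_pow_pow (𝕜 := ℝ) (one_lt_two)

theorem IsTest.hasDerivAt_shift {φ : ℝ → ℝ} (hφ : IsTest φ) (t : ℝ) :
    HasDerivAt (fun t => shift t (toL2 φ)) (shift t (toL2 (deriv φ))) t := by
  simp only [shift_toL2 hφ.memLp, shift_toL2 hφ.deriv.memLp]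
  obtain ⟨C, hC⟩ := hφ.deriv.deriv.exists_bound
  obtain ⟨L, hL0, hL⟩ := hφ.exists_support_bound
  have hC0 : 0 ≤ C := (abs_nonneg _).trans (hC 0)
  have hL' : ∀ s, L < |s| → deriv φ s = 0 := fun s hs => by
    have : φ =ᶠ[𝓝 s] fun _ => 0 := by
      filter_upwards [(isOpen_lt continuous_const continuous_abs).mem_nhds hs] with y hy
        using hL y (le_of_lt hy)
    rw [this.deriv_eq, deriv_const]
  refine hasDerivAt_toL2 (k := (Icc (-(L + 1 + |t|)) (L + 1 + |t|)).indicator fun _ => C)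
    (fun t => (hφ.comp_add t).memLp) (hφ.deriv.comp_add t).memLp
    (memLp_indicator_const 2 measurableSet_Icc C (Or.inr (by simp))) fun h hh s => ?_
  · by_cases hs : s ∈ Icc (-(L + 1 + |t|)) (L + 1 + |t|)
    · rw [indicator_of_mem hs, mul_comm (h ^ 2), ← add_assoc]
      exact abs_taylor_le hφ.hasDerivAt hφ.deriv.hasDerivAt hC (s + t) h
    · rw [indicator_of_notMem hs]
      have hs' : L + 1 + |t| < |s| := by
        by_contra hcon
        exact hs (abs_le.mp (not_lt.mp hcon))
      have e1 : L < |s + t| := by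
        have := abs_sub_abs_le_abs_sub s (-t)
        rw [abs_neg, sub_neg_eq_add] at this
        linarith
      have e2 : L < |s + (t + h)| := by
        have := abs_sub_abs_le_abs_sub s (-(t + h))
        rw [abs_neg, sub_neg_eq_add] at this
        linarith [abs_add_le t h]
      rw [hL _ e1.le, hL _ e2.le, hL' _ e1]
      simp

/-- If `w` is the weak derivative of `u` then the curve of translates of `u` in `L²(ℝ)`
is differentiable, with the translates of `w` as derivative. This is proved by duality from the case
of test functions. -/
theorem IsWeakDeriv.hasDerivAt_shift {u w : L2R} (huw : IsWeakDeriv u w) (t : ℝ) :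
    HasDerivAt (fun t => shift t u) (shift t w) t := by
  have hcont : Continuous fun t => shift t w :=
    continuous_shift.comp (continuous_id.prodMk continuous_const)
  have hint : ∀ t, HasDerivAt (fun t => u + ∫ σ in (0 : ℝ)..t, shift σ w) (shift t w) t := fun t =>
    (hcont.integral_hasStrictDerivAt 0 t).hasDerivAt.const_add u
  suffices h : (fun t => shift t u) = fun t => u + ∫ σ in (0 : ℝ)..t, shift σ w by
    rw [h]
    exact hint t
  funext t
  rw [← sub_eq_zero]
  refine eq_zero_of_inner_test fun φ hφ => ?_
  have hder : ∀ τ, HasDerivAt (fun τ => ⟪shift τ u - (u + ∫ σ in (0 : ℝ)..τ, shift σ w), toL2 φ⟫)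
      0 τ := by
    intro τ
    have h1 : HasDerivAt (fun τ => ⟪shift τ u, toL2 φ⟫) (⟪shift τ w, toL2 φ⟫) τ := by
      have h2 := (hφ.hasDerivAt_shift (-τ)).scomp τ (hasDerivAt_neg τ)
      have h3 := (hasDerivAt_const τ u).inner ℝ h2
      have h4 : ⟪u, shift (-τ) (toL2 (deriv φ))⟫ = -⟪w, shift (-τ) (toL2 φ)⟫ := by
        rw [shift_toL2 hφ.deriv.memLp, shift_toL2 hφ.memLp,
          ← isWeakDeriv_iff.mp huw _ (hφ.comp_add (-τ))]
        congr 2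
        funext s
        exact (deriv_comp_add_const (f := φ) (a := -τ) (x := s)).symm
      simp only [inner_shift]
      refine h3.congr_deriv ?_
      rw [inner_zero_left, add_zero, inner_smul_right, h4]
      ring
    have h5 := h1.sub ((hint τ).inner ℝ (hasDerivAt_const τ (toL2 φ)))
    simp only [inner_zero_right, zero_add, sub_self] at h5
    refine h5.congr_of_eventuallyEq (Eventually.of_forall fun x => ?_)
    simp only [Pi.sub_apply, inner_sub_left]
  have := is_const_of_deriv_eq_zero (fun τ => (hder τ).differentiableAt)
    (fun τ => (hder τ).deriv) t 0
  rw [this]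
  simp [shift_zero]

/-! ### The Sobolev space `H¹(ℝ)` -/

theorem SobolevH.isWeakDeriv_one (u : SobolevH 1) : IsWeakDeriv (SobolevH.D 0 u) (SobolevH.D 1 u) :=
  u.2 0

instance SobolevH.completeSpace (k : ℕ) : CompleteSpace (SobolevH k) := by
  refine IsClosed.completeSpace_coe (hs := ?_)
  have : (SobolevH k : Set (PiLp 2 (fun _ : Fin (k + 1) => L2R))) =
      ⋂ i : Fin k, (fun u : PiLp 2 (fun _ : Fin (k + 1) => L2R) => (u i.castSucc, u i.succ)) ⁻¹'
        {q : L2R × L2R | IsWeakDeriv q.1 q.2} := by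
    ext u
    simp only [mem_iInter, mem_preimage, mem_ofPred_eq]
    rfl
  rw [this]
  refine isClosed_iInter fun i => isClosed_isWeakDeriv.preimage ?_
  exact (PiLp.continuous_apply 2 _ i.castSucc).prodMk (PiLp.continuous_apply 2 _ i.succ)

/-- The element of `H¹(ℝ)` with components `u` and `w = ∂u`. -/
def SobolevH.mk₁ (u w : L2R) (h : IsWeakDeriv u w) : SobolevH 1 :=
  ⟨WithLp.toLp 2 ![u, w], fun i => by
    fin_cases i
    exact h⟩

@[simp] theorem SobolevH.D_zero_mk₁ (u w : L2R) (h : IsWeakDeriv u w) :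
    SobolevH.D 0 (SobolevH.mk₁ u w h) = u := rfl

@[simp] theorem SobolevH.D_one_mk₁ (u w : L2R) (h : IsWeakDeriv u w) :
    SobolevH.D 1 (SobolevH.mk₁ u w h) = w := rfl

theorem SobolevH.ext_one {u w : SobolevH 1} (h : SobolevH.D 0 u = SobolevH.D 0 w) : u = w := by
  have h1 : SobolevH.D 1 u = SobolevH.D 1 w :=
    (SobolevH.isWeakDeriv_one u).unique (by rw [h]; exact (SobolevH.isWeakDeriv_one w))
  apply Subtype.ext
  apply PiLp.ext
  intro i
  fin_cases i
  · exact h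
  · exact h1

theorem SobolevH.norm_sq_one (u : SobolevH 1) :
    ‖u‖ ^ 2 = ‖SobolevH.D 0 u‖ ^ 2 + ‖SobolevH.D 1 u‖ ^ 2 := by
  have : ‖u‖ = ‖(u : PiLp 2 (fun _ : Fin 2 => L2R))‖ := rfl
  rw [this, PiLp.norm_sq_eq_of_L2, Fin.sum_univ_two]
  rfl

theorem SobolevH.inner_one (u w : SobolevH 1) :
    ⟪u, w⟫ = ⟪SobolevH.D 0 u, SobolevH.D 0 w⟫ + ⟪SobolevH.D 1 u, SobolevH.D 1 w⟫ := by
  have : ⟪u, w⟫ = ⟪(u : PiLp 2 (fun _ : Fin 2 => L2R)), (w : PiLp 2 (fun _ : Fin 2 => L2R))⟫ := rfl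
  rw [this, PiLp.inner_apply, Fin.sum_univ_two]
  rfl

theorem SobolevH.norm_D_le {k : ℕ} (i : Fin (k + 1)) (u : SobolevH k) : ‖SobolevH.D i u‖ ≤ ‖u‖ :=
  PiLp.norm_apply_le (u : PiLp 2 (fun _ : Fin (k + 1) => L2R)) i

theorem SobolevH.norm_one_le (u : SobolevH 1) :
    ‖u‖ ≤ ‖SobolevH.D 0 u‖ + ‖SobolevH.D 1 u‖ := by
  refine abs_le_of_sq_le_sq' ?_ (by positivity) |>.2
  rw [(SobolevH.norm_sq_one u)]
  nlinarith [norm_nonneg (SobolevH.D 0 u), norm_nonneg (SobolevH.D 1 u)]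

theorem SobolevH.continuous_one_iff {X : Type*} [TopologicalSpace X] {g : X → SobolevH 1} :
    Continuous g ↔ Continuous (fun x => SobolevH.D 0 (g x)) ∧
      Continuous fun x => SobolevH.D 1 (g x) := by
  refine ⟨fun h => ⟨(SobolevH.D 0).continuous.comp h, (SobolevH.D 1).continuous.comp h⟩,
    fun h => ?_⟩
  rw [continuous_iff_continuousAt]
  intro x
  rw [ContinuousAt, tendsto_iff_norm_sub_tendsto_zero]
  have h0 := tendsto_iff_norm_sub_tendsto_zero.mp (h.1.tendsto x)
  have h1 := tendsto_iff_norm_sub_tendsto_zero.mp (h.2.tendsto x)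
  refine squeeze_zero (fun _ => norm_nonneg _) (fun y => ?_) (by simpa using h0.add h1)
  simpa only [map_sub] using SobolevH.norm_one_le (g y - g x)

theorem IsTest.isWeakDeriv {φ : ℝ → ℝ} (hφ : IsTest φ) :
    IsWeakDeriv (toL2 φ) (toL2 (deriv φ)) := by
  intro ψ h1 h2
  have hψ : IsTest ψ := ⟨h1, h2⟩
  have e1 : ∫ s, toL2 φ s * deriv ψ s = ∫ s, φ s * deriv ψ s :=
    integral_congr_ae ((coeFn_toL2 hφ.memLp).mono fun s hs => by simp only [hs])
  have e2 : ∫ s, toL2 (deriv φ) s * ψ s = ∫ s, deriv φ s * ψ s :=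
    integral_congr_ae ((coeFn_toL2 hφ.deriv.memLp).mono fun s hs => by simp only [hs])
  rw [e1, e2]
  exact integral_mul_deriv_eq_deriv_mul_of_integrable (fun x _ => hφ.hasDerivAt x)
    (fun x _ => hψ.hasDerivAt x)
    (MemLp.integrable_mul (p := 2) (q := 2) hφ.memLp hψ.deriv.memLp)
    (MemLp.integrable_mul (p := 2) (q := 2) hφ.deriv.memLp hψ.memLp)
    (MemLp.integrable_mul (p := 2) (q := 2) hφ.memLp hψ.memLp)

/-- A test function as an element of `H¹(ℝ)`. -/
def IsTest.toH1 {φ : ℝ → ℝ} (hφ : IsTest φ) : SobolevH 1 :=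
  SobolevH.mk₁ (toL2 φ) (toL2 (deriv φ)) hφ.isWeakDeriv

/-- Two functions in `L²(ℝ)` that are weak derivatives of each other vanish: translates of their
sum grow exponentially, and translates of their difference decay, while translations are
isometries. -/
theorem IsWeakDeriv.eq_zero_of_symm {u w : L2R} (h : IsWeakDeriv u w) (h' : IsWeakDeriv w u) :
    u = 0 := by
  have key : ∀ (c : ℝ) (y : L2R), c ≠ 0 →
      (∀ t, HasDerivAt (fun t => shift t y) (c • shift t y) t) → y = 0 := by
    intro c y hc hy
    have hd : ∀ t, HasDerivAt (fun t => Real.exp (-(c * t)) • shift t y) 0 t := fun t => by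
      have h1 : HasDerivAt (fun t => Real.exp (-(c * t))) (Real.exp (-(c * t)) * -(c * 1)) t :=
        ((hasDerivAt_id t).const_mul c).neg.exp
      refine (h1.smul (hy t)).congr_deriv ?_
      rw [smul_smul, ← add_smul]
      ring_nf
      simp
    have h2 := is_const_of_deriv_eq_zero (fun t => (hd t).differentiableAt)
      (fun t => (hd t).deriv) 1 0
    have h3 := congrArg norm h2
    simp only [norm_smul, LinearIsometry.norm_map, Real.norm_eq_abs, Real.abs_exp, mul_zero,
      neg_zero, Real.exp_zero, abs_one, mul_one, one_mul] at h3
    by_contra hne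
    have h4 : Real.exp (-c) = 1 := by
      have := norm_pos_iff.mpr hne
      exact mul_right_cancel₀ this.ne' (h3.trans (one_mul _).symm)
    rw [Real.exp_eq_one_iff] at h4
    exact hc (by linarith)
  have h1 := key 1 (u + w) one_ne_zero fun t => by
    have := (h.hasDerivAt_shift t).add (h'.hasDerivAt_shift t)
    simp only [map_add, one_smul]
    rwa [add_comm (shift t u)]
  have h2 := key (-1) (u - w) (by norm_num) fun t => by
    have := (h.hasDerivAt_shift t).sub (h'.hasDerivAt_shift t)
    simp only [map_sub]
    rwa [neg_smul, one_smul, neg_sub]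
  have h3 : (2 : ℝ) • u = (u + w) + (u - w) := by
    rw [two_smul]; abel
  rw [h1, h2, add_zero] at h3
  simpa using h3

/-- Density of test functions in `H¹(ℝ)`, as an induction principle. -/
theorem SobolevH.induction_on_test {P : SobolevH 1 → Prop} (hP : IsClosed {u | P u})
    (h : ∀ φ (hφ : IsTest φ), P hφ.toH1) (u : SobolevH 1) : P u := by
  let K : Submodule ℝ (SobolevH 1) :=
    { carrier := {u | ∃ φ, ∃ hφ : IsTest φ, u = hφ.toH1}
      zero_mem' := ⟨0, ⟨contDiff_const, HasCompactSupport.zero⟩, SobolevH.ext_one (by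
        apply Lp.ext
        filter_upwards [coeFn_toL2 (g := 0) MemLp.zero, Lp.coeFn_zero ℝ 2 (volume : Measure ℝ)]
          with s h1 h2
        simp only [map_zero, IsTest.toH1, SobolevH.D_zero_mk₁]
        rw [h1, h2])⟩
      add_mem' := by
        rintro _ _ ⟨φ, hφ, rfl⟩ ⟨ψ, hψ, rfl⟩
        have hs : IsTest (φ + ψ) := ⟨hφ.smooth.add hψ.smooth, hφ.supp.add hψ.supp⟩
        refine ⟨φ + ψ, hs, SobolevH.ext_one ?_⟩
        simp only [map_add, IsTest.toH1, SobolevH.D_zero_mk₁]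
        rw [toL2_eq hφ.memLp, toL2_eq hψ.memLp, toL2_eq hs.memLp]
        rfl
      smul_mem' := by
        rintro c _ ⟨φ, hφ, rfl⟩
        have hs : IsTest (c • φ) := ⟨hφ.smooth.const_smul c, hφ.supp.mono (by
          intro s hs h0
          exact hs (by simp [h0]))⟩
        refine ⟨c • φ, hs, SobolevH.ext_one ?_⟩
        simp only [map_smul, IsTest.toH1, SobolevH.D_zero_mk₁]
        rw [toL2_eq hφ.memLp, toL2_eq hs.memLp]
        rfl }
  have hK : K.topologicalClosure = ⊤ := by
    rw [Submodule.topologicalClosure_eq_top_iff, Submodule.eq_bot_iff]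
    intro v hv
    have h1 : IsWeakDeriv (SobolevH.D 1 v) (SobolevH.D 0 v) := by
      rw [isWeakDeriv_iff]
      intro φ hφ
      have h2 := (Submodule.mem_orthogonal' K v).mp hv _ ⟨φ, hφ, rfl⟩
      rw [SobolevH.inner_one] at h2
      simp only [IsTest.toH1, SobolevH.D_zero_mk₁, SobolevH.D_one_mk₁] at h2
      linarith
    exact SobolevH.ext_one (by simpa using (SobolevH.isWeakDeriv_one v).eq_zero_of_symm h1)
  have hu : u ∈ closure (K : Set (SobolevH 1)) := by
    rw [← Submodule.topologicalClosure_coe, hK]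
    trivial
  refine closure_minimal ?_ hP hu
  rintro _ ⟨φ, hφ, rfl⟩
  exact h φ hφ

/-- This follows by integrating `(φ²)' = 2 φ φ'` over `(-∞, s]`. -/
theorem IsTest.sq_le_integral {φ : ℝ → ℝ} (hφ : IsTest φ) (s : ℝ) :
    φ s ^ 2 ≤ ∫ x, (φ x ^ 2 + deriv φ x ^ 2) := by
  have i1 : Integrable fun s => φ s ^ 2 := hφ.memLp.integrable_sq
  have i2 : Integrable fun s => deriv φ s ^ 2 := hφ.deriv.memLp.integrable_sq
  have hsq : ∀ s, deriv (fun s => φ s ^ 2) s = 2 * φ s * deriv φ s := fun s => by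
    have := ((hφ.hasDerivAt s).fun_pow 2).deriv
    rw [this]
    ring
  have hc : HasCompactSupport fun s => φ s ^ 2 :=
    hφ.supp.comp_left (g := fun x : ℝ => x ^ 2) (by norm_num)
  have hd : ContDiff ℝ 1 fun s => φ s ^ 2 := (hφ.smooth.of_le (by simp)).pow 2
  have h2 : ∫ x in Iic s, 2 * φ x * deriv φ x = φ s ^ 2 := by
    rw [← hc.integral_Iic_deriv_eq hd s]
    exact integral_congr_ae (Eventually.of_forall fun x => (hsq x).symm)
  have i3 : Integrable fun x => 2 * φ x * deriv φ x := by
    have := (MemLp.integrable_mul (p := 2) (q := 2) hφ.memLp hφ.deriv.memLp).const_mul 2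
    refine this.congr (Eventually.of_forall fun x => ?_)
    simp only [Pi.mul_apply]
    ring
  rw [← h2]
  calc ∫ x in Iic s, 2 * φ x * deriv φ x
      ≤ ∫ x in Iic s, (φ x ^ 2 + deriv φ x ^ 2) :=
        setIntegral_mono i3.integrableOn (i1.add i2).integrableOn fun x => by
          show 2 * φ x * deriv φ x ≤ φ x ^ 2 + deriv φ x ^ 2
          nlinarith [sq_nonneg (φ x - deriv φ x)]
    _ ≤ ∫ x, (φ x ^ 2 + deriv φ x ^ 2) :=
        setIntegral_le_integral (i1.add i2) (Eventually.of_forall fun x => by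
          show 0 ≤ φ x ^ 2 + deriv φ x ^ 2
          positivity)

theorem norm_sq_toL2 {g : ℝ → ℝ} (h : MemLp g 2 volume) : ‖toL2 g‖ ^ 2 = ∫ s, g s ^ 2 := by
  rw [norm_sq_eq_integral]
  exact integral_congr_ae ((coeFn_toL2 h).mono fun s hs => by simp only [hs])

theorem IsTest.abs_le_norm {φ : ℝ → ℝ} (hφ : IsTest φ) (s : ℝ) : |φ s| ≤ ‖hφ.toH1‖ := by
  refine abs_le_of_sq_le_sq ((hφ.sq_le_integral s).trans_eq ?_) (norm_nonneg _)
  rw [SobolevH.norm_sq_one, IsTest.toH1, SobolevH.D_zero_mk₁, SobolevH.D_one_mk₁,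
    norm_sq_toL2 hφ.memLp, norm_sq_toL2 hφ.deriv.memLp]
  exact integral_add hφ.memLp.integrable_sq hφ.deriv.memLp.integrable_sq

/-- The embedding of `H¹(ℝ)` in `L^∞(ℝ)`. -/
theorem SobolevH.ae_abs_le_norm (u : SobolevH 1) : ∀ᵐ s : ℝ, |SobolevH.D 0 u s| ≤ ‖u‖ := by
  refine SobolevH.induction_on_test (P := fun u => ∀ᵐ s : ℝ, |SobolevH.D 0 u s| ≤ ‖u‖)
    (IsSeqClosed.isClosed fun x v hx hv => ?_) (fun φ hφ => ?_) u
  · have h1 : Tendsto (fun n => SobolevH.D 0 (x n)) atTop (𝓝 (SobolevH.D 0 v)) :=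
      ((SobolevH.D 0).continuous.tendsto v).comp hv
    obtain ⟨ns, hns, h2⟩ := (tendstoInMeasure_of_tendsto_Lp h1).exists_seq_tendsto_ae
    have h3 : ∀ᵐ s : ℝ, ∀ n, |SobolevH.D 0 (x n) s| ≤ ‖x n‖ := ae_all_iff.mpr hx
    filter_upwards [h2, h3] with s hs2 hs3
    exact le_of_tendsto_of_tendsto' hs2.abs ((hv.comp hns.tendsto_atTop).norm) fun n => hs3 _
  · filter_upwards [coeFn_toL2 hφ.memLp] with s hs
    show |toL2 φ s| ≤ _
    rw [hs]
    exact hφ.abs_le_norm s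

theorem IsWeakDeriv.shift {u w : L2R} (h : IsWeakDeriv u w) (t : ℝ) :
    IsWeakDeriv (shift t u) (shift t w) := by
  rw [isWeakDeriv_iff]
  intro φ hφ
  rw [inner_shift, inner_shift, shift_toL2 hφ.memLp, shift_toL2 hφ.deriv.memLp,
    ← isWeakDeriv_iff.mp h _ (hφ.comp_add (-t))]
  congr 2
  funext s
  exact (deriv_comp_add_const (f := φ) (a := -t) (x := s)).symm

/-- Translations of `H¹(ℝ)`. -/
def shift₁ (t : ℝ) : SobolevH 1 →ₗᵢ[ℝ] SobolevH 1 where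
  toFun u := SobolevH.mk₁ (shift t (SobolevH.D 0 u)) (shift t (SobolevH.D 1 u))
    ((SobolevH.isWeakDeriv_one u).shift t)
  map_add' u w := SobolevH.ext_one ((shift t).map_add (SobolevH.D 0 u) (SobolevH.D 0 w))
  map_smul' c u := SobolevH.ext_one ((shift t).map_smul c (SobolevH.D 0 u))
  norm_map' u := by
    have h := SobolevH.norm_sq_one (SobolevH.mk₁ (shift t (SobolevH.D 0 u))
      (shift t (SobolevH.D 1 u)) ((SobolevH.isWeakDeriv_one u).shift t))
    rw [SobolevH.D_zero_mk₁, SobolevH.D_one_mk₁, (shift t).norm_map, (shift t).norm_map,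
      ← SobolevH.norm_sq_one] at h
    exact (sq_eq_sq₀ (norm_nonneg _) (norm_nonneg _)).mp h

@[simp] theorem D_zero_shift₁ (t : ℝ) (u : SobolevH 1) :
    SobolevH.D 0 (shift₁ t u) = shift t (SobolevH.D 0 u) := rfl

@[simp] theorem D_one_shift₁ (t : ℝ) (u : SobolevH 1) :
    SobolevH.D 1 (shift₁ t u) = shift t (SobolevH.D 1 u) := rfl

theorem shift₁_zero (u : SobolevH 1) : shift₁ 0 u = u :=
  SobolevH.ext_one (by simp [shift_zero])

theorem continuous_shift₁ : Continuous fun q : ℝ × SobolevH 1 => shift₁ q.1 q.2 := by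
  rw [SobolevH.continuous_one_iff]
  simp only [D_zero_shift₁, D_one_shift₁]
  exact ⟨continuous_shift.comp (continuous_fst.prodMk ((SobolevH.D 0).continuous.comp
      continuous_snd)),
    continuous_shift.comp (continuous_fst.prodMk ((SobolevH.D 1).continuous.comp continuous_snd))⟩

/-- The product rule for a moving curve in `H¹(ℝ)`: `∂ₜ (S(ct) y) = S(ct) (c ∂y + y')`, in
`L²(ℝ)`. -/
theorem HasDerivWithinAt.shift_D_zero {y : ℝ → SobolevH 1} {y' : SobolevH 1} {s : Set ℝ} {t : ℝ}
    (c : ℝ)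
    (hy : HasDerivWithinAt y y' s t) :
    HasDerivWithinAt (fun τ => shift (c * τ) (SobolevH.D 0 (y τ)))
      (shift (c * t) (c • SobolevH.D 1 (y t) + SobolevH.D 0 y')) s t := by
  have h1 : HasDerivWithinAt (fun τ => shift (c * τ) (SobolevH.D 0 (y t)))
      (c • shift (c * t) (SobolevH.D 1 (y t))) s t := by
    have h2 : HasDerivAt (fun τ => c * τ) c t := by simpa using (hasDerivAt_id t).const_mul c
    exact (((SobolevH.isWeakDeriv_one (y t)).hasDerivAt_shift (c * t)).scomp t h2).hasDerivWithinAt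
  have h3 : HasDerivWithinAt
      (fun τ => shift (c * τ) (SobolevH.D 0 (y τ) - SobolevH.D 0 (y t)))
      (shift (c * t) (SobolevH.D 0 y')) s t := by
    rw [hasDerivWithinAt_iff_tendsto_slope]
    have h4 : Tendsto (fun τ => slope (fun τ => SobolevH.D 0 (y τ)) t τ) (𝓝[s \ {t}] t)
        (𝓝 (SobolevH.D 0 y')) := by
      have := (SobolevH.D (k := 1) 0).hasFDerivAt.comp_hasDerivWithinAt t hy
      exact hasDerivWithinAt_iff_tendsto_slope.mp this
    have h5 : Tendsto (fun τ : ℝ => c * τ) (𝓝[s \ {t}] t) (𝓝 (c * t)) :=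
      (Continuous.tendsto (by fun_prop) t).mono_left nhdsWithin_le_nhds
    have h6 := (continuous_shift.tendsto (c * t, SobolevH.D 0 y')).comp (h5.prodMk_nhds h4)
    refine h6.congr fun τ => ?_
    simp only [Function.comp, slope_def_module, map_smul, sub_self, map_zero, sub_zero]
  have := h1.add h3
  rw [map_add, map_smul]
  refine this.congr_of_eventuallyEq (Eventually.of_forall fun τ => ?_) ?_
  · simp [map_sub]
  · simp [map_sub]

/-! ### The area radius and the coefficients of the equation -/

/-- The Regge-Wheeler coordinate stretches distances. -/
theorem sub_le_reggeWheeler_sub {M a b : ℝ} (hM : 0 < M) (ha : 2 * M < a) (hab : a ≤ b) :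
    b - a ≤ reggeWheeler M b - reggeWheeler M a := by
  have h : Real.log (a - 2 * M) ≤ Real.log (b - 2 * M) :=
    Real.log_le_log (by linarith) (by linarith)
  have h2 := mul_le_mul_of_nonneg_left h (by linarith : 0 ≤ 2 * M)
  unfold reggeWheeler
  linarith

section Radius

variable {M : ℝ} (hM : 0 < M)
include hM

theorem areaRadius_pos (s : ℝ) : 0 < areaRadius M s := by
  linarith [areaRadius_gt hM s]

theorem areaRadius_mono : Monotone (areaRadius M) := by
  intro s t hst
  by_contra! h
  have h1 := sub_le_reggeWheeler_sub hM (areaRadius_gt hM t) h.le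
  rw [reggeWheeler_areaRadius hM, reggeWheeler_areaRadius hM] at h1
  linarith

theorem areaRadius_sub_le {s t : ℝ} (hst : s ≤ t) : areaRadius M t - areaRadius M s ≤ t - s := by
  have h1 := sub_le_reggeWheeler_sub hM (areaRadius_gt hM s) (areaRadius_mono hM hst)
  rwa [reggeWheeler_areaRadius hM, reggeWheeler_areaRadius hM] at h1

theorem areaRadius_le (s : ℝ) : areaRadius M s ≤ areaRadius M 0 + |s| := by
  rcases le_total 0 s with h | h
  · have := areaRadius_sub_le hM h
    rw [abs_of_nonneg h]
    linarith
  · have := areaRadius_mono hM h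
    linarith [abs_nonneg s]

theorem continuous_areaRadius : Continuous (areaRadius M) := by
  refine (LipschitzWith.of_le_add fun s t => ?_ : LipschitzWith 1 _).continuous
  rw [Real.dist_eq]
  rcases le_total s t with h | h
  · linarith [areaRadius_mono hM h, abs_nonneg (s - t)]
  · linarith [areaRadius_sub_le hM h, le_abs_self (s - t)]

theorem lapseF_pos (s : ℝ) : 0 < lapseF M s := by
  unfold lapseF
  have := areaRadius_gt hM s
  rw [sub_pos, div_lt_one (areaRadius_pos hM s)]
  exact this

theorem lapseF_lt_one (s : ℝ) : lapseF M s < 1 := by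
  unfold lapseF
  have : 0 < 2 * M / areaRadius M s := div_pos (by linarith) (areaRadius_pos hM s)
  linarith

theorem hasDerivAt_areaRadius (s : ℝ) : HasDerivAt (areaRadius M) (lapseF M s) s := by
  have hr := areaRadius_gt hM s
  have hr0 := areaRadius_pos hM s
  have hne : areaRadius M s - 2 * M ≠ 0 := by linarith
  have h1 : HasDerivAt (reggeWheeler M) (lapseF M s)⁻¹ (areaRadius M s) := by
    have h2 : HasDerivAt (fun r => r + 2 * M * Real.log (r - 2 * M))
        (1 + 2 * M * (1 / (areaRadius M s - 2 * M))) (areaRadius M s) :=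
      (hasDerivAt_id _).add
        ((((hasDerivAt_id (areaRadius M s)).sub_const (2 * M)).log hne).const_mul (2 * M))
    refine h2.congr_deriv ?_
    unfold lapseF
    field_simp
    ring
  have h3 := HasDerivAt.of_local_left_inverse (continuous_areaRadius hM).continuousAt h1
    (inv_ne_zero (lapseF_pos hM s).ne')
    (Eventually.of_forall fun t => reggeWheeler_areaRadius hM t)
  rwa [inv_inv] at h3

theorem contDiff_areaRadius : ContDiff ℝ ∞ (areaRadius M) := by
  rw [contDiff_infty]
  intro n
  induction n with
  | zero => exact contDiff_zero.mpr (continuous_areaRadius hM)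
  | succ n ih =>
    push_cast
    rw [contDiff_succ_iff_deriv]
    refine ⟨fun s => (hasDerivAt_areaRadius hM s).differentiableAt, by simp, ?_⟩
    have : deriv (areaRadius M) = fun s => 1 - 2 * M / areaRadius M s :=
      funext fun s => (hasDerivAt_areaRadius hM s).deriv
    rw [this]
    exact contDiff_const.sub (contDiff_const.div ih fun s => (areaRadius_pos hM s).ne')

theorem contDiff_lapseF : ContDiff ℝ ∞ (lapseF M) :=
  contDiff_const.sub (contDiff_const.div (contDiff_areaRadius hM)
    fun s => (areaRadius_pos hM s).ne')

theorem hasDerivAt_lapseF (s : ℝ) :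
    HasDerivAt (lapseF M) (2 * M / areaRadius M s ^ 2 * lapseF M s) s := by
  have hr0 := (areaRadius_pos hM s).ne'
  have h := ((hasDerivAt_areaRadius hM s).inv hr0).const_mul (2 * M) |>.const_sub 1
  refine (h.congr_deriv ?_).congr_of_eventuallyEq (Eventually.of_forall fun t => ?_)
  · field_simp
  · simp only [lapseF, div_eq_mul_inv, Pi.inv_apply]

theorem contDiff_potentialW : ContDiff ℝ ∞ (potentialW M) :=
  (contDiff_const.mul (contDiff_lapseF hM)).div ((contDiff_areaRadius hM).pow 3)
    fun s => (pow_pos (areaRadius_pos hM s) 3).ne'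

theorem potentialW_nonneg (s : ℝ) : 0 ≤ potentialW M s := by
  have := areaRadius_pos hM s
  have := lapseF_pos hM s
  unfold potentialW
  positivity

/-- The potential is the derivative of the bounded function `-M / r²`, hence integrable. -/
theorem hasDerivAt_neg_div_sq (s : ℝ) :
    HasDerivAt (fun s => -(M / areaRadius M s ^ 2)) (potentialW M s) s := by
  have hr0 := (areaRadius_pos hM s).ne'
  have h := (((hasDerivAt_areaRadius hM s).fun_pow 2).fun_inv
    (pow_ne_zero 2 hr0)).const_mul M |>.neg
  refine (h.congr_deriv ?_).congr_of_eventuallyEq (Eventually.of_forall fun t => ?_)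
  · unfold potentialW
    field_simp
    norm_num
    ring
  · simp only [div_eq_mul_inv, Pi.neg_apply]

theorem hasDerivAt_potentialW (s : ℝ) :
    HasDerivAt (potentialW M)
      (lapseF M s * (4 * M ^ 2 / areaRadius M s ^ 5 - 6 * M * lapseF M s / areaRadius M s ^ 4))
      s := by
  have hr0 := (areaRadius_pos hM s).ne'
  have h := ((hasDerivAt_lapseF hM s).const_mul (2 * M)).div
    ((hasDerivAt_areaRadius hM s).fun_pow 3) (pow_ne_zero 3 hr0)
  refine (h.congr_deriv ?_).congr_of_eventuallyEq (Eventually.of_forall fun t => ?_)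
  · field_simp
    push_cast
    ring
  · rfl

theorem one_div_areaRadius_pow_le (n : ℕ) (s : ℝ) :
    1 / areaRadius M s ^ n ≤ 1 / (2 * M) ^ n := by
  have := areaRadius_gt hM s
  gcongr

theorem areaRadius_rpow_le {a : ℝ} (ha : a ≤ 0) (s : ℝ) :
    areaRadius M s ^ a ≤ (2 * M) ^ a :=
  Real.rpow_le_rpow_of_nonpos (by linarith) (areaRadius_gt hM s).le ha

theorem exists_potentialW_bound :
    ∃ C, ∀ s, |potentialW M s| ≤ C ∧ |deriv (potentialW M) s| ≤ C := by
  refine ⟨2 * M * (1 / (2 * M) ^ 3) +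
    (4 * M ^ 2 * (1 / (2 * M) ^ 5) + 6 * M * (1 / (2 * M) ^ 4)), fun s => ?_⟩
  have hF0 := (lapseF_pos hM s).le
  have hF1 := (lapseF_lt_one hM s).le
  have hr := areaRadius_pos hM s
  have h3 := one_div_areaRadius_pow_le hM 3 s
  have h4 := one_div_areaRadius_pow_le hM 4 s
  have h5 := one_div_areaRadius_pow_le hM 5 s
  have p4 : 0 < 1 / areaRadius M s ^ 4 := by positivity
  have p5 : 0 < 1 / areaRadius M s ^ 5 := by positivity
  have c3 : 0 ≤ 2 * M * (1 / (2 * M) ^ 3) := by positivity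
  have c45 : 0 ≤ 4 * M ^ 2 * (1 / (2 * M) ^ 5) + 6 * M * (1 / (2 * M) ^ 4) := by positivity
  constructor
  · rw [abs_of_nonneg (potentialW_nonneg hM s)]
    have : potentialW M s = 2 * M * lapseF M s * (1 / areaRadius M s ^ 3) := by
      unfold potentialW; ring
    rw [this]
    have : 2 * M * lapseF M s * (1 / areaRadius M s ^ 3) ≤ 2 * M * 1 * (1 / (2 * M) ^ 3) := by
      gcongr
    linarith
  · rw [(hasDerivAt_potentialW hM s).deriv, abs_mul, abs_of_nonneg hF0]
    have e1 : |4 * M ^ 2 / areaRadius M s ^ 5 - 6 * M * lapseF M s / areaRadius M s ^ 4| ≤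
        4 * M ^ 2 * (1 / (2 * M) ^ 5) + 6 * M * (1 / (2 * M) ^ 4) := by
      refine (abs_sub _ _).trans ?_
      have : 4 * M ^ 2 / areaRadius M s ^ 5 = 4 * M ^ 2 * (1 / areaRadius M s ^ 5) := by ring
      have h' : 6 * M * lapseF M s / areaRadius M s ^ 4 =
          6 * M * lapseF M s * (1 / areaRadius M s ^ 4) := by ring
      rw [this, h', abs_of_nonneg (by positivity), abs_of_nonneg (by positivity)]
      have : 6 * M * lapseF M s * (1 / areaRadius M s ^ 4) ≤ 6 * M * 1 * (1 / (2 * M) ^ 4) := by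
        gcongr
      have : 4 * M ^ 2 * (1 / areaRadius M s ^ 5) ≤ 4 * M ^ 2 * (1 / (2 * M) ^ 5) := by gcongr
      linarith
    have := mul_le_mul hF1 e1 (abs_nonneg _) zero_le_one
    linarith

theorem nonlinWeight_pos (p s : ℝ) : 0 < nonlinWeight M p s :=
  mul_pos (lapseF_pos hM s) (Real.rpow_pos_of_pos (areaRadius_pos hM s) _)

theorem contDiff_nonlinWeight (p : ℝ) : ContDiff ℝ ∞ (nonlinWeight M p) :=
  (contDiff_lapseF hM).mul ((contDiff_areaRadius hM).rpow_const_of_ne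
    fun s => (areaRadius_pos hM s).ne')

theorem exists_nonlinWeight_bound {p : ℝ} (hp : 1 ≤ p) :
    ∃ C, ∀ s, |nonlinWeight M p s| ≤ C ∧ |deriv (nonlinWeight M p) s| ≤ C := by
  refine ⟨(2 * M) ^ (1 - p) + (2 * M * (1 / (2 * M) ^ 2) * (2 * M) ^ (1 - p) +
    (p - 1) * (2 * M) ^ (-p)), fun s => ?_⟩
  have hF0 := (lapseF_pos hM s).le
  have hF1 := (lapseF_lt_one hM s).le
  have hr := areaRadius_pos hM s
  have h1 := areaRadius_rpow_le hM (by linarith : 1 - p ≤ 0) s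
  have h2 := areaRadius_rpow_le hM (by linarith : -p ≤ 0) s
  have h3 := one_div_areaRadius_pow_le hM 2 s
  have q1 : 0 < areaRadius M s ^ (1 - p) := Real.rpow_pos_of_pos hr _
  have q2 : 0 < areaRadius M s ^ (-p) := Real.rpow_pos_of_pos hr _
  have r1 : 0 < (2 * M) ^ (1 - p) := Real.rpow_pos_of_pos (by linarith) _
  have r2 : 0 < (2 * M) ^ (-p) := Real.rpow_pos_of_pos (by linarith) _
  have hp0 : 0 ≤ p - 1 := by linarith
  constructor
  · rw [abs_of_pos (nonlinWeight_pos hM p s)]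
    unfold nonlinWeight
    have : lapseF M s * areaRadius M s ^ (1 - p) ≤ 1 * (2 * M) ^ (1 - p) := by gcongr
    have : 0 ≤ 2 * M * (1 / (2 * M) ^ 2) * (2 * M) ^ (1 - p) + (p - 1) * (2 * M) ^ (-p) := by
      positivity
    linarith
  · have hd : HasDerivAt (nonlinWeight M p) (2 * M / areaRadius M s ^ 2 * lapseF M s *
        areaRadius M s ^ (1 - p) + lapseF M s * (lapseF M s * (1 - p) *
          areaRadius M s ^ (1 - p - 1))) s :=
      (hasDerivAt_lapseF hM s).mul ((hasDerivAt_areaRadius hM s).rpow_const (Or.inl hr.ne'))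
    rw [hd.deriv, show 1 - p - 1 = -p by ring]
    have e1 : |2 * M / areaRadius M s ^ 2 * lapseF M s * areaRadius M s ^ (1 - p)| ≤
        2 * M * (1 / (2 * M) ^ 2) * (2 * M) ^ (1 - p) := by
      have : 2 * M / areaRadius M s ^ 2 * lapseF M s * areaRadius M s ^ (1 - p) =
          2 * M * (1 / areaRadius M s ^ 2) * lapseF M s * areaRadius M s ^ (1 - p) := by ring
      rw [this, abs_of_nonneg (by positivity)]
      have : 2 * M * (1 / areaRadius M s ^ 2) * lapseF M s * areaRadius M s ^ (1 - p) ≤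
          2 * M * (1 / (2 * M) ^ 2) * 1 * (2 * M) ^ (1 - p) := by gcongr
      linarith
    have e2 : |lapseF M s * (lapseF M s * (1 - p) * areaRadius M s ^ (-p))| ≤
        (p - 1) * (2 * M) ^ (-p) := by
      have : lapseF M s * (lapseF M s * (1 - p) * areaRadius M s ^ (-p)) =
          -(lapseF M s * (lapseF M s * ((p - 1) * areaRadius M s ^ (-p)))) := by ring
      rw [this, abs_neg, abs_of_nonneg (by positivity)]
      have : lapseF M s * (lapseF M s * ((p - 1) * areaRadius M s ^ (-p))) ≤
          1 * (1 * ((p - 1) * (2 * M) ^ (-p))) := by gcongr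
      linarith
    refine (abs_add_le _ _).trans ?_
    linarith

/-- At the horizon the lapse decays no faster than `exp (s / 2M)`. -/
theorem exists_lapseF_ge : ∃ c : ℝ, 0 < c ∧ ∀ s, c * Real.exp (min s 0 / (2 * M)) ≤ lapseF M s := by
  set r₀ := areaRadius M 0 with hr₀
  have hr₀pos : 0 < r₀ := areaRadius_pos hM 0
  refine ⟨Real.exp (-r₀ / (2 * M)) / r₀, by positivity, fun s => ?_⟩
  have key : ∀ s ≤ 0, Real.exp (-r₀ / (2 * M)) / r₀ * Real.exp (s / (2 * M)) ≤ lapseF M s := by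
    intro s hs
    have hr := areaRadius_pos hM s
    have hrr : areaRadius M s ≤ r₀ := areaRadius_mono hM hs
    have h1 := reggeWheeler_areaRadius hM s
    have hpos : 0 < areaRadius M s - 2 * M := by linarith [areaRadius_gt hM s]
    have h2 : areaRadius M s - 2 * M = Real.exp ((s - areaRadius M s) / (2 * M)) := by
      rw [← Real.exp_log hpos]
      congr 1
      unfold reggeWheeler at h1
      field_simp
      linarith
    have h3 : lapseF M s = Real.exp ((s - areaRadius M s) / (2 * M)) / areaRadius M s := by
      rw [← h2]
      unfold lapseF
      field_simp
    rw [h3, div_mul_eq_mul_div, ← Real.exp_add]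
    have : -r₀ / (2 * M) + s / (2 * M) ≤ (s - areaRadius M s) / (2 * M) := by
      rw [← add_div]
      gcongr
      linarith
    gcongr
  rcases le_total s 0 with h | h
  · rw [min_eq_left h]
    exact key s h
  · rw [min_eq_right h]
    refine (key 0 le_rfl).trans ?_
    unfold lapseF
    have := areaRadius_mono hM h
    have := areaRadius_pos hM 0
    gcongr

end Radius

/-! ### The nonlinearity on `H¹(ℝ)` -/

theorem hasDerivAt_mul_abs_rpow {q : ℝ} (hq : 0 < q) (x : ℝ) :
    HasDerivAt (fun x : ℝ => |x| ^ q * x) ((q + 1) * |x| ^ q) x := by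
  rcases eq_or_ne x 0 with rfl | hx
  · rw [abs_zero, Real.zero_rpow hq.ne', mul_zero, hasDerivAt_iff_tendsto_slope]
    have h : Tendsto (fun y : ℝ => |y| ^ q) (𝓝[≠] 0) (𝓝 0) := by
      have hc : Continuous fun y : ℝ => |y| ^ q :=
        continuous_abs.rpow_const fun _ => Or.inr hq.le
      have := hc.tendsto 0
      rw [abs_zero, Real.zero_rpow hq.ne'] at this
      exact this.mono_left nhdsWithin_le_nhds
    refine h.congr' ?_
    filter_upwards [self_mem_nhdsWithin] with y hy
    have hy' : y ≠ 0 := hy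
    simp only [slope_def_field, mul_zero, sub_zero]
    field_simp
  · have h1 := ((hasDerivAt_abs hx).rpow_const (p := q) (Or.inl (abs_ne_zero.mpr hx))).mul
      (hasDerivAt_id x)
    refine h1.congr_deriv ?_
    have h2 : |x| ^ (q - 1) * |x| = |x| ^ q := by
      rw [← Real.rpow_add_one (abs_ne_zero.mpr hx)]
      ring_nf
    have h3 : (SignType.sign x : ℝ) * x = |x| := by
      rw [mul_comm, self_mul_sign]
    simp only [id]
    rw [mul_one, ← h2, add_mul, one_mul, ← h3]
    ring

theorem abs_rpow_sub_le {p B x y : ℝ} (hp : 2 < p) (hx : |x| ≤ B) (hy : |y| ≤ B) :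
    |(|x| ^ p) - |y| ^ p| ≤ p * B ^ (p - 1) * |x - y| := by
  have hB : 0 ≤ B := (abs_nonneg x).trans hx
  have := (convex_Icc (-B) B).norm_image_sub_le_of_norm_hasDerivWithin_le
    (f := fun x : ℝ => |x| ^ p) (C := p * B ^ (p - 1))
    (fun z _ => (hasDerivAt_abs_rpow z (by linarith)).hasDerivWithinAt) (fun z hz => ?_)
    (abs_le.mp hy) (abs_le.mp hx)
  · exact this
  · have hz' : |z| ≤ B := abs_le.mpr hz
    rw [Real.norm_eq_abs, abs_mul, abs_mul, abs_of_pos (by linarith : 0 < p), mul_assoc,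
      abs_of_nonneg (Real.rpow_nonneg (abs_nonneg z) _)]
    refine mul_le_mul_of_nonneg_left ?_ (by linarith)
    calc |z| ^ (p - 2) * |z| = |z| ^ (p - 1) := by
          rw [← Real.rpow_add_one' (abs_nonneg z) (by linarith)]
          ring_nf
      _ ≤ B ^ (p - 1) := Real.rpow_le_rpow (abs_nonneg z) hz' (by linarith)

theorem abs_mul_abs_rpow_sub_le {p B x y : ℝ} (hp : 2 < p) (hx : |x| ≤ B) (hy : |y| ≤ B) :
    |(|x| ^ (p - 2) * x) - |y| ^ (p - 2) * y| ≤ (p - 1) * B ^ (p - 2) * |x - y| := by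
  have := (convex_Icc (-B) B).norm_image_sub_le_of_norm_hasDerivWithin_le
    (f := fun x : ℝ => |x| ^ (p - 2) * x) (C := (p - 1) * B ^ (p - 2))
    (fun z _ => (hasDerivAt_mul_abs_rpow (by linarith : 0 < p - 2) z).hasDerivWithinAt)
    (fun z hz => ?_) (abs_le.mp hy) (abs_le.mp hx)
  · exact this
  · have hz' : |z| ≤ B := abs_le.mpr hz
    rw [Real.norm_eq_abs, abs_mul, abs_of_pos (by linarith : 0 < p - 2 + 1),
      abs_of_nonneg (Real.rpow_nonneg (abs_nonneg z) _), show p - 2 + 1 = p - 1 by ring]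
    exact mul_le_mul_of_nonneg_left (Real.rpow_le_rpow (abs_nonneg z) hz' (by linarith))
      (by linarith)

/-- A `C¹` function that is bounded together with its derivative. -/
structure IsBddC1 (f : ℝ → ℝ) : Prop where
  contDiff : ContDiff ℝ 1 f
  bound : ∃ C, ∀ s, |f s| ≤ C ∧ |deriv f s| ≤ C

theorem IsBddC1.hasDerivAt {f : ℝ → ℝ} (h : IsBddC1 f) (s : ℝ) : HasDerivAt f (deriv f s) s :=
  ((h.contDiff.differentiable (by simp)) s).hasDerivAt

/-- The nonlinearity `f |u|^p - W u`. -/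
def nlin (f W : ℝ → ℝ) (p : ℝ) (u : ℝ → ℝ) (s : ℝ) : ℝ := f s * |u s| ^ p - W s * u s

/-- The derivative of `f |u|^p - W u`, if `w` is the derivative of `u`. -/
def nlinDeriv (f W : ℝ → ℝ) (p : ℝ) (u w : ℝ → ℝ) (s : ℝ) : ℝ :=
  deriv f s * |u s| ^ p + f s * (p * (|u s| ^ (p - 2) * u s) * w s) -
    (deriv W s * u s + W s * w s)

section

variable {f W : ℝ → ℝ} {p : ℝ}

/-- Pointwise Lipschitz bounds for the nonlinearity and its derivative at bounded arguments. -/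
theorem exists_nlin_bound (hf : IsBddC1 f) (hW : IsBddC1 W) (hp : 2 < p) {B : ℝ} (hB : 0 ≤ B) :
    ∃ K : ℝ, 0 ≤ K ∧ ∀ (u w v z : ℝ → ℝ) (s : ℝ), |u s| ≤ B → |v s| ≤ B →
      |nlin f W p u s - nlin f W p v s| ≤ K * |u s - v s| ∧
      |nlinDeriv f W p u w s - nlinDeriv f W p v z s| ≤
        K * |u s - v s| + K * (|u s - v s| * |w s|) + K * |w s - z s| := by
  obtain ⟨C, hC⟩ := hf.bound
  obtain ⟨D, hD⟩ := hW.bound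
  have hC0 : 0 ≤ C := (abs_nonneg _).trans (hC 0).1
  have hD0 : 0 ≤ D := (abs_nonneg _).trans (hD 0).1
  have hp0 : 0 ≤ p := by linarith
  have hp1 : 0 ≤ p - 1 := by linarith
  have hB1 : 0 ≤ B ^ (p - 1) := Real.rpow_nonneg hB _
  have hB2 : 0 ≤ B ^ (p - 2) := Real.rpow_nonneg hB _
  have k1 : 0 ≤ C * (p * B ^ (p - 1)) := by positivity
  have k2 : 0 ≤ C * (p * ((p - 1) * B ^ (p - 2))) := by positivity
  refine ⟨C * (p * B ^ (p - 1)) + D + C * (p * ((p - 1) * B ^ (p - 2))), by positivity,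
    fun u w v z s hu hv => ?_⟩
  have l1 := abs_rpow_sub_le hp hu hv
  have l2 := abs_mul_abs_rpow_sub_le hp hu hv
  have hv1 : |(|v s| ^ (p - 2) * v s)| ≤ B ^ (p - 1) := by
    rw [abs_mul, abs_of_nonneg (Real.rpow_nonneg (abs_nonneg _) _),
      ← Real.rpow_add_one' (abs_nonneg _) (by linarith), show p - 2 + 1 = p - 1 by ring]
    exact Real.rpow_le_rpow (abs_nonneg _) hv hp1
  obtain ⟨c1, c2⟩ := hC s
  obtain ⟨d1, d2⟩ := hD s
  set δ := |u s - v s| with hδ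
  have hδ0 : 0 ≤ δ := abs_nonneg _
  have t1 : ∀ a, |a| ≤ C → |a * (|u s| ^ p - |v s| ^ p)| ≤ C * (p * B ^ (p - 1)) * δ :=
    fun a ha => by
      rw [abs_mul]
      calc |a| * |(|u s| ^ p) - |v s| ^ p| ≤ C * (p * B ^ (p - 1) * δ) := by gcongr
        _ = _ := by ring
  have t2 : ∀ a, |a| ≤ D → |a * (u s - v s)| ≤ D * δ := fun a ha => by
    rw [abs_mul]
    gcongr
  constructor
  · have e : nlin f W p u s - nlin f W p v s =
        f s * (|u s| ^ p - |v s| ^ p) - W s * (u s - v s) := by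
      unfold nlin; ring
    rw [e]
    refine (abs_sub _ _).trans ?_
    have := t1 _ c1
    have := t2 _ d1
    nlinarith
  · have e : nlinDeriv f W p u w s - nlinDeriv f W p v z s =
        deriv f s * (|u s| ^ p - |v s| ^ p) +
        f s * (p * (|u s| ^ (p - 2) * u s - |v s| ^ (p - 2) * v s) * w s) +
        f s * (p * (|v s| ^ (p - 2) * v s) * (w s - z s)) -
        (deriv W s * (u s - v s) + W s * (w s - z s)) := by
      unfold nlinDeriv; ring
    have t3 : |f s * (p * (|u s| ^ (p - 2) * u s - |v s| ^ (p - 2) * v s) * w s)| ≤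
        C * (p * ((p - 1) * B ^ (p - 2))) * (δ * |w s|) := by
      rw [abs_mul, abs_mul, abs_mul, abs_of_nonneg hp0]
      calc |f s| * (p * |(|u s| ^ (p - 2) * u s) - |v s| ^ (p - 2) * v s| * |w s|)
          ≤ C * (p * ((p - 1) * B ^ (p - 2) * δ) * |w s|) := by gcongr
        _ = _ := by ring
    have t4 : |f s * (p * (|v s| ^ (p - 2) * v s) * (w s - z s))| ≤
        C * (p * B ^ (p - 1)) * |w s - z s| := by
      rw [abs_mul, abs_mul, abs_mul p, abs_of_nonneg hp0]
      calc |f s| * (p * |(|v s| ^ (p - 2) * v s)| * |w s - z s|)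
          ≤ C * (p * B ^ (p - 1) * |w s - z s|) := by gcongr
        _ = _ := by ring
    have t5 : |W s * (w s - z s)| ≤ D * |w s - z s| := by
      rw [abs_mul]
      gcongr
    have t6 := t1 _ c2
    have t7 := t2 _ d2
    rw [e]
    have t8 : |deriv f s * (|u s| ^ p - |v s| ^ p) +
        f s * (p * (|u s| ^ (p - 2) * u s - |v s| ^ (p - 2) * v s) * w s) +
        f s * (p * (|v s| ^ (p - 2) * v s) * (w s - z s)) -
        (deriv W s * (u s - v s) + W s * (w s - z s))| ≤
        C * (p * B ^ (p - 1)) * δ + C * (p * ((p - 1) * B ^ (p - 2))) * (δ * |w s|) +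
        C * (p * B ^ (p - 1)) * |w s - z s| + (D * δ + D * |w s - z s|) := by
      refine (abs_sub _ _).trans (add_le_add ((abs_add_le _ _).trans (add_le_add
        ((abs_add_le _ _).trans (add_le_add t6 t3)) t4)) ((abs_add_le _ _).trans
          (add_le_add t7 t5)))
    refine t8.trans ?_
    have hw0 : 0 ≤ |w s| := abs_nonneg _
    have hz0 : 0 ≤ |w s - z s| := abs_nonneg _
    have m1 : 0 ≤ C * (p * ((p - 1) * B ^ (p - 2))) * δ := by positivity
    have m2 : 0 ≤ C * (p * B ^ (p - 1)) * (δ * |w s|) := by positivity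
    have m3 : 0 ≤ D * (δ * |w s|) := by positivity
    have m4 : 0 ≤ C * (p * ((p - 1) * B ^ (p - 2))) * |w s - z s| := by positivity
    linarith

theorem aestronglyMeasurable_nlin (hf : IsBddC1 f) (hW : IsBddC1 W) (hp : 2 < p) (u : L2R) :
    AEStronglyMeasurable (nlin f W p u) volume := by
  have hu := (Lp.memLp u).1
  have h1 : AEStronglyMeasurable (fun s => |u s| ^ p) volume :=
    (continuous_abs.rpow_const fun _ => Or.inr (by linarith)).comp_aestronglyMeasurable hu
  exact (hf.contDiff.continuous.aestronglyMeasurable.mul h1).sub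
    (hW.contDiff.continuous.aestronglyMeasurable.mul hu)

theorem aestronglyMeasurable_nlinDeriv (hf : IsBddC1 f) (hW : IsBddC1 W) (hp : 2 < p)
    (u w : L2R) : AEStronglyMeasurable (nlinDeriv f W p u w) volume := by
  have hu := (Lp.memLp u).1
  have hw := (Lp.memLp w).1
  have h1 : AEStronglyMeasurable (fun s => |u s| ^ p) volume :=
    (continuous_abs.rpow_const fun _ => Or.inr (by linarith)).comp_aestronglyMeasurable hu
  have hcont : Continuous fun x : ℝ => p * (|x| ^ (p - 2) * x) :=
    continuous_const.mul ((continuous_abs.rpow_const fun _ => Or.inr (by linarith)).mul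
      continuous_id)
  have h2 : AEStronglyMeasurable (fun s => p * (|u s| ^ (p - 2) * u s)) volume :=
    hcont.comp_aestronglyMeasurable hu
  exact (((hf.contDiff.continuous_deriv (by simp)).aestronglyMeasurable.mul h1).add
    (hf.contDiff.continuous.aestronglyMeasurable.mul (h2.mul hw))).sub
    (((hW.contDiff.continuous_deriv (by simp)).aestronglyMeasurable.mul hu).add
      (hW.contDiff.continuous.aestronglyMeasurable.mul hw))

theorem nlin_zero (hp : 2 < p) (s : ℝ) : nlin f W p 0 s = 0 := by
  simp [nlin, Real.zero_rpow (by linarith : p ≠ 0)]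

theorem nlinDeriv_zero (hp : 2 < p) (s : ℝ) : nlinDeriv f W p 0 0 s = 0 := by
  simp [nlinDeriv, Real.zero_rpow (by linarith : p ≠ 0)]

theorem memLp_nlin (hf : IsBddC1 f) (hW : IsBddC1 W) (hp : 2 < p) (u : SobolevH 1) :
    MemLp (nlin f W p (SobolevH.D 0 u)) 2 volume := by
  obtain ⟨K, -, hK⟩ := exists_nlin_bound hf hW hp (norm_nonneg u)
  refine ((Lp.memLp (SobolevH.D 0 u)).norm.const_mul K).mono'
    (aestronglyMeasurable_nlin hf hW hp _) ?_
  filter_upwards [SobolevH.ae_abs_le_norm u] with s hs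
  have := (hK (SobolevH.D 0 u) 0 0 0 s hs (by simp)).1
  rwa [nlin_zero hp, sub_zero, Pi.zero_apply, sub_zero] at this

theorem memLp_nlinDeriv (hf : IsBddC1 f) (hW : IsBddC1 W) (hp : 2 < p) (u : SobolevH 1) :
    MemLp (nlinDeriv f W p (SobolevH.D 0 u) (SobolevH.D 1 u)) 2 volume := by
  obtain ⟨K, hK0, hK⟩ := exists_nlin_bound hf hW hp (norm_nonneg u)
  refine (((Lp.memLp (SobolevH.D 0 u)).norm.const_mul K).add
    ((Lp.memLp (SobolevH.D 1 u)).norm.const_mul (K * ‖u‖ + K))).mono'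
    (aestronglyMeasurable_nlinDeriv hf hW hp _ _) ?_
  filter_upwards [SobolevH.ae_abs_le_norm u] with s hs
  have := (hK (SobolevH.D 0 u) (SobolevH.D 1 u) 0 0 s hs (by simp)).2
  rw [nlinDeriv_zero hp] at this
  simp only [sub_zero, Pi.zero_apply] at this
  refine this.trans ?_
  simp only [Pi.add_apply, Real.norm_eq_abs]
  have h2 : K * (|SobolevH.D 0 u s| * |SobolevH.D 1 u s|) ≤ K * (‖u‖ * |SobolevH.D 1 u s|) := by
    gcongr
  linarith

theorem exists_nlin_lipschitz (hf : IsBddC1 f) (hW : IsBddC1 W) (hp : 2 < p) {B : ℝ}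
    (hB : 0 ≤ B) : ∃ K : ℝ, 0 ≤ K ∧ ∀ u v : SobolevH 1, ‖u‖ ≤ B → ‖v‖ ≤ B →
      ‖toL2 (nlin f W p (SobolevH.D 0 u)) - toL2 (nlin f W p (SobolevH.D 0 v))‖ ≤ K * ‖u - v‖ ∧
      ‖toL2 (nlinDeriv f W p (SobolevH.D 0 u) (SobolevH.D 1 u)) -
        toL2 (nlinDeriv f W p (SobolevH.D 0 v) (SobolevH.D 1 v))‖ ≤ K * ‖u - v‖ := by
  obtain ⟨K, hK0, hK⟩ := exists_nlin_bound hf hW hp hB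
  refine ⟨K * (2 + B), by positivity, fun u v hu hv => ?_⟩
  have d0 : ‖SobolevH.D 0 u - SobolevH.D 0 v‖ ≤ ‖u - v‖ := by
    rw [← map_sub]; exact SobolevH.norm_D_le 0 _
  have d1 : ‖SobolevH.D 1 u - SobolevH.D 1 v‖ ≤ ‖u - v‖ := by
    rw [← map_sub]; exact SobolevH.norm_D_le 1 _
  constructor
  · calc _ ≤ ‖K • (SobolevH.D 0 u - SobolevH.D 0 v)‖ := by
          apply Lp.norm_le_norm_of_ae_le
          filter_upwards [SobolevH.ae_abs_le_norm u, SobolevH.ae_abs_le_norm v,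
            coeFn_toL2 (memLp_nlin hf hW hp u), coeFn_toL2 (memLp_nlin hf hW hp v),
            Lp.coeFn_sub (toL2 (nlin f W p (SobolevH.D 0 u)))
              (toL2 (nlin f W p (SobolevH.D 0 v))),
            Lp.coeFn_sub (SobolevH.D 0 u) (SobolevH.D 0 v),
            Lp.coeFn_smul K (SobolevH.D 0 u - SobolevH.D 0 v)] with s e1 e2 e3 e4 e5 e6 e7
          rw [e5, Pi.sub_apply, e3, e4, e7, Pi.smul_apply, e6, Pi.sub_apply, smul_eq_mul,
            Real.norm_eq_abs, Real.norm_eq_abs, abs_mul, abs_of_nonneg hK0]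
          exact (hK _ 0 _ 0 s (e1.trans hu) (e2.trans hv)).1
      _ = K * ‖SobolevH.D 0 u - SobolevH.D 0 v‖ := by
          rw [norm_smul, Real.norm_eq_abs, abs_of_nonneg hK0]
      _ ≤ K * (2 + B) * ‖u - v‖ := by
          rw [mul_assoc]
          gcongr
          nlinarith [norm_nonneg (u - v)]
  · calc _ ≤ ‖K • |SobolevH.D 0 u - SobolevH.D 0 v| + (K * ‖u - v‖) • |SobolevH.D 1 u| +
            K • |SobolevH.D 1 u - SobolevH.D 1 v|‖ := by
          apply Lp.norm_le_norm_of_ae_le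
          filter_upwards [SobolevH.ae_abs_le_norm u, SobolevH.ae_abs_le_norm v,
            coeFn_toL2 (memLp_nlinDeriv hf hW hp u), coeFn_toL2 (memLp_nlinDeriv hf hW hp v),
            Lp.coeFn_sub (toL2 (nlinDeriv f W p (SobolevH.D 0 u) (SobolevH.D 1 u)))
              (toL2 (nlinDeriv f W p (SobolevH.D 0 v) (SobolevH.D 1 v))),
            Lp.coeFn_sub (SobolevH.D 0 u) (SobolevH.D 0 v),
            Lp.coeFn_sub (SobolevH.D 1 u) (SobolevH.D 1 v),
            Lp.coeFn_abs (SobolevH.D 0 u - SobolevH.D 0 v), Lp.coeFn_abs (SobolevH.D 1 u),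
            Lp.coeFn_abs (SobolevH.D 1 u - SobolevH.D 1 v),
            Lp.coeFn_smul K |SobolevH.D 0 u - SobolevH.D 0 v|,
            Lp.coeFn_smul (K * ‖u - v‖) |SobolevH.D 1 u|,
            Lp.coeFn_smul K |SobolevH.D 1 u - SobolevH.D 1 v|,
            Lp.coeFn_add (K • |SobolevH.D 0 u - SobolevH.D 0 v|)
              ((K * ‖u - v‖) • |SobolevH.D 1 u|),
            Lp.coeFn_add (K • |SobolevH.D 0 u - SobolevH.D 0 v| +
              (K * ‖u - v‖) • |SobolevH.D 1 u|) (K • |SobolevH.D 1 u - SobolevH.D 1 v|),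
            SobolevH.ae_abs_le_norm (u - v)]
            with s e1 e2 e3 e4 e5 e6 e7 e8 e9 e10 e11 e12 e13 e14 e15 e16
          rw [map_sub, e6, Pi.sub_apply] at e16
          rw [e5, Pi.sub_apply, e3, e4, e15, Pi.add_apply, e14, Pi.add_apply, e13, e12, e11,
            Pi.smul_apply, Pi.smul_apply, Pi.smul_apply, e8, e9, e10, e6, e7, Pi.sub_apply,
            Pi.sub_apply, smul_eq_mul, smul_eq_mul, smul_eq_mul, Real.norm_eq_abs]
          refine ((hK _ (SobolevH.D 1 u) _ (SobolevH.D 1 v) s (e1.trans hu)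
            (e2.trans hv)).2.trans ?_).trans (le_abs_self _)
          have : K * (|SobolevH.D 0 u s - SobolevH.D 0 v s| * |SobolevH.D 1 u s|) ≤
              K * (‖u - v‖ * |SobolevH.D 1 u s|) := by gcongr
          linarith
      _ ≤ K * ‖SobolevH.D 0 u - SobolevH.D 0 v‖ + K * ‖u - v‖ * ‖SobolevH.D 1 u‖ +
            K * ‖SobolevH.D 1 u - SobolevH.D 1 v‖ := by
          refine (norm_add_le _ _).trans (add_le_add ((norm_add_le _ _).trans (add_le_add ?_ ?_)) ?_)
          · rw [norm_smul, norm_abs_eq_norm, Real.norm_eq_abs, abs_of_nonneg hK0]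
          · rw [norm_smul, norm_abs_eq_norm, Real.norm_eq_abs, abs_of_nonneg (by positivity)]
          · rw [norm_smul, norm_abs_eq_norm, Real.norm_eq_abs, abs_of_nonneg hK0]
      _ ≤ K * ‖u - v‖ + K * ‖u - v‖ * B + K * ‖u - v‖ := by
          have : ‖SobolevH.D 1 u‖ ≤ B := (SobolevH.norm_D_le 1 u).trans hu
          gcongr
      _ = K * (2 + B) * ‖u - v‖ := by ring

theorem continuous_of_lipschitz_on_balls {E F : Type*} [NormedAddCommGroup E]
    [NormedAddCommGroup F] {g : E → F}
    (h : ∀ B : ℝ, 0 ≤ B → ∃ K : ℝ, 0 ≤ K ∧ ∀ u v : E, ‖u‖ ≤ B → ‖v‖ ≤ B →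
      ‖g u - g v‖ ≤ K * ‖u - v‖) : Continuous g := by
  rw [continuous_iff_continuousAt]
  intro u
  obtain ⟨K, -, hK⟩ := h (‖u‖ + 1) (by positivity)
  rw [ContinuousAt, tendsto_iff_norm_sub_tendsto_zero]
  have h1 : Tendsto (fun v => K * ‖v - u‖) (𝓝 u) (𝓝 0) := by
    have : Continuous fun v => K * ‖v - u‖ := by fun_prop
    simpa using this.tendsto u
  refine squeeze_zero' (Eventually.of_forall fun _ => norm_nonneg _) ?_ h1
  filter_upwards [Metric.ball_mem_nhds u one_pos] with v hv
  refine hK v u ?_ (by linarith)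
  have := norm_sub_norm_le v u
  rw [mem_ball_iff_norm] at hv
  linarith

theorem IsTest.isWeakDeriv_nlin (hf : IsBddC1 f) (hW : IsBddC1 W) (hp : 2 < p) {φ : ℝ → ℝ}
    (hφ : IsTest φ) :
    IsWeakDeriv (toL2 (nlin f W p (SobolevH.D 0 hφ.toH1)))
      (toL2 (nlinDeriv f W p (SobolevH.D 0 hφ.toH1) (SobolevH.D 1 hφ.toH1))) := by
  have c0 : SobolevH.D 0 hφ.toH1 =ᵐ[volume] φ := coeFn_toL2 hφ.memLp
  have c1 : SobolevH.D 1 hφ.toH1 =ᵐ[volume] deriv φ := coeFn_toL2 hφ.deriv.memLp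
  have m0 : nlin f W p (SobolevH.D 0 hφ.toH1) =ᵐ[volume] nlin f W p φ := by
    filter_upwards [c0] with s h0
    simp only [nlin, h0]
  have m1 : nlinDeriv f W p (SobolevH.D 0 hφ.toH1) (SobolevH.D 1 hφ.toH1) =ᵐ[volume]
      nlinDeriv f W p φ (deriv φ) := by
    filter_upwards [c0, c1] with s h0 h1
    simp only [nlinDeriv, h0, h1]
  have l0 := memLp_nlin hf hW hp hφ.toH1
  have l1 := memLp_nlinDeriv hf hW hp hφ.toH1
  intro ψ h1 h2
  have hψ : IsTest ψ := ⟨h1, h2⟩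
  have e0 : ∫ s, toL2 (nlin f W p (SobolevH.D 0 hφ.toH1)) s * deriv ψ s =
      ∫ s, nlin f W p φ s * deriv ψ s :=
    integral_congr_ae (((coeFn_toL2 l0).trans m0).mono fun s hs => by simp only [hs])
  have e1 : ∫ s, toL2 (nlinDeriv f W p (SobolevH.D 0 hφ.toH1) (SobolevH.D 1 hφ.toH1)) s * ψ s =
      ∫ s, nlinDeriv f W p φ (deriv φ) s * ψ s :=
    integral_congr_ae (((coeFn_toL2 l1).trans m1).mono fun s hs => by simp only [hs])
  rw [e0, e1]
  have hd : ∀ s, HasDerivAt (nlin f W p φ) (nlinDeriv f W p φ (deriv φ) s) s := by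
    intro s
    have a1 : HasDerivAt (fun s => |φ s| ^ p) (p * |φ s| ^ (p - 2) * φ s * deriv φ s) s :=
      (hasDerivAt_abs_rpow (φ s) (by linarith)).comp s (hφ.hasDerivAt s)
    refine (((hf.hasDerivAt s).mul a1).sub ((hW.hasDerivAt s).mul (hφ.hasDerivAt s))).congr_deriv ?_
    unfold nlinDeriv
    ring
  have l0' := l0.ae_eq m0
  have l1' := l1.ae_eq m1
  exact integral_mul_deriv_eq_deriv_mul_of_integrable (fun x _ => hd x)
    (fun x _ => hψ.hasDerivAt x)
    (MemLp.integrable_mul (p := 2) (q := 2) l0' hψ.deriv.memLp)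
    (MemLp.integrable_mul (p := 2) (q := 2) l1' hψ.memLp)
    (MemLp.integrable_mul (p := 2) (q := 2) l0' hψ.memLp)

/-- The chain rule in `H¹(ℝ)`, obtained from that for test functions by density. -/
theorem isWeakDeriv_nlin (hf : IsBddC1 f) (hW : IsBddC1 W) (hp : 2 < p) (u : SobolevH 1) :
    IsWeakDeriv (toL2 (nlin f W p (SobolevH.D 0 u)))
      (toL2 (nlinDeriv f W p (SobolevH.D 0 u) (SobolevH.D 1 u))) := by
  refine SobolevH.induction_on_test (P := fun u => IsWeakDeriv (toL2 (nlin f W p (SobolevH.D 0 u)))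
      (toL2 (nlinDeriv f W p (SobolevH.D 0 u) (SobolevH.D 1 u)))) ?_
    (fun φ hφ => hφ.isWeakDeriv_nlin hf hW hp) u
  have k0 : Continuous fun u : SobolevH 1 => toL2 (nlin f W p (SobolevH.D 0 u)) :=
    continuous_of_lipschitz_on_balls fun B hB => by
      obtain ⟨K, hK0, hK⟩ := exists_nlin_lipschitz hf hW hp hB
      exact ⟨K, hK0, fun u v hu hv => (hK u v hu hv).1⟩
  have k1 : Continuous fun u : SobolevH 1 =>
      toL2 (nlinDeriv f W p (SobolevH.D 0 u) (SobolevH.D 1 u)) :=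
    continuous_of_lipschitz_on_balls fun B hB => by
      obtain ⟨K, hK0, hK⟩ := exists_nlin_lipschitz hf hW hp hB
      exact ⟨K, hK0, fun u v hu hv => (hK u v hu hv).2⟩
  exact isClosed_isWeakDeriv.preimage (k0.prodMk k1)

/-- The nonlinearity `f |u|^p - W u` as a map of `H¹(ℝ)`. -/
def nlinH1 (hf : IsBddC1 f) (hW : IsBddC1 W) (hp : 2 < p) (u : SobolevH 1) : SobolevH 1 :=
  SobolevH.mk₁ _ _ (isWeakDeriv_nlin hf hW hp u)

theorem coeFn_D_zero_nlinH1 (hf : IsBddC1 f) (hW : IsBddC1 W) (hp : 2 < p) (u : SobolevH 1) :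
    SobolevH.D 0 (nlinH1 hf hW hp u) =ᵐ[volume] nlin f W p (SobolevH.D 0 u) :=
  coeFn_toL2 (memLp_nlin hf hW hp u)

theorem exists_nlinH1_lipschitz (hf : IsBddC1 f) (hW : IsBddC1 W) (hp : 2 < p) {B : ℝ}
    (hB : 0 ≤ B) : ∃ K : ℝ, 0 ≤ K ∧ ∀ u v : SobolevH 1, ‖u‖ ≤ B → ‖v‖ ≤ B →
      ‖nlinH1 hf hW hp u - nlinH1 hf hW hp v‖ ≤ K * ‖u - v‖ := by
  obtain ⟨K, hK0, hK⟩ := exists_nlin_lipschitz hf hW hp hB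
  refine ⟨2 * K, by positivity, fun u v hu hv => ?_⟩
  obtain ⟨h0, h1⟩ := hK u v hu hv
  refine (SobolevH.norm_one_le _).trans ?_
  rw [map_sub, map_sub, nlinH1, nlinH1, SobolevH.D_zero_mk₁, SobolevH.D_zero_mk₁,
    SobolevH.D_one_mk₁, SobolevH.D_one_mk₁]
  linarith

theorem continuous_nlinH1 (hf : IsBddC1 f) (hW : IsBddC1 W) (hp : 2 < p) :
    Continuous (nlinH1 hf hW hp) :=
  continuous_of_lipschitz_on_balls fun _ hB => exists_nlinH1_lipschitz hf hW hp hB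

end

/-! ### The wave equation as an ordinary differential equation along characteristics -/

section Wave

open scoped NNReal

/-- The vector field of the wave equation `v_tt - v_ss = N(v)` for the unknowns `(A, B, v)`, where
`v_t + v_s` and `v_t - v_s` at time `t` are the translates of `A` by `t` and of `B` by `-t`. -/
def waveField (N : SobolevH 1 → SobolevH 1) (t : ℝ) (x : SobolevH 1 × SobolevH 1 × SobolevH 1) :
    SobolevH 1 × SobolevH 1 × SobolevH 1 :=
  (shift₁ (-t) (N x.2.2), shift₁ t (N x.2.2),
    (1 / 2 : ℝ) • (shift₁ t x.1 + shift₁ (-t) x.2.1))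

variable {N : SobolevH 1 → SobolevH 1}

theorem continuous_waveField (x : SobolevH 1 × SobolevH 1 × SobolevH 1) :
    Continuous fun t => waveField N t x := by
  have h : ∀ y : SobolevH 1, Continuous fun t => shift₁ t y := fun y =>
    continuous_shift₁.comp (f := fun t : ℝ => (t, y)) (continuous_id.prodMk continuous_const)
  have h' : ∀ y : SobolevH 1, Continuous fun t => shift₁ (-t) y := fun y =>
    (h y).comp (f := fun t : ℝ => -t) continuous_neg
  have h3 : Continuous fun t => (1 / 2 : ℝ) • (shift₁ t x.1 + shift₁ (-t) x.2.1) :=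
    ((h x.1).fun_add (h' x.2.1)).const_smul (1 / 2 : ℝ)
  exact (h' (N x.2.2)).prodMk ((h (N x.2.2)).prodMk h3)

theorem norm_waveField_sub_le {B K : ℝ} (hK0 : 0 ≤ K)
    (hK : ∀ u v : SobolevH 1, ‖u‖ ≤ B → ‖v‖ ≤ B → ‖N u - N v‖ ≤ K * ‖u - v‖) (t : ℝ)
    {x y : SobolevH 1 × SobolevH 1 × SobolevH 1} (hx : ‖x‖ ≤ B) (hy : ‖y‖ ≤ B) :
    ‖waveField N t x - waveField N t y‖ ≤ (K + 1) * ‖x - y‖ := by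
  have n1 : ∀ z : SobolevH 1 × SobolevH 1 × SobolevH 1, ‖z.1‖ ≤ ‖z‖ := fun z => norm_fst_le z
  have n2 : ∀ z : SobolevH 1 × SobolevH 1 × SobolevH 1, ‖z.2.1‖ ≤ ‖z‖ := fun z =>
    (norm_fst_le z.2).trans (norm_snd_le z)
  have n3 : ∀ z : SobolevH 1 × SobolevH 1 × SobolevH 1, ‖z.2.2‖ ≤ ‖z‖ := fun z =>
    (norm_snd_le z.2).trans (norm_snd_le z)
  have hN : ‖N x.2.2 - N y.2.2‖ ≤ (K + 1) * ‖x - y‖ := by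
    have := hK _ _ ((n3 x).trans hx) ((n3 y).trans hy)
    have h3 := n3 (x - y)
    have : K * ‖x.2.2 - y.2.2‖ ≤ K * ‖x - y‖ := mul_le_mul_of_nonneg_left h3 hK0
    nlinarith [norm_nonneg (x - y)]
  refine norm_prod_le_iff.mpr ⟨?_, norm_prod_le_iff.mpr ⟨?_, ?_⟩⟩
  · simp only [waveField, Prod.fst_sub]
    rw [← map_sub, LinearIsometry.norm_map]
    exact hN
  · simp only [waveField, Prod.fst_sub, Prod.snd_sub]
    rw [← map_sub, LinearIsometry.norm_map]
    exact hN
  · simp only [waveField, Prod.snd_sub]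
    rw [← smul_sub, add_sub_add_comm, ← map_sub, ← map_sub, norm_smul]
    have h1 := norm_add_le (shift₁ t (x.1 - y.1)) (shift₁ (-t) (x.2.1 - y.2.1))
    rw [LinearIsometry.norm_map, LinearIsometry.norm_map] at h1
    have h2 := n1 (x - y)
    have h3 := n2 (x - y)
    simp only [Prod.fst_sub, Prod.snd_sub] at h2 h3
    have : ‖(1 / 2 : ℝ)‖ = 1 / 2 := by norm_num
    rw [this]
    nlinarith [norm_nonneg (x - y)]

variable (hN : ∀ B : ℝ, 0 ≤ B → ∃ K : ℝ, 0 ≤ K ∧ ∀ u v : SobolevH 1, ‖u‖ ≤ B → ‖v‖ ≤ B →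
  ‖N u - N v‖ ≤ K * ‖u - v‖)
include hN

theorem waveField_lipschitzOnWith (B : ℝ) : ∃ K : ℝ≥0, ∀ t,
    LipschitzOnWith K (waveField N t) (Metric.closedBall 0 B) := by
  obtain ⟨K, hK0, hK⟩ := hN |B| (abs_nonneg B)
  refine ⟨⟨K + 1, by positivity⟩, fun t => LipschitzOnWith.of_dist_le_mul fun x hx y hy => ?_⟩
  rw [mem_closedBall_zero_iff] at hx hy
  rw [dist_eq_norm, dist_eq_norm]
  exact norm_waveField_sub_le hK0 hK t (hx.trans (le_abs_self B)) (hy.trans (le_abs_self B))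

theorem waveField_norm_le (B : ℝ) : ∃ C : ℝ≥0, ∀ t, ∀ x ∈ Metric.closedBall
    (0 : SobolevH 1 × SobolevH 1 × SobolevH 1) B, ‖waveField N t x‖ ≤ C := by
  obtain ⟨K, hK0, hK⟩ := hN |B| (abs_nonneg B)
  refine ⟨⟨(K + 1) * |B| + ‖N 0‖, by positivity⟩, fun t x hx => ?_⟩
  rw [mem_closedBall_zero_iff] at hx
  have h1 := norm_waveField_sub_le hK0 hK t (hx.trans (le_abs_self B))
    (y := 0) (by simp)
  have h2 : ‖waveField N t 0‖ ≤ ‖N 0‖ := by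
    refine norm_prod_le_iff.mpr ⟨?_, norm_prod_le_iff.mpr ⟨?_, ?_⟩⟩ <;> simp [waveField]
  rw [sub_zero] at h1
  have h3 := norm_sub_norm_le (waveField N t x) (waveField N t 0)
  have h4 : (K + 1) * ‖x‖ ≤ (K + 1) * |B| := by
    have := hx.trans (le_abs_self B)
    gcongr
  show _ ≤ (K + 1) * |B| + ‖N 0‖
  linarith

end Wave

/-! ### Regularity of the solution -/

/-- The element of `H²(ℝ)` with `u ∈ H¹(ℝ)` and `∂u = w ∈ H¹(ℝ)`. -/
def SobolevH.mk₂ (u w : SobolevH 1) (h : SobolevH.D 1 u = SobolevH.D 0 w) : SobolevH 2 :=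
  ⟨WithLp.toLp 2 ![SobolevH.D 0 u, SobolevH.D 0 w, SobolevH.D 1 w], fun i => by
    fin_cases i
    · have := SobolevH.isWeakDeriv_one u
      rw [h] at this
      exact this
    · exact SobolevH.isWeakDeriv_one w⟩

/-- The derivative as a map from `H²(ℝ)` to `H¹(ℝ)`. -/
def SobolevH.tail (u : SobolevH 2) : SobolevH 1 :=
  SobolevH.mk₁ (SobolevH.D 1 u) (SobolevH.D 2 u) (u.2 1)

theorem SobolevH.norm_two_le (u : SobolevH 2) :
    ‖u‖ ≤ ‖SobolevH.D 0 u‖ + ‖SobolevH.D 1 u‖ + ‖SobolevH.D 2 u‖ := by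
  refine abs_le_of_sq_le_sq' ?_ (by positivity) |>.2
  have : ‖u‖ = ‖(u : PiLp 2 (fun _ : Fin 3 => L2R))‖ := rfl
  rw [this, PiLp.norm_sq_eq_of_L2, Fin.sum_univ_three]
  change ‖SobolevH.D 0 u‖ ^ 2 + ‖SobolevH.D 1 u‖ ^ 2 + ‖SobolevH.D 2 u‖ ^ 2 ≤ _
  have h0 := norm_nonneg (SobolevH.D 0 u)
  have h1 := norm_nonneg (SobolevH.D 1 u)
  have h2 := norm_nonneg (SobolevH.D 2 u)
  nlinarith [mul_nonneg h0 h1, mul_nonneg h0 h2, mul_nonneg h1 h2]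

theorem SobolevH.continuousOn_two {V : ℝ → SobolevH 2} {I : Set ℝ}
    (h0 : ContinuousOn (fun t => SobolevH.D 0 (V t)) I)
    (h1 : ContinuousOn (fun t => SobolevH.D 1 (V t)) I)
    (h2 : ContinuousOn (fun t => SobolevH.D 2 (V t)) I) : ContinuousOn V I := by
  intro t ht
  rw [ContinuousWithinAt, tendsto_iff_norm_sub_tendsto_zero]
  have k0 := tendsto_iff_norm_sub_tendsto_zero.mp (h0 t ht).tendsto
  have k1 := tendsto_iff_norm_sub_tendsto_zero.mp (h1 t ht).tendsto
  have k2 := tendsto_iff_norm_sub_tendsto_zero.mp (h2 t ht).tendsto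
  refine squeeze_zero (fun _ => norm_nonneg _) (fun y => ?_)
    (by simpa using (k0.add k1).add k2)
  simpa only [map_sub] using SobolevH.norm_two_le (V y - V t)

/-- `V` solves `V_tt = V_ss + N(V)` on the time interval `I`, with `Vt = ∂ₜV` as a curve in
`H¹(ℝ)` and `Vtt = ∂ₜ²V` as a curve in `L²(ℝ)`. -/
structure IsStrongWave (N : SobolevH 1 → SobolevH 1) (I : Set ℝ) (V : ℝ → SobolevH 2)
    (Vt : ℝ → SobolevH 1) (Vtt : ℝ → L2R) : Prop where
  continuousOn : ContinuousOn V I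
  continuousOn_t : ContinuousOn Vt I
  continuousOn_tt : ContinuousOn Vtt I
  hasDeriv : ∀ t ∈ I, HasDerivWithinAt (fun t => SobolevH.incl 1 (V t)) (Vt t) I t
  hasDeriv_t : ∀ t ∈ I, HasDerivWithinAt (fun t => SobolevH.D 0 (Vt t)) (Vtt t) I t
  equation : ∀ t ∈ I, Vtt t = SobolevH.D 2 (V t) + SobolevH.D 0 (N (SobolevH.incl 1 (V t)))

/-- The initial state of the characteristic system for the data `(v₀, v₁)`. -/
def waveInit (v₀ : SobolevH 2) (v₁ : SobolevH 1) : SobolevH 1 × SobolevH 1 × SobolevH 1 :=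
  (v₁ + SobolevH.tail v₀, v₁ - SobolevH.tail v₀, SobolevH.incl 1 v₀)

theorem HasDerivWithinAt.clm_image {E F : Type*} [NormedAddCommGroup E] [NormedSpace ℝ E]
    [NormedAddCommGroup F] [NormedSpace ℝ F] {x : ℝ → E} {x' : E} {s : Set ℝ} {t : ℝ}
    (h : HasDerivWithinAt x x' s t) (L : E →L[ℝ] F) :
    HasDerivWithinAt (fun t => L (x t)) (L x') s t :=
  L.hasFDerivAt.comp_hasDerivWithinAt t h

theorem HasDerivWithinAt.fst_prod {E F : Type*} [NormedAddCommGroup E] [NormedSpace ℝ E]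
    [NormedAddCommGroup F] [NormedSpace ℝ F] {x : ℝ → E × F} {x' : E × F} {s : Set ℝ} {t : ℝ}
    (h : HasDerivWithinAt x x' s t) : HasDerivWithinAt (fun t => (x t).1) x'.1 s t :=
  h.clm_image (ContinuousLinearMap.fst ℝ E F)

theorem HasDerivWithinAt.snd_prod {E F : Type*} [NormedAddCommGroup E] [NormedSpace ℝ E]
    [NormedAddCommGroup F] [NormedSpace ℝ F] {x : ℝ → E × F} {x' : E × F} {s : Set ℝ} {t : ℝ}
    (h : HasDerivWithinAt x x' s t) : HasDerivWithinAt (fun t => (x t).2) x'.2 s t :=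
  h.clm_image (ContinuousLinearMap.snd ℝ E F)

theorem ContinuousOn.shift₁ {g : ℝ → ℝ} {y : ℝ → SobolevH 1} {I : Set ℝ} (hg : ContinuousOn g I)
    (hy : ContinuousOn y I) : ContinuousOn (fun t => shift₁ (g t) (y t)) I :=
  Continuous.comp_continuousOn (g := fun q : ℝ × SobolevH 1 => _root_.shift₁ q.1 q.2)
    (f := fun t => (g t, y t)) continuous_shift₁ (hg.prodMk hy)

/-- Integral curves of the characteristic system with compatible data yield solutions with values in
`H²(ℝ)`: the constraint `∂v = (a - b) / 2` between the unknowns is preserved, where `a` and `b` are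
the translates of the first two unknowns. The norm of the curve is controlled by that of `V`
and `Vt`, so that blow-up passes from the former to the latter. -/
theorem exists_isStrongWave {N : SobolevH 1 → SobolevH 1} (hNc : Continuous N) {I : Set ℝ}
    (hI : Convex ℝ I) (h0 : (0 : ℝ) ∈ I) {x : ℝ → SobolevH 1 × SobolevH 1 × SobolevH 1}
    {v₀ : SobolevH 2} {v₁ : SobolevH 1} (hx0 : x 0 = waveInit v₀ v₁)
    (hx : IsIntegralCurveOn x (waveField N) I) :
    ∃ V Vt Vtt, IsStrongWave N I V Vt Vtt ∧ V 0 = v₀ ∧ Vt 0 = v₁ ∧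
      (∀ t ∈ I, SobolevH.incl 1 (V t) = (x t).2.2) ∧
      ∀ t ∈ I, ‖x t‖ ≤ 2 * (‖V t‖ + ‖Vt t‖) := by
  set a : ℝ → SobolevH 1 := fun t => shift₁ t (x t).1 with ha
  set b : ℝ → SobolevH 1 := fun t => shift₁ (-t) (x t).2.1 with hb
  have hxc : ContinuousOn x I := fun t ht => (hx t ht).continuousWithinAt
  have hac : ContinuousOn a I := continuousOn_id.shift₁ hxc.fst
  have hbc : ContinuousOn b I := continuousOn_id.neg.shift₁ hxc.snd.fst
  have hA : ∀ t ∈ I, HasDerivWithinAt (fun t => (x t).1) (shift₁ (-t) (N (x t).2.2)) I t :=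
    fun t ht => (hx t ht).fst_prod
  have hB : ∀ t ∈ I, HasDerivWithinAt (fun t => (x t).2.1) (shift₁ t (N (x t).2.2)) I t :=
    fun t ht => (hx t ht).snd_prod.fst_prod
  have hv : ∀ t ∈ I, HasDerivWithinAt (fun t => (x t).2.2) ((1 / 2 : ℝ) • (a t + b t)) I t :=
    fun t ht => (hx t ht).snd_prod.snd_prod
  -- the transport equations for `a` and `b`, in `L²`
  have ha' : ∀ t ∈ I, HasDerivWithinAt (fun t => SobolevH.D 0 (a t))
      (SobolevH.D 1 (a t) + SobolevH.D 0 (N (x t).2.2)) I t := by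
    intro t ht
    have := (hA t ht).shift_D_zero 1
    simp only [one_mul, one_smul, map_add, D_zero_shift₁, shift_shift, add_neg_cancel,
      shift_zero] at this
    exact this
  have hb' : ∀ t ∈ I, HasDerivWithinAt (fun t => SobolevH.D 0 (b t))
      (-SobolevH.D 1 (b t) + SobolevH.D 0 (N (x t).2.2)) I t := by
    intro t ht
    have := (hB t ht).shift_D_zero (-1)
    simp only [neg_mul, one_mul, neg_smul, one_smul, map_add, map_neg, D_zero_shift₁, shift_shift,
      neg_add_cancel, shift_zero] at this
    exact this
  -- the constraint `∂v = (a - b) / 2` is propagated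
  have hcon : ∀ t ∈ I, SobolevH.D 1 (x t).2.2 =
      SobolevH.D 0 ((1 / 2 : ℝ) • (a t - b t)) := by
    have hz : ∀ t ∈ I, HasDerivWithinAt (fun t => SobolevH.D 1 (x t).2.2 -
        (1 / 2 : ℝ) • (SobolevH.D 0 (a t) - SobolevH.D 0 (b t))) 0 I t := by
      intro t ht
      have h1 : HasDerivWithinAt (fun t => SobolevH.D 1 (x t).2.2)
          (SobolevH.D 1 ((1 / 2 : ℝ) • (a t + b t))) I t :=
        (hv t ht).clm_image (SobolevH.D 1)
      have h2 := h1.fun_sub (((ha' t ht).fun_sub (hb' t ht)).const_smul (1 / 2 : ℝ))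
      refine h2.congr_deriv ?_
      rw [map_smul, map_add]
      module
    intro t ht
    have h3 := hI.norm_image_sub_le_of_norm_hasDerivWithin_le (C := 0) hz (fun t _ => by simp) h0 ht
    rw [zero_mul, norm_le_zero_iff, sub_eq_zero] at h3
    have h4 : SobolevH.D 1 (x 0).2.2 -
        (1 / 2 : ℝ) • (SobolevH.D 0 (a 0) - SobolevH.D 0 (b 0)) = 0 := by
      simp only [ha, hb, neg_zero, shift₁_zero, hx0, waveInit, map_add, map_sub]
      have e1 : SobolevH.D 1 (SobolevH.incl 1 v₀) = SobolevH.D 1 v₀ := rfl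
      have e2 : SobolevH.D 0 (SobolevH.tail v₀) = SobolevH.D 1 v₀ := rfl
      rw [e1, e2]
      module
    rw [h4, sub_eq_zero] at h3
    rw [h3, map_smul, map_sub]
  classical
  set V : ℝ → SobolevH 2 := fun t => if ht : t ∈ I then SobolevH.mk₂ _ _ (hcon t ht) else 0 with hV
  have hVI : ∀ t (ht : t ∈ I), V t = SobolevH.mk₂ _ _ (hcon t ht) := fun t ht => dif_pos ht
  have hV0 : ∀ t ∈ I, SobolevH.D 0 (V t) = SobolevH.D 0 (x t).2.2 := fun t ht => by
    rw [hVI t ht]; rfl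
  have hV1 : ∀ t ∈ I, SobolevH.D 1 (V t) = SobolevH.D 0 ((1 / 2 : ℝ) • (a t - b t)) :=
    fun t ht => by rw [hVI t ht]; rfl
  have hV2 : ∀ t ∈ I, SobolevH.D 2 (V t) = SobolevH.D 1 ((1 / 2 : ℝ) • (a t - b t)) :=
    fun t ht => by rw [hVI t ht]; rfl
  have hVx : ∀ t ∈ I, SobolevH.incl 1 (V t) = (x t).2.2 := fun t ht =>
    SobolevH.ext_one (hV0 t ht)
  have habc : ContinuousOn (fun t => (1 / 2 : ℝ) • (a t - b t)) I :=
    (hac.fun_sub hbc).const_smul (1 / 2 : ℝ)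
  have hvc : ContinuousOn (fun t => (x t).2.2) I := fun t ht => (hv t ht).continuousWithinAt
  have hVc : ContinuousOn V I := SobolevH.continuousOn_two
    (((SobolevH.D 0).continuous.comp_continuousOn hvc).congr hV0)
    (((SobolevH.D 0).continuous.comp_continuousOn habc).congr hV1)
    (((SobolevH.D 1).continuous.comp_continuousOn habc).congr hV2)
  have hincl : ContinuousOn (fun t => SobolevH.incl 1 (V t)) I := hvc.congr hVx
  have habc' : ContinuousOn (fun t => (1 / 2 : ℝ) • (a t + b t)) I :=
    (hac.fun_add hbc).const_smul (1 / 2 : ℝ)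
  refine ⟨V, fun t => (1 / 2 : ℝ) • (a t + b t),
    fun t => SobolevH.D 2 (V t) + SobolevH.D 0 (N (SobolevH.incl 1 (V t))),
    ⟨hVc, habc', ?_, ?_, ?_, fun _ _ => rfl⟩, ?_, ?_, hVx, ?_⟩
  · exact ((SobolevH.D 2).continuous.comp_continuousOn hVc).fun_add
      ((SobolevH.D 0).continuous.comp_continuousOn (hNc.comp_continuousOn hincl))
  · intro t ht
    exact (hv t ht).congr hVx (hVx t ht)
  · intro t ht
    have := ((ha' t ht).fun_add (hb' t ht)).fun_const_smul (1 / 2 : ℝ)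
    refine (this.congr_deriv ?_).congr_of_eventuallyEq
      (Eventually.of_forall fun τ => by simp only [map_smul, map_add])
      (by rw [map_smul, map_add])
    rw [hV2 t ht, hVx t ht, map_smul, map_sub]
    module
  · have h1 : ∀ i : Fin 3, SobolevH.D i (V 0) = SobolevH.D i v₀ := by
      have e : (1 / 2 : ℝ) • (a 0 - b 0) = SobolevH.tail v₀ := by
        simp only [ha, hb, neg_zero, shift₁_zero, hx0, waveInit]
        module
      intro i
      fin_cases i
      · have := hV0 0 h0
        rw [hx0] at this
        exact this
      · have := hV1 0 h0
        rw [e] at this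
        exact this
      · have := hV2 0 h0
        rw [e] at this
        exact this
    apply Subtype.ext
    apply PiLp.ext
    exact h1
  · simp only [ha, hb, neg_zero, shift₁_zero, hx0, waveInit]
    module
  · intro t ht
    have htail : SobolevH.tail (V t) = (1 / 2 : ℝ) • (a t - b t) :=
      SobolevH.ext_one (hV1 t ht)
    have n1 : ‖(1 / 2 : ℝ) • (a t - b t)‖ ≤ 2 * ‖V t‖ := by
      rw [← htail]
      refine (SobolevH.norm_one_le _).trans ?_
      have h1 := SobolevH.norm_D_le 1 (V t)
      have h2 := SobolevH.norm_D_le 2 (V t)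
      have e1 : SobolevH.D 0 (SobolevH.tail (V t)) = SobolevH.D 1 (V t) := rfl
      have e2 : SobolevH.D 1 (SobolevH.tail (V t)) = SobolevH.D 2 (V t) := rfl
      rw [e1, e2]
      linarith
    have n2 : ‖(x t).2.2‖ ≤ 2 * ‖V t‖ := by
      rw [← hVx t ht]
      refine (SobolevH.norm_one_le _).trans ?_
      have h1 := SobolevH.norm_D_le 0 (V t)
      have h2 := SobolevH.norm_D_le 1 (V t)
      have e1 : SobolevH.D 0 (SobolevH.incl 1 (V t)) = SobolevH.D 0 (V t) := rfl
      have e2 : SobolevH.D 1 (SobolevH.incl 1 (V t)) = SobolevH.D 1 (V t) := rfl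
      rw [e1, e2]
      linarith
    have n3 : ‖(x t).1‖ ≤ ‖(1 / 2 : ℝ) • (a t + b t)‖ + ‖(1 / 2 : ℝ) • (a t - b t)‖ := by
      have e : a t = (1 / 2 : ℝ) • (a t + b t) + (1 / 2 : ℝ) • (a t - b t) := by module
      have e' : ‖(x t).1‖ = ‖a t‖ := ((shift₁ t).norm_map _).symm
      rw [e', e]
      refine (norm_add_le _ _).trans_eq ?_
      rw [← e]
    have n4 : ‖(x t).2.1‖ ≤ ‖(1 / 2 : ℝ) • (a t + b t)‖ + ‖(1 / 2 : ℝ) • (a t - b t)‖ := by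
      have e : b t = (1 / 2 : ℝ) • (a t + b t) - (1 / 2 : ℝ) • (a t - b t) := by module
      have e' : ‖(x t).2.1‖ = ‖b t‖ := ((shift₁ (-t)).norm_map _).symm
      rw [e', e]
      refine (norm_sub_le _ _).trans_eq ?_
      rw [← e]
    have p0 := norm_nonneg (V t)
    have p1 := norm_nonneg ((1 / 2 : ℝ) • (a t + b t))
    exact norm_prod_le_iff.mpr ⟨by linarith, norm_prod_le_iff.mpr ⟨by linarith, by linarith⟩⟩

/-! ### Finite speed of propagation -/

/-- Multiplication by the indicator function of a set, on `L²(ℝ)`. -/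
def cutoff (S : Set ℝ) (hS : MeasurableSet S) : L2R →L[ℝ] L2R :=
  LinearMap.mkContinuous
    { toFun := fun u => ((Lp.memLp u).indicator hS).toLp (S.indicator u)
      map_add' := fun u w => by
        apply Lp.ext
        filter_upwards [((Lp.memLp (u + w)).indicator hS).coeFn_toLp, Lp.coeFn_add u w,
          Lp.coeFn_add (((Lp.memLp u).indicator hS).toLp (S.indicator u))
            (((Lp.memLp w).indicator hS).toLp (S.indicator w)),
          ((Lp.memLp u).indicator hS).coeFn_toLp, ((Lp.memLp w).indicator hS).coeFn_toLp]
          with s h1 h2 h3 h4 h5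
        rw [h1, h3, Pi.add_apply, h4, h5]
        by_cases hs : s ∈ S
        · rw [indicator_of_mem hs, indicator_of_mem hs, indicator_of_mem hs, h2, Pi.add_apply]
        · simp [hs]
      map_smul' := fun c u => by
        apply Lp.ext
        filter_upwards [((Lp.memLp (c • u)).indicator hS).coeFn_toLp, Lp.coeFn_smul c u,
          Lp.coeFn_smul c (((Lp.memLp u).indicator hS).toLp (S.indicator u)),
          ((Lp.memLp u).indicator hS).coeFn_toLp] with s h1 h2 h3 h4
        rw [h1, RingHom.id_apply, h3, Pi.smul_apply, h4]
        by_cases hs : s ∈ S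
        · rw [indicator_of_mem hs, indicator_of_mem hs, h2, Pi.smul_apply]
        · simp [hs] } 1 fun u => by
    rw [one_mul]
    apply Lp.norm_le_norm_of_ae_le
    filter_upwards [((Lp.memLp u).indicator hS).coeFn_toLp] with s h1
    simp only [LinearMap.coe_mk, AddHom.coe_mk]
    rw [h1]
    exact norm_indicator_le_norm_self _ _

theorem coeFn_cutoff {S : Set ℝ} (hS : MeasurableSet S) (u : L2R) :
    cutoff S hS u =ᵐ[volume] S.indicator u :=
  ((Lp.memLp u).indicator hS).coeFn_toLp

theorem norm_cutoff_le {S S' : Set ℝ} (hS : MeasurableSet S) (hS' : MeasurableSet S')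
    (hSS : S ⊆ S') {K : ℝ} (hK : 0 ≤ K) {u w : L2R} (h : ∀ᵐ s : ℝ, |u s| ≤ K * |w s|) :
    ‖cutoff S hS u‖ ≤ K * ‖cutoff S' hS' w‖ := by
  calc ‖cutoff S hS u‖ ≤ ‖K • cutoff S' hS' w‖ := by
        apply Lp.norm_le_norm_of_ae_le
        filter_upwards [coeFn_cutoff hS u, coeFn_cutoff hS' w,
          Lp.coeFn_smul K (cutoff S' hS' w), h] with s h1 h2 h3 h4
        rw [h1, h3, Pi.smul_apply, h2, smul_eq_mul, Real.norm_eq_abs, Real.norm_eq_abs, abs_mul,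
          abs_of_nonneg hK]
        by_cases hs : s ∈ S
        · simpa [hs, hSS hs] using h4
        · rw [indicator_of_notMem hs, abs_zero]
          positivity
    _ = K * ‖cutoff S' hS' w‖ := by rw [norm_smul, Real.norm_eq_abs, abs_of_nonneg hK]

theorem norm_cutoff_shift_le {S S' : Set ℝ} (hS : MeasurableSet S) (hS' : MeasurableSet S')
    {t : ℝ} (h : ∀ s ∈ S, s + t ∈ S') (u : L2R) :
    ‖cutoff S hS (shift t u)‖ ≤ ‖cutoff S' hS' u‖ := by
  rw [← (shift t).norm_map (cutoff S' hS' u)]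
  apply Lp.norm_le_norm_of_ae_le
  filter_upwards [coeFn_cutoff hS (shift t u), ae_add_right (coeFn_cutoff hS' u) t,
    coeFn_shift t u, coeFn_shift t (cutoff S' hS' u)] with s h1 h2 h3 h4
  rw [h1, h4, h2]
  by_cases hs : s ∈ S
  · rw [indicator_of_mem hs, indicator_of_mem (h s hs), h3]
  · rw [indicator_of_notMem hs, norm_zero]
    exact norm_nonneg _

theorem cutoff_eq_zero_iff {S : Set ℝ} (hS : MeasurableSet S) (u : L2R) :
    cutoff S hS u = 0 ↔ ∀ᵐ s : ℝ, s ∈ S → u s = 0 := by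
  rw [Lp.eq_zero_iff_ae_eq_zero]
  constructor
  · intro h
    filter_upwards [h, coeFn_cutoff hS u] with s h1 h2 hs
    rw [h2, indicator_of_mem hs] at h1
    exact h1
  · intro h
    filter_upwards [h, coeFn_cutoff hS u] with s h1 h2
    rw [h2]
    by_cases hs : s ∈ S
    · rw [indicator_of_mem hs, h1 hs, Pi.zero_apply]
    · rw [indicator_of_notMem hs, Pi.zero_apply]

/-- The complement of the interval of radius `ρ` about `c`. -/
def outside (c ρ : ℝ) : Set ℝ := {s | ρ < |s - c|}

theorem isOpen_outside (c ρ : ℝ) : IsOpen (outside c ρ) :=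
  isOpen_lt continuous_const (continuous_abs.comp (continuous_id.sub continuous_const))

theorem outside_subset {c ρ ρ' : ℝ} (h : ρ' ≤ ρ) : outside c ρ ⊆ outside c ρ' :=
  fun _ hs => h.trans_lt hs

theorem add_mem_outside {c ρ d s : ℝ} (hs : s ∈ outside c ρ) : s + d ∈ outside c (ρ - |d|) := by
  have h1 : ρ < |s - c| := hs
  show ρ - |d| < |s + d - c|
  have := abs_sub_abs_le_abs_sub (s - c) (-d)
  rw [abs_neg, sub_neg_eq_add] at this
  rw [show s + d - c = s - c + d by ring]
  linarith

/-- Weak derivatives are local. -/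
theorem IsWeakDeriv.eq_zero_on {u w : L2R} (h : IsWeakDeriv u w) {U : Set ℝ} (hU : IsOpen U)
    (hu : ∀ᵐ s : ℝ, s ∈ U → u s = 0) : ∀ᵐ s : ℝ, s ∈ U → w s = 0 := by
  refine hU.ae_eq_zero_of_integral_contDiff_smul_eq_zero
    (((Lp.memLp w).locallyIntegrable (by norm_num)).locallyIntegrableOn U) fun φ h1 h2 h3 => ?_
  have h4 := h φ h1 h2
  have h5 : ∫ s, u s * deriv φ s = 0 := by
    refine integral_eq_zero_of_ae ?_
    filter_upwards [hu] with s hs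
    by_cases hsU : s ∈ U
    · simp [hs hsU]
    · have : s ∉ tsupport (deriv φ) := fun h' => hsU (h3 (tsupport_deriv_subset h'))
      simp [image_eq_zero_of_notMem_tsupport this]
  rw [h5] at h4
  have : ∫ s, φ s • w s = ∫ s, w s * φ s :=
    integral_congr_ae (Eventually.of_forall fun s => by simp [mul_comm])
  rw [this]
  linarith

/-- A bound that improves by a factor `K t / n` at each step of an iteration. -/
theorem norm_le_pow_div_factorial {g : ℝ → L2R} {g' : ℝ → L2R} {T K b : ℝ} {n : ℕ}
    (hg0 : g 0 = 0) (hg : ∀ τ ∈ Icc 0 T, HasDerivWithinAt g (g' τ) (Icc 0 T) τ)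
    (hg' : ∀ τ ∈ Icc 0 T, ‖g' τ‖ ≤ K * (b * (K * τ) ^ n / n.factorial)) :
    ∀ τ ∈ Icc 0 T, ‖g τ‖ ≤ b * (K * τ) ^ (n + 1) / (n + 1).factorial := by
  have hB : ∀ τ : ℝ, HasDerivAt (fun τ : ℝ => b * (K * τ) ^ (n + 1) / (n + 1).factorial)
      (K * (b * (K * τ) ^ n / n.factorial)) τ := by
    intro τ
    have h1 : HasDerivAt (fun τ : ℝ => K * τ) K τ := by
      simpa using (hasDerivAt_id τ).const_mul K
    refine (((h1.fun_pow (n + 1)).const_mul b).div_const _).congr_deriv ?_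
    rw [Nat.factorial_succ]
    have : ((n : ℝ) + 1) ≠ 0 := by positivity
    have : (n.factorial : ℝ) ≠ 0 := by positivity
    push_cast
    field_simp
  refine image_norm_le_of_norm_deriv_right_le_deriv_boundary
    (fun τ hτ => (hg τ hτ).continuousWithinAt) (fun τ hτ => ?_) (by simp [hg0]) hB
    (fun τ hτ => hg' τ (Ico_subset_Icc_self hτ))
  refine (hg τ (Ico_subset_Icc_self hτ)).mono_of_mem_nhdsWithin ?_
  filter_upwards [Icc_mem_nhdsGE hτ.2] with s hs using ⟨hτ.1.trans hs.1, hs.2⟩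

/-- Outside the light cone the `L²` norms of the unknowns satisfy a linear integral inequality with
zero initial values, by which they are bounded by `β (K t)^n / n!` for every `n`. -/
theorem IsIntegralCurveOn.eq_zero_outside {N : SobolevH 1 → SobolevH 1}
    (hN : ∀ B : ℝ, 0 ≤ B → ∃ K : ℝ, 0 ≤ K ∧ ∀ u : SobolevH 1, ‖u‖ ≤ B →
      ∀ᵐ s : ℝ, |SobolevH.D 0 (N u) s| ≤ K * |SobolevH.D 0 u s|)
    {T c R : ℝ} {x : ℝ → SobolevH 1 × SobolevH 1 × SobolevH 1}
    (hx : IsIntegralCurveOn x (waveField N) (Icc 0 T))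
    (hA0 : ∀ᵐ s : ℝ, s ∈ outside c R → SobolevH.D 0 (x 0).1 s = 0)
    (hB0 : ∀ᵐ s : ℝ, s ∈ outside c R → SobolevH.D 0 (x 0).2.1 s = 0)
    (hv0 : ∀ᵐ s : ℝ, s ∈ outside c R → SobolevH.D 0 (x 0).2.2 s = 0) :
    ∀ t ∈ Icc 0 T, ∀ᵐ s : ℝ, s ∈ outside c (R + t) → SobolevH.D 0 (x t).2.2 s = 0 := by
  set P : ℝ → L2R →L[ℝ] L2R := fun t =>
    cutoff (outside c (R + t)) (isOpen_outside c (R + t)).measurableSet with hP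
  set a : ℝ → L2R := fun t => shift t (SobolevH.D 0 (x t).1) with ha
  set b : ℝ → L2R := fun t => shift (-t) (SobolevH.D 0 (x t).2.1) with hb
  set v : ℝ → L2R := fun t => SobolevH.D 0 (x t).2.2 with hv
  have hxc : ContinuousOn x (Icc 0 T) := fun t ht => (hx t ht).continuousWithinAt
  obtain ⟨β, hβ⟩ := isCompact_Icc.exists_bound_of_continuousOn hxc
  obtain ⟨K₀, hK₀, hNK⟩ := hN (max β 0) (le_max_right _ _)
  set K := K₀ + 1 with hK
  have hK0 : 0 ≤ K := by positivity
  have hx1 : ∀ t ∈ Icc 0 T, ‖(x t).1‖ ≤ max β 0 := fun t ht =>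
    (norm_fst_le _).trans ((hβ t ht).trans (le_max_left _ _))
  have hx2 : ∀ t ∈ Icc 0 T, ‖(x t).2.1‖ ≤ max β 0 := fun t ht =>
    (norm_fst_le _).trans ((norm_snd_le _).trans ((hβ t ht).trans (le_max_left _ _)))
  have hx3 : ∀ t ∈ Icc 0 T, ‖(x t).2.2‖ ≤ max β 0 := fun t ht =>
    (norm_snd_le _).trans ((norm_snd_le _).trans ((hβ t ht).trans (le_max_left _ _)))
  -- the cut-off of a function at a later time is controlled by that at an earlier time
  have hPmono : ∀ τ t, τ ≤ t → ∀ u, ‖P t u‖ ≤ ‖P τ u‖ := fun τ t h u => by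
    have := norm_cutoff_le (isOpen_outside c (R + t)).measurableSet
      (isOpen_outside c (R + τ)).measurableSet (outside_subset (by linarith)) zero_le_one
      (u := u) (w := u) (Eventually.of_forall fun s => by rw [one_mul])
    rwa [one_mul] at this
  have hPshift : ∀ τ t d, |d| ≤ t - τ → ∀ u, ‖P t (shift d u)‖ ≤ ‖P τ u‖ := fun τ t d h u =>
    norm_cutoff_shift_le _ _ (fun s hs => outside_subset (by linarith) (add_mem_outside hs)) u
  have hPN : ∀ t ∈ Icc 0 T, ‖P t (SobolevH.D 0 (N (x t).2.2))‖ ≤ K * ‖P t (v t)‖ :=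
    fun t ht => by
      refine (norm_cutoff_le (isOpen_outside c (R + t)).measurableSet
        (isOpen_outside c (R + t)).measurableSet subset_rfl hK₀ (hNK _ (hx3 t ht))).trans ?_
      have : 0 ≤ ‖P t (v t)‖ := norm_nonneg _
      show K₀ * ‖P t (v t)‖ ≤ K * ‖P t (v t)‖
      rw [hK]
      nlinarith
  have hP1 : ∀ t u, ‖P t u‖ ≤ ‖u‖ := fun t u => by
    apply Lp.norm_le_norm_of_ae_le
    filter_upwards [coeFn_cutoff (isOpen_outside c (R + t)).measurableSet u] with s h1
    rw [hP, h1]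
    exact norm_indicator_le_norm_self _ _
  have key : ∀ n : ℕ, ∀ t ∈ Icc 0 T,
      ‖P t (a t)‖ ≤ max β 0 * (K * t) ^ n / n.factorial ∧
      ‖P t (b t)‖ ≤ max β 0 * (K * t) ^ n / n.factorial ∧
      ‖P t (v t)‖ ≤ max β 0 * (K * t) ^ n / n.factorial := by
    intro n
    induction n with
    | zero =>
      intro t ht
      simp only [pow_zero, mul_one, Nat.factorial_zero, Nat.cast_one, div_one]
      refine ⟨(hP1 _ _).trans ?_, (hP1 _ _).trans ?_, (hP1 _ _).trans ?_⟩
      · rw [ha, LinearIsometry.norm_map]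
        exact (SobolevH.norm_D_le 0 _).trans (hx1 t ht)
      · rw [hb, LinearIsometry.norm_map]
        exact (SobolevH.norm_D_le 0 _).trans (hx2 t ht)
      · exact (SobolevH.norm_D_le 0 _).trans (hx3 t ht)
    | succ n ih =>
      intro t ht
      have hsub : Icc 0 t ⊆ Icc 0 T := Icc_subset_Icc_right ht.2
      have hm : t ∈ Icc 0 t := ⟨ht.1, le_rfl⟩
      have hxt : ∀ τ ∈ Icc 0 t, HasDerivWithinAt x (waveField N τ (x τ)) (Icc 0 t) τ :=
        fun τ hτ => (hx τ (hsub hτ)).mono hsub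
      refine ⟨?_, ?_, ?_⟩
      · refine norm_le_pow_div_factorial (T := t) (b := max β 0)
          (g := fun τ => P t (shift t (SobolevH.D 0 (x τ).1)))
          (g' := fun τ => P t (shift t (SobolevH.D 0 (shift₁ (-τ) (N (x τ).2.2))))) ?_
          (fun τ hτ => ?_) (fun τ hτ => ?_) t hm
        · rw [← norm_le_zero_iff]
          refine (hPshift 0 t t (by rw [abs_of_nonneg ht.1, sub_zero]) _).trans ?_
          rw [norm_le_zero_iff, hP]
          simp only [add_zero]
          exact (cutoff_eq_zero_iff _ _).mpr hA0
        · exact (((hxt τ hτ).fst_prod.clm_image (SobolevH.D 0)).clm_image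
            (shift t).toContinuousLinearMap).clm_image (P t)
        · rw [D_zero_shift₁, shift_shift]
          refine (hPshift τ t _ (by rw [← sub_eq_add_neg, abs_of_nonneg (by linarith [hτ.2])])
            _).trans ((hPN τ (hsub hτ)).trans ?_)
          exact mul_le_mul_of_nonneg_left (ih τ (hsub hτ)).2.2 hK0
      · refine norm_le_pow_div_factorial (T := t) (b := max β 0)
          (g := fun τ => P t (shift (-t) (SobolevH.D 0 (x τ).2.1)))
          (g' := fun τ => P t (shift (-t) (SobolevH.D 0 (shift₁ τ (N (x τ).2.2))))) ?_
          (fun τ hτ => ?_) (fun τ hτ => ?_) t hm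
        · rw [← norm_le_zero_iff]
          refine (hPshift 0 t (-t) (by rw [abs_neg, abs_of_nonneg ht.1, sub_zero]) _).trans ?_
          rw [norm_le_zero_iff, hP]
          simp only [add_zero]
          exact (cutoff_eq_zero_iff _ _).mpr hB0
        · exact (((hxt τ hτ).snd_prod.fst_prod.clm_image (SobolevH.D 0)).clm_image
            (shift (-t)).toContinuousLinearMap).clm_image (P t)
        · rw [D_zero_shift₁, shift_shift]
          refine (hPshift τ t _ ?_ _).trans ((hPN τ (hsub hτ)).trans ?_)
          · rw [abs_of_nonpos (by linarith [hτ.2])]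
            linarith
          · exact mul_le_mul_of_nonneg_left (ih τ (hsub hτ)).2.2 hK0
      · refine norm_le_pow_div_factorial (T := t) (b := max β 0)
          (g := fun τ => P t (SobolevH.D 0 (x τ).2.2))
          (g' := fun τ => P t (SobolevH.D 0
            ((1 / 2 : ℝ) • (shift₁ τ (x τ).1 + shift₁ (-τ) (x τ).2.1)))) ?_
          (fun τ hτ => ?_) (fun τ hτ => ?_) t hm
        · rw [← norm_le_zero_iff]
          refine (hPmono 0 t ht.1 _).trans ?_
          rw [norm_le_zero_iff, hP]
          simp only [add_zero]
          exact (cutoff_eq_zero_iff _ _).mpr hv0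
        · exact ((hxt τ hτ).snd_prod.snd_prod.clm_image (SobolevH.D 0)).clm_image (P t)
        · have h1 : SobolevH.D 0 ((1 / 2 : ℝ) • (shift₁ τ (x τ).1 + shift₁ (-τ) (x τ).2.1)) =
              (1 / 2 : ℝ) • (a τ + b τ) := by
            rw [map_smul, map_add, D_zero_shift₁, D_zero_shift₁]
          rw [h1]
          refine (hPmono τ t hτ.2 _).trans ?_
          rw [map_smul, map_add, norm_smul]
          have h2 := norm_add_le (P τ (a τ)) (P τ (b τ))
          obtain ⟨h3, h4, -⟩ := ih τ (hsub hτ)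
          have h5 : ‖(1 / 2 : ℝ)‖ = 1 / 2 := by norm_num
          have h6 : 0 ≤ max β 0 * (K * τ) ^ n / n.factorial := by
            have : 0 ≤ K * τ := mul_nonneg hK0 hτ.1
            have : 0 ≤ max β 0 := le_max_right _ _
            positivity
          rw [h5]
          have h7 : max β 0 * (K * τ) ^ n / n.factorial ≤
              K * (max β 0 * (K * τ) ^ n / n.factorial) := by
            have : 1 ≤ K := by rw [hK]; linarith
            nlinarith
          linarith
  intro t ht
  refine (cutoff_eq_zero_iff (isOpen_outside c (R + t)).measurableSet _).mp ?_
  rw [← norm_le_zero_iff]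
  have hlim : Tendsto (fun n : ℕ => max β 0 * (K * t) ^ n / n.factorial) atTop (𝓝 0) := by
    have := (FloorSemiring.tendsto_pow_div_factorial_atTop (K * t)).const_mul (max β 0)
    simpa [mul_div_assoc] using this
  exact ge_of_tendsto' hlim fun n => (key n t ht).2.2

/-! ### Exponentially growing solutions of `φ'' = (μ² + W) φ` -/

theorem hasDerivAt_setIntegral_Iic {g : ℝ → ℝ} (hg : Continuous g)
    (hi : ∀ s, IntegrableOn g (Iic s)) (s : ℝ) :
    HasDerivAt (fun s => ∫ x in Iic s, g x) (g s) s := by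
  have h1 : ∀ t, ∫ x in Iic t, g x = (∫ x in Iic s, g x) + ∫ x in s..t, g x := fun t => by
    rw [← intervalIntegral.integral_Iic_sub_Iic (hi s) (hi t)]
    ring
  rw [funext h1]
  exact (intervalIntegral.integral_hasDerivAt_right (hg.intervalIntegrable _ _)
    (hg.stronglyMeasurableAtFilter _ _) hg.continuousAt).const_add _

theorem abs_setIntegral_Iic_le {g W : ℝ → ℝ} (hW : Integrable W) {s C : ℝ} (hC : 0 ≤ C)
    (hW0 : ∀ x, 0 ≤ W x) (h : ∀ x ≤ s, |g x| ≤ C * W x) :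
    |∫ x in Iic s, g x| ≤ C * ∫ x, W x := by
  calc |∫ x in Iic s, g x| ≤ ∫ x in Iic s, C * W x := by
        rw [← Real.norm_eq_abs]
        refine norm_integral_le_of_norm_le (hW.const_mul C).integrableOn ?_
        filter_upwards [ae_restrict_mem measurableSet_Iic] with x hx using h x hx
    _ ≤ ∫ x, C * W x :=
        setIntegral_le_integral (hW.const_mul C)
          (Eventually.of_forall fun x => mul_nonneg hC (hW0 x))
    _ = C * ∫ x, W x := integral_const_mul _ _

section
open scoped BoundedContinuousFunction

variable {W : ℝ → ℝ} {μ : ℝ}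

/-- The right-hand side of the Volterra equation
`h(s) = 1 + (2μ)⁻¹ ∫_{-∞}^s (1 - exp(2μ(x - s))) W(x) h(x) dx`, which is solved by `h` precisely
when `φ(s) = exp(μs) h(s)` solves `φ'' = (μ² + W) φ` and `h → 1` at `-∞`. -/
def volterra (W : ℝ → ℝ) (μ : ℝ) (h : ℝ → ℝ) (s : ℝ) : ℝ :=
  1 + 1 / (2 * μ) * ((∫ x in Iic s, W x * h x) -
    Real.exp (-(2 * μ * s)) * ∫ x in Iic s, Real.exp (2 * μ * x) * (W x * h x))

theorem integrable_mul_bcf (hW : Integrable W) (h : ℝ →ᵇ ℝ) : Integrable fun x => W x * h x :=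
  hW.mul_bdd (c := ‖h‖) h.continuous.aestronglyMeasurable
    (Eventually.of_forall fun x => h.norm_coe_le_norm x)

theorem integrableOn_exp_mul_bcf (hμ : 0 < μ) (hW : Integrable W) (h : ℝ →ᵇ ℝ) (s : ℝ) :
    IntegrableOn (fun x => Real.exp (2 * μ * x) * (W x * h x)) (Iic s) := by
  refine (integrable_mul_bcf hW h).integrableOn.bdd_mul (c := Real.exp (2 * μ * s))
    (by fun_prop) ?_
  filter_upwards [ae_restrict_mem measurableSet_Iic] with x hx
  rw [Real.norm_eq_abs, Real.abs_exp]
  have : x ≤ s := hx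
  gcongr

theorem volterra_sub (hμ : 0 < μ) (hW : Integrable W) (h k : ℝ →ᵇ ℝ) (s : ℝ) :
    volterra W μ h s - volterra W μ k s = volterra W μ (h - k) s - 1 := by
  have h1 : ∫ x in Iic s, W x * (h - k) x =
      (∫ x in Iic s, W x * h x) - ∫ x in Iic s, W x * k x := by
    rw [← integral_sub (integrable_mul_bcf hW h).integrableOn
      (integrable_mul_bcf hW k).integrableOn]
    simp [mul_sub]
  have h2 : ∫ x in Iic s, Real.exp (2 * μ * x) * (W x * (h - k) x) =
      (∫ x in Iic s, Real.exp (2 * μ * x) * (W x * h x)) -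
        ∫ x in Iic s, Real.exp (2 * μ * x) * (W x * k x) := by
    rw [← integral_sub (integrableOn_exp_mul_bcf hμ hW h s) (integrableOn_exp_mul_bcf hμ hW k s)]
    simp [mul_sub]
  have h3 : ((h - k : ℝ →ᵇ ℝ) : ℝ → ℝ) = ⇑h - ⇑k := rfl
  rw [h3] at h1 h2
  unfold volterra
  rw [h1, h2]
  ring

theorem abs_volterra_sub_one_le (hμ : 0 < μ) (hW : Integrable W) (hW0 : ∀ x, 0 ≤ W x)
    (hWμ : ∫ x, W x ≤ μ / 4) (h : ℝ →ᵇ ℝ) (s : ℝ) : |volterra W μ h s - 1| ≤ ‖h‖ / 4 := by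
  have hb : ∀ x, |W x * h x| ≤ ‖h‖ * W x := fun x => by
    rw [abs_mul, abs_of_nonneg (hW0 x), mul_comm]
    exact mul_le_mul_of_nonneg_right (h.norm_coe_le_norm x) (hW0 x)
  have h1 : |∫ x in Iic s, W x * h x| ≤ ‖h‖ * ∫ x, W x :=
    abs_setIntegral_Iic_le hW (norm_nonneg h) hW0 fun x _ => hb x
  have h2 : |Real.exp (-(2 * μ * s)) * ∫ x in Iic s, Real.exp (2 * μ * x) * (W x * h x)| ≤
      ‖h‖ * ∫ x, W x := by
    rw [← integral_const_mul]
    refine abs_setIntegral_Iic_le hW (norm_nonneg h) hW0 fun x hx => ?_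
    rw [← mul_assoc, ← Real.exp_add, abs_mul, Real.abs_exp]
    have : Real.exp (-(2 * μ * s) + 2 * μ * x) ≤ 1 := Real.exp_le_one_iff.mpr (by nlinarith)
    calc _ ≤ 1 * |W x * h x| := mul_le_mul_of_nonneg_right this (abs_nonneg _)
      _ ≤ _ := by rw [one_mul]; exact hb x
  have h3 : ‖h‖ * ∫ x, W x ≤ ‖h‖ * (μ / 4) := mul_le_mul_of_nonneg_left hWμ (norm_nonneg h)
  unfold volterra
  rw [add_sub_cancel_left, abs_mul, abs_of_pos (by positivity)]
  calc _ ≤ 1 / (2 * μ) * (‖h‖ * (μ / 4) + ‖h‖ * (μ / 4)) := by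
        gcongr
        exact (abs_sub _ _).trans (add_le_add (h1.trans h3) (h2.trans h3))
    _ = ‖h‖ / 4 := by field_simp; ring

theorem hasDerivAt_integral_bcf (hWc : Continuous W) (hW : Integrable W) (h : ℝ →ᵇ ℝ) (s : ℝ) :
    HasDerivAt (fun s => ∫ x in Iic s, W x * h x) (W s * h s) s :=
  hasDerivAt_setIntegral_Iic (hWc.mul h.continuous)
    (fun _ => (integrable_mul_bcf hW h).integrableOn) s

theorem hasDerivAt_integral_exp_bcf (hμ : 0 < μ) (hWc : Continuous W) (hW : Integrable W)
    (h : ℝ →ᵇ ℝ) (s : ℝ) :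
    HasDerivAt (fun s => ∫ x in Iic s, Real.exp (2 * μ * x) * (W x * h x))
      (Real.exp (2 * μ * s) * (W s * h s)) s :=
  hasDerivAt_setIntegral_Iic ((by fun_prop : Continuous fun x => Real.exp (2 * μ * x)).mul
    (hWc.mul h.continuous)) (fun _ => integrableOn_exp_mul_bcf hμ hW h _) s

/-- The integral of `W` is so small that the Volterra equation is solved by a contraction with
constant `1 / 4`. -/
theorem exists_volterra_fixedPoint (hμ : 0 < μ) (hWc : Continuous W) (hW : Integrable W)
    (hW0 : ∀ x, 0 ≤ W x) (hWμ : ∫ x, W x ≤ μ / 4) :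
    ∃ h : ℝ →ᵇ ℝ, (∀ s, volterra W μ h s = h s) ∧ ∀ s, 2 / 3 ≤ h s ∧ h s ≤ 4 / 3 := by
  have hcont : ∀ h : ℝ →ᵇ ℝ, Continuous (volterra W μ h) := fun h => by
    have h1 : Continuous fun s => ∫ x in Iic s, W x * h x :=
      continuous_iff_continuousAt.mpr fun s => (hasDerivAt_integral_bcf hWc hW h s).continuousAt
    have h2 : Continuous fun s => ∫ x in Iic s, Real.exp (2 * μ * x) * (W x * h x) :=
      continuous_iff_continuousAt.mpr
        fun s => (hasDerivAt_integral_exp_bcf hμ hWc hW h s).continuousAt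
    unfold volterra
    fun_prop
  have hbound : ∀ (h : ℝ →ᵇ ℝ) s, ‖volterra W μ h s‖ ≤ ‖h‖ / 4 + 1 := fun h s => by
    have h1 := abs_volterra_sub_one_le hμ hW hW0 hWμ h s
    have h2 := abs_add_le (volterra W μ h s - 1) 1
    rw [sub_add_cancel, abs_one] at h2
    rw [Real.norm_eq_abs]
    linarith
  set Θ : (ℝ →ᵇ ℝ) → (ℝ →ᵇ ℝ) := fun h =>
    BoundedContinuousFunction.ofNormedAddCommGroup (volterra W μ h) (hcont h) _ (hbound h) with hΘ
  have hcontr : ContractingWith (1 / 4) Θ := by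
    refine ⟨by rw [← NNReal.coe_lt_coe]; norm_num, LipschitzWith.of_dist_le_mul fun h k => ?_⟩
    rw [dist_eq_norm, dist_eq_norm]
    refine (BoundedContinuousFunction.norm_le (by positivity)).mpr fun s => ?_
    have h1 := abs_volterra_sub_one_le hμ hW hW0 hWμ (h - k) s
    have h3 : ((h - k : ℝ →ᵇ ℝ) : ℝ → ℝ) = ⇑h - ⇑k := rfl
    rw [h3, ← volterra_sub hμ hW h k s] at h1
    have h2 : ‖(Θ h - Θ k) s‖ = |volterra W μ h s - volterra W μ k s| := rfl
    rw [h2]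
    refine h1.trans (le_of_eq ?_)
    push_cast
    ring
  obtain ⟨h, hfix, -⟩ := hcontr.exists_fixedPoint (0 : ℝ →ᵇ ℝ) (edist_ne_top _ _)
  have hfix' : ∀ s, volterra W μ h s = h s := fun s => congrArg (fun g : ℝ →ᵇ ℝ => g s) hfix
  have hnorm : ‖h‖ ≤ ‖h‖ / 4 + 1 :=
    (BoundedContinuousFunction.norm_le (by positivity)).mpr fun s => by
      rw [← hfix' s]; exact hbound h s
  refine ⟨h, hfix', fun s => ?_⟩
  have h1 := abs_le.mp (abs_volterra_sub_one_le hμ hW hW0 hWμ h s)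
  rw [hfix' s] at h1
  constructor <;> linarith [h1.1, h1.2]

end

/-- Elliptic regularity on the line: solutions of `φ'' = q φ` with `q` smooth are smooth. -/
theorem contDiff_of_second_derivative {φ φ' q : ℝ → ℝ} (h1 : ∀ s, HasDerivAt φ (φ' s) s)
    (h2 : ∀ s, HasDerivAt φ' (q s * φ s) s) (hq : ContDiff ℝ ∞ q) : ContDiff ℝ ∞ φ := by
  have hd1 : deriv φ = φ' := funext fun s => (h1 s).deriv
  have hd2 : deriv φ' = fun s => q s * φ s := funext fun s => (h2 s).deriv
  have key : ∀ n : ℕ, ContDiff ℝ n φ ∧ ContDiff ℝ n φ' := by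
    intro n
    induction n with
    | zero =>
      exact ⟨contDiff_zero.mpr (continuous_iff_continuousAt.mpr fun s => (h1 s).continuousAt),
        contDiff_zero.mpr (continuous_iff_continuousAt.mpr fun s => (h2 s).continuousAt)⟩
    | succ n ih =>
      push_cast
      refine ⟨contDiff_succ_iff_deriv.mpr ⟨fun s => (h1 s).differentiableAt, by simp, ?_⟩,
        contDiff_succ_iff_deriv.mpr ⟨fun s => (h2 s).differentiableAt, by simp, ?_⟩⟩
      · rw [hd1]; exact ih.2
      · rw [hd2]; exact (hq.of_le (by exact_mod_cast le_top)).mul ih.1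
  exact contDiff_infty.mpr fun n => (key n).1

/-- If `W ≥ 0` has small integral compared to `μ`, then `φ'' = (μ² + W) φ` has a solution of the
size of `exp (μ s)` on the whole line. -/
theorem exists_exponential_solution {W : ℝ → ℝ} {μ : ℝ} (hμ : 0 < μ) (hWs : ContDiff ℝ ∞ W)
    (hW : Integrable W) (hW0 : ∀ x, 0 ≤ W x) (hWμ : ∫ x, W x ≤ μ / 4) :
    ∃ φ : ℝ → ℝ, ContDiff ℝ ∞ φ ∧ (∀ s, deriv (deriv φ) s = (μ ^ 2 + W s) * φ s) ∧
      ∀ s, 2 / 3 * Real.exp (μ * s) ≤ φ s ∧ φ s ≤ 4 / 3 * Real.exp (μ * s) := by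
  obtain ⟨h, hfix, hbd⟩ := exists_volterra_fixedPoint hμ hWs.continuous hW hW0 hWμ
  set J₁ : ℝ → ℝ := fun s => ∫ x in Iic s, W x * h x with hJ₁
  set J₂ : ℝ → ℝ := fun s => ∫ x in Iic s, Real.exp (2 * μ * x) * (W x * h x) with hJ₂
  have hd1 : ∀ s, HasDerivAt J₁ (W s * h s) s := hasDerivAt_integral_bcf hWs.continuous hW h
  have hd2 : ∀ s, HasDerivAt J₂ (Real.exp (2 * μ * s) * (W s * h s)) s :=
    hasDerivAt_integral_exp_bcf hμ hWs.continuous hW h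
  have he : ∀ a s : ℝ, HasDerivAt (fun s => Real.exp (a * s)) (a * Real.exp (a * s)) s :=
    fun a s => by simpa [mul_comm] using ((hasDerivAt_id s).const_mul a).exp
  set φ : ℝ → ℝ := fun s => Real.exp (μ * s) +
    1 / (2 * μ) * (Real.exp (μ * s) * J₁ s - Real.exp (-μ * s) * J₂ s) with hφ
  set φ' : ℝ → ℝ := fun s => μ * Real.exp (μ * s) +
    1 / 2 * (Real.exp (μ * s) * J₁ s + Real.exp (-μ * s) * J₂ s) with hφ'
  have hee : ∀ s, Real.exp (-μ * s) * Real.exp (2 * μ * s) = Real.exp (μ * s) := fun s => by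
    rw [← Real.exp_add]; congr 1; ring
  have hφh : ∀ s, φ s = Real.exp (μ * s) * h s := fun s => by
    rw [← hfix s, hφ]
    have : Real.exp (μ * s) * Real.exp (-(2 * μ * s)) = Real.exp (-μ * s) := by
      rw [← Real.exp_add]; congr 1; ring
    simp only [volterra, ← this]
    ring
  have h1 : ∀ s, HasDerivAt φ (φ' s) s := fun s => by
    refine ((he μ s).add ((((he μ s).mul (hd1 s)).sub
      ((he (-μ) s).mul (hd2 s))).const_mul (1 / (2 * μ)))).congr_deriv ?_
    rw [← mul_assoc (Real.exp (-μ * s)), hee, hφ']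
    field_simp
    ring
  have h2 : ∀ s, HasDerivAt φ' ((μ ^ 2 + W s) * φ s) s := fun s => by
    refine (((he μ s).const_mul μ).add ((((he μ s).mul (hd1 s)).add
      ((he (-μ) s).mul (hd2 s))).const_mul (1 / 2))).congr_deriv ?_
    rw [← mul_assoc (Real.exp (-μ * s)), hee, add_mul, hφh s, ← hfix s]
    have : Real.exp (-(2 * μ * s)) * Real.exp (μ * s) = Real.exp (-μ * s) := by
      rw [← Real.exp_add]; congr 1; ring
    simp only [volterra, ← this, hJ₁, hJ₂]
    field_simp
    ring
  refine ⟨φ, contDiff_of_second_derivative h1 h2 (contDiff_const.add hWs), fun s => ?_,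
    fun s => ?_⟩
  · rw [show deriv φ = φ' from funext fun s => (h1 s).deriv, (h2 s).deriv]
  · have := Real.exp_pos (μ * s)
    rw [hφh s]
    constructor <;> nlinarith [(hbd s).1, (hbd s).2]

theorem integrable_potentialW {M : ℝ} (hM : 0 < M) :
    Integrable (potentialW M) ∧ ∫ s, potentialW M s ≤ 1 / M / 4 := by
  have hint : ∀ n : ℕ, ∫ s in (-(n : ℝ))..n, potentialW M s ≤ 1 / M / 4 := fun n => by
    rw [intervalIntegral.integral_eq_sub_of_hasDerivAt (fun s _ => hasDerivAt_neg_div_sq hM s)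
      ((contDiff_potentialW hM).continuous.intervalIntegrable _ _)]
    have h1 := areaRadius_gt hM (-(n : ℝ))
    have h2 := areaRadius_pos hM (n : ℝ)
    have h3 : M / areaRadius M (-(n : ℝ)) ^ 2 ≤ M / (2 * M) ^ 2 := by gcongr
    have h4 : 0 ≤ M / areaRadius M (n : ℝ) ^ 2 := by positivity
    have h5 : M / (2 * M) ^ 2 = 1 / M / 4 := by field_simp; norm_num
    linarith
  have ha : Tendsto (fun n : ℕ => -(n : ℝ)) atTop atBot :=
    tendsto_neg_atTop_atBot.comp tendsto_natCast_atTop_atTop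
  have hi : Integrable (potentialW M) := by
    refine integrable_of_intervalIntegral_norm_bounded (1 / M / 4)
      (fun n : ℕ => (contDiff_potentialW hM).continuous.integrableOn_Ioc) ha
      tendsto_natCast_atTop_atTop (Eventually.of_forall fun n => ?_)
    simp_rw [Real.norm_eq_abs, abs_of_nonneg (potentialW_nonneg hM _)]
    exact hint n
  exact ⟨hi, le_of_tendsto' (intervalIntegral_tendsto_integral hi ha
    tendsto_natCast_atTop_atTop) hint⟩

/-! ### The weak form of the equation -/

/-- A curve `u` in `L²(ℝ)` on the time interval `[0, T]`, with derivatives `ut` and `utt`, that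
solves `u_tt - u_ss + W u = f |u|^p` in the sense of distributions in the space variable, where
`G = f |u|^p ∈ L²(ℝ)`, and vanishes outside the forward light cone over `[c - R, c + R]`. -/
structure IsWeakWave (f W : ℝ → ℝ) (p c R T : ℝ) (u ut utt G : ℝ → L2R) : Prop where
  hasDeriv : ∀ t ∈ Icc 0 T, HasDerivWithinAt u (ut t) (Icc 0 T) t
  hasDeriv_t : ∀ t ∈ Icc 0 T, HasDerivWithinAt ut (utt t) (Icc 0 T) t
  weak : ∀ t ∈ Icc 0 T, ∀ ψ, IsTest ψ → ⟪utt t, toL2 ψ⟫ =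
    ⟪u t, toL2 fun s => deriv (deriv ψ) s - W s * ψ s⟫ + ⟪G t, toL2 ψ⟫
  source : ∀ t ∈ Icc 0 T, G t =ᵐ[volume] fun s => f s * |u t s| ^ p
  support : ∀ t ∈ Icc 0 T, ∀ᵐ s : ℝ, R + t < |s - c| → u t s = 0

theorem IsTest.mul_smooth {κ ψ : ℝ → ℝ} (hκ : IsTest κ) (hψ : ContDiff ℝ ∞ ψ) :
    IsTest fun s => κ s * ψ s :=
  ⟨hκ.smooth.mul hψ, hκ.supp.mul_right⟩

theorem toL2_sub {g h : ℝ → ℝ} (hg : MemLp g 2 volume) (hh : MemLp h 2 volume) :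
    toL2 (fun s => g s - h s) = toL2 g - toL2 h := by
  rw [toL2_eq hg, toL2_eq hh]
  exact toL2_eq (hg.sub hh)

theorem toL2_const_mul {g : ℝ → ℝ} (hg : MemLp g 2 volume) (a : ℝ) :
    toL2 (fun s => a * g s) = a • toL2 g := by
  rw [toL2_eq hg]
  exact toL2_eq (hg.const_mul a)

theorem inner_toL2_congr {u : L2R} {g h : ℝ → ℝ} (hg : MemLp g 2 volume) (hh : MemLp h 2 volume)
    (hgh : ∀ᵐ s : ℝ, u s * g s = u s * h s) : ⟪u, toL2 g⟫ = ⟪u, toL2 h⟫ := by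
  rw [inner_toL2 u hg, inner_toL2 u hh]
  exact integral_congr_ae hgh

theorem inner_toL2_nonneg {u : L2R} {g : ℝ → ℝ} (hg : MemLp g 2 volume)
    (h : ∀ᵐ s : ℝ, 0 ≤ u s * g s) : 0 ≤ ⟪u, toL2 g⟫ := by
  rw [inner_toL2 u hg]
  exact integral_nonneg_of_ae h

theorem integrable_mul_of_memLp (u : L2R) {g : ℝ → ℝ} (hg : MemLp g 2 volume) :
    Integrable fun s => u s * g s :=
  MemLp.integrable_mul (p := 2) (q := 2) (Lp.memLp u) hg

/-- Integration of a pointwise bound with an additional term on the set `S`. -/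
theorem inner_toL2_le {u w : L2R} {g h : ℝ → ℝ} {b : ℝ} {k : ℝ → ℝ} {S : Set ℝ}
    (hS : MeasurableSet S) (hg : MemLp g 2 volume) (hh : MemLp h 2 volume) (hk : IntegrableOn k S)
    (h1 : ∀ᵐ s : ℝ, s ∈ S → u s * g s ≤ b * (w s * h s) + k s)
    (h2 : ∀ᵐ s : ℝ, s ∉ S → u s * g s ≤ b * (w s * h s)) :
    ⟪u, toL2 g⟫ ≤ b * ⟪w, toL2 h⟫ + ∫ s in S, k s := by
  rw [inner_toL2 u hg, inner_toL2 w hh, ← integral_const_mul, ← integral_indicator hS,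
    ← integral_add ((integrable_mul_of_memLp w hh).const_mul b) (hk.integrable_indicator hS)]
  refine integral_mono_ae (integrable_mul_of_memLp u hg)
    (((integrable_mul_of_memLp w hh).const_mul b).add (hk.integrable_indicator hS)) ?_
  filter_upwards [h1, h2] with s hs1 hs2
  by_cases hs : s ∈ S
  · simpa [hs] using hs1 hs
  · simpa [hs] using hs2 hs

/-- A test function that equals `1` on the interval of radius `ρ` about `c`. -/
structure IsBump (c ρ : ℝ) (κ : ℝ → ℝ) : Prop where
  isTest : IsTest κ
  nonneg : ∀ s, 0 ≤ κ s
  eq_one : ∀ s, |s - c| ≤ ρ → κ s = 1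

theorem exists_isBump (c : ℝ) {ρ : ℝ} (hρ : 0 < ρ) : ∃ κ, IsBump c ρ κ := by
  let b : ContDiffBump c := ⟨ρ, ρ + 1, hρ, by linarith⟩
  exact ⟨b, ⟨b.contDiff, b.hasCompactSupport⟩, fun s => b.nonneg,
    fun s hs => b.one_of_mem_closedBall (by rwa [Metric.mem_closedBall, Real.dist_eq])⟩

theorem IsBump.deriv_deriv_mul {c ρ : ℝ} {κ : ℝ → ℝ} (hκ : IsBump c ρ κ) (ψ : ℝ → ℝ) {s : ℝ}
    (hs : |s - c| < ρ) : deriv (deriv fun s => κ s * ψ s) s = deriv (deriv ψ) s := by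
  have h1 : (fun s => κ s * ψ s) =ᶠ[𝓝 s] ψ := by
    have : ∀ᶠ x in 𝓝 s, |x - c| < ρ :=
      (continuous_abs.comp (continuous_id.sub continuous_const)).continuousAt.eventually_lt
        continuousAt_const hs
    filter_upwards [this] with x hx
    rw [hκ.eq_one x hx.le, one_mul]
  exact h1.deriv.deriv_eq

namespace IsWeakWave

variable {f W : ℝ → ℝ} {p c R T : ℝ} {u ut utt G : ℝ → L2R}

/-- The weak form with test functions that need not have compact support. -/
theorem inner_tt (h : IsWeakWave f W p c R T u ut utt G) (hW : ContDiff ℝ ∞ W) {κ ψ : ℝ → ℝ}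
    (hκ : IsBump c (R + T + 1) κ) (hψ : ContDiff ℝ ∞ ψ) {t : ℝ} (ht : t ∈ Icc 0 T) :
    ⟪utt t, toL2 fun s => κ s * ψ s⟫ =
      ⟪u t, toL2 fun s => κ s * (deriv (deriv ψ) s - W s * ψ s)⟫ +
        ⟪G t, toL2 fun s => κ s * ψ s⟫ := by
  have hψ2 : ContDiff ℝ ∞ (deriv (deriv ψ)) := hψ.deriv'.deriv'
  have h1 := hκ.isTest.mul_smooth hψ
  rw [h.weak t ht _ h1]
  congr 1
  refine inner_toL2_congr ((h1.deriv.deriv.memLp).sub ?_)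
    (hκ.isTest.mul_smooth (hψ2.sub (hW.mul hψ))).memLp ?_
  · have := (hκ.isTest.mul_smooth (hW.mul hψ)).memLp
    refine this.ae_eq (Eventually.of_forall fun s => ?_)
    simp only
    ring
  · filter_upwards [h.support t ht] with s hs
    by_cases hsc : R + t < |s - c|
    · rw [hs hsc, zero_mul, zero_mul]
    · have h2 : |s - c| < R + T + 1 := by linarith [ht.2, not_lt.mp hsc]
      rw [hκ.deriv_deriv_mul ψ h2, hκ.eq_one s h2.le]
      ring

theorem source_nonneg (h : IsWeakWave f W p c R T u ut utt G) (hf : ∀ s, 0 ≤ f s) {t : ℝ}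
    (ht : t ∈ Icc 0 T) {g : ℝ → ℝ} (hg : MemLp g 2 volume) (hg0 : ∀ s, 0 ≤ g s) :
    0 ≤ ⟪G t, toL2 g⟫ := by
  refine inner_toL2_nonneg hg ?_
  filter_upwards [h.source t ht] with s hs
  rw [hs]
  exact mul_nonneg (mul_nonneg (hf s) (Real.rpow_nonneg (abs_nonneg _) _)) (hg0 s)

end IsWeakWave

theorem monotoneOn_Icc_of_hasDerivWithinAt {g g' : ℝ → ℝ} {a b : ℝ}
    (hg : ∀ t ∈ Icc a b, HasDerivWithinAt g (g' t) (Icc a b) t) (h0 : ∀ t ∈ Icc a b, 0 ≤ g' t) :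
    MonotoneOn g (Icc a b) := by
  refine monotoneOn_of_hasDerivWithinAt_nonneg (convex_Icc a b)
    (fun t ht => (hg t ht).continuousWithinAt) (f' := g') (fun t ht => ?_) fun t ht => ?_
  · exact (hg t (interior_subset ht)).mono interior_subset
  · exact h0 t (interior_subset ht)

/-- A solution of `y'' = μ² y + n` with `n ≥ 0` grows exponentially if `y(0), y'(0) ≥ 0`. -/
theorem exp_growth_of_second_derivative {y y' n : ℝ → ℝ} {μ T : ℝ}
    (hy : ∀ t ∈ Icc 0 T, HasDerivWithinAt y (y' t) (Icc 0 T) t)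
    (hy' : ∀ t ∈ Icc 0 T, HasDerivWithinAt y' (μ ^ 2 * y t + n t) (Icc 0 T) t)
    (hn : ∀ t ∈ Icc 0 T, 0 ≤ n t) (h0 : 0 ≤ y 0) (h0' : 0 ≤ y' 0) {t : ℝ} (ht : t ∈ Icc 0 T) :
    y 0 / 2 * Real.exp (μ * t) ≤ y t := by
  have hT : (0 : ℝ) ∈ Icc 0 T := ⟨le_rfl, ht.1.trans ht.2⟩
  have he : ∀ a t : ℝ, HasDerivAt (fun t => Real.exp (a * t)) (a * Real.exp (a * t)) t :=
    fun a s => by simpa [mul_comm] using ((hasDerivAt_id s).const_mul a).exp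
  -- `(y' + μ y) exp (-μ t)` is nondecreasing
  have hm1 : MonotoneOn (fun t => (y' t + μ * y t) * Real.exp (-μ * t)) (Icc 0 T) := by
    refine monotoneOn_Icc_of_hasDerivWithinAt (g' := fun t => n t * Real.exp (-μ * t))
      (fun t ht => ?_) fun t ht => mul_nonneg (hn t ht) (Real.exp_pos _).le
    refine (((hy' t ht).fun_add ((hy t ht).const_mul μ)).fun_mul
      (he (-μ) t).hasDerivWithinAt).congr_deriv ?_
    ring
  have hz : ∀ t ∈ Icc 0 T, μ * y 0 * Real.exp (μ * t) ≤ y' t + μ * y t := fun t ht => by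
    have h1 := hm1 hT ht ht.1
    simp only [mul_zero, Real.exp_zero, mul_one] at h1
    have h2 : Real.exp (-μ * t) * Real.exp (μ * t) = 1 := by
      rw [← Real.exp_add, neg_mul, neg_add_cancel, Real.exp_zero]
    have h3 : μ * y 0 ≤ (y' t + μ * y t) * Real.exp (-μ * t) := by linarith
    have h4 := mul_le_mul_of_nonneg_right h3 (Real.exp_pos (μ * t)).le
    rwa [mul_assoc (y' t + μ * y t), h2, mul_one] at h4
  -- hence so is `y exp (μ t) - y(0) exp (2 μ t) / 2`
  have hm2 : MonotoneOn (fun t => y t * Real.exp (μ * t) - y 0 / 2 * Real.exp (2 * μ * t))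
      (Icc 0 T) := by
    refine monotoneOn_Icc_of_hasDerivWithinAt
      (g' := fun t => (y' t + μ * y t - μ * y 0 * Real.exp (μ * t)) * Real.exp (μ * t))
      (fun t ht => ?_) fun t ht => mul_nonneg (sub_nonneg.mpr (hz t ht)) (Real.exp_pos _).le
    refine (((hy t ht).fun_mul (he μ t).hasDerivWithinAt).fun_sub
      ((he (2 * μ) t).hasDerivWithinAt.const_mul (y 0 / 2))).congr_deriv ?_
    have : Real.exp (2 * μ * t) = Real.exp (μ * t) * Real.exp (μ * t) := by
      rw [← Real.exp_add]; congr 1; ring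
    rw [this]
    ring
  have h1 := hm2 hT ht ht.1
  simp only [mul_zero, Real.exp_zero, mul_one] at h1
  have h2 : Real.exp (2 * μ * t) = Real.exp (μ * t) * Real.exp (μ * t) := by
    rw [← Real.exp_add]; congr 1; ring
  rw [h2] at h1
  have h3 := Real.exp_pos (μ * t)
  by_contra hcon
  push Not at hcon
  nlinarith [mul_lt_mul_of_pos_right hcon h3]

namespace IsWeakWave

variable {f W : ℝ → ℝ} {p c R T : ℝ} {u ut utt G : ℝ → L2R}

/-- Exponential growth of the pairing of a solution with an exponential solution of the
stationary equation `φ'' = (μ² + W) φ`. -/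
theorem exp_growth (h : IsWeakWave f W p c R T u ut utt G) (hW : ContDiff ℝ ∞ W)
    (hf : ∀ s, 0 ≤ f s) {κ φ : ℝ → ℝ} (hκ : IsBump c (R + T + 1) κ) (hφ : ContDiff ℝ ∞ φ)
    (hφ0 : ∀ s, 0 ≤ φ s) {μ : ℝ}
    (hφμ : ∀ s, deriv (deriv φ) s = (μ ^ 2 + W s) * φ s)
    (h0 : ∀ᵐ s : ℝ, 0 ≤ u 0 s) (h0' : ∀ᵐ s : ℝ, 0 ≤ ut 0 s) {t : ℝ} (ht : t ∈ Icc 0 T) :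
    ⟪u 0, toL2 fun s => κ s * φ s⟫ / 2 * Real.exp (μ * t) ≤ ⟪u t, toL2 fun s => κ s * φ s⟫ := by
  have hm := (hκ.isTest.mul_smooth hφ).memLp
  have hpos : ∀ s, 0 ≤ κ s * φ s := fun s => mul_nonneg (hκ.nonneg s) (hφ0 s)
  refine exp_growth_of_second_derivative (y := fun t => ⟪u t, toL2 fun s => κ s * φ s⟫)
    (y' := fun t => ⟪ut t, toL2 fun s => κ s * φ s⟫)
    (n := fun t => ⟪G t, toL2 fun s => κ s * φ s⟫) (fun t ht => ?_) (fun t ht => ?_)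
    (fun t ht => h.source_nonneg hf ht hm hpos) (inner_toL2_nonneg hm ?_)
    (inner_toL2_nonneg hm ?_) ht
  · simpa using (h.hasDeriv t ht).inner ℝ (hasDerivWithinAt_const t (Icc 0 T) _)
  · have h1 := (h.hasDeriv_t t ht).inner ℝ
      (hasDerivWithinAt_const t (Icc 0 T) (toL2 fun s => κ s * φ s))
    rw [inner_zero_right, zero_add, h.inner_tt hW hκ hφ ht] at h1
    have h2 : (fun s => κ s * (deriv (deriv φ) s - W s * φ s)) =
        fun s => μ ^ 2 * (κ s * φ s) := funext fun s => by rw [hφμ s]; ring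
    rw [h2, toL2_const_mul hm, real_inner_smul_right] at h1
    exact h1
  · filter_upwards [h0] with s hs using mul_nonneg hs (hpos s)
  · filter_upwards [h0'] with s hs using mul_nonneg hs (hpos s)

end IsWeakWave

/-! ### The test function adapted to the geometry -/

/-- A smooth transition `η` from `1` to `0` which is the fourth power of a transition `ζ`, so that
its second derivative is controlled by `ζ²`. -/
structure IsTransition (η ζ : ℝ → ℝ) (C : ℝ) : Prop where
  smooth : ContDiff ℝ ∞ η
  eq_pow : ∀ x, η x = ζ x ^ 4
  nonneg : ∀ x, 0 ≤ ζ x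
  le_one : ∀ x, ζ x ≤ 1
  eq_one : ∀ x ≤ 1 / 2, ζ x = 1
  eq_zero : ∀ x, 1 ≤ x → ζ x = 0
  isTest_deriv : IsTest (deriv η)
  deriv_nonpos : ∀ x, deriv η x ≤ 0
  abs_deriv_deriv_le : ∀ x, |deriv (deriv η) x| ≤ C * ζ x ^ 2

theorem exists_isTransition : ∃ η ζ C, 0 ≤ C ∧ IsTransition η ζ C := by
  set ζ : ℝ → ℝ := fun x => Real.smoothTransition (2 - 2 * x) with hζ
  have hζs : ContDiff ℝ ∞ ζ :=
    Real.smoothTransition.contDiff.comp (contDiff_const.sub (contDiff_const.mul contDiff_id))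
  have h1 : ∀ x ≤ 1 / 2, ζ x = 1 := fun x hx =>
    Real.smoothTransition.one_of_one_le (by linarith)
  have h0 : ∀ x, 1 ≤ x → ζ x = 0 := fun x hx =>
    Real.smoothTransition.zero_of_nonpos (by linarith)
  have hanti : Antitone ζ := fun x y hxy => Real.smoothTransition.monotone (by linarith)
  have hle : ∀ x, ζ x ≤ 1 := fun x => Real.smoothTransition.le_one _
  have hnn : ∀ x, 0 ≤ ζ x := fun x => Real.smoothTransition.nonneg _
  have hsupp : ∀ x, x ∉ Icc (0 : ℝ) 2 → deriv ζ x = 0 := fun x hx => by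
    rcases lt_or_ge x 0 with h | h
    · have : ζ =ᶠ[𝓝 x] fun _ => 1 := by
        filter_upwards [gt_mem_nhds h] with y hy using h1 y (by linarith)
      rw [this.deriv_eq, deriv_const]
    · have hx2 : 2 < x := lt_of_not_ge fun h' => hx ⟨h, h'⟩
      have : ζ =ᶠ[𝓝 x] fun _ => 0 := by
        filter_upwards [lt_mem_nhds hx2] with y hy using h0 y (by linarith)
      rw [this.deriv_eq, deriv_const]
  have hζt : IsTest (deriv ζ) :=
    ⟨hζs.deriv', HasCompactSupport.intro isCompact_Icc hsupp⟩
  obtain ⟨C₁, hC₁⟩ := hζt.exists_bound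
  obtain ⟨C₂, hC₂⟩ := hζt.deriv.exists_bound
  have hd : ∀ x, HasDerivAt ζ (deriv ζ x) x := fun x =>
    ((hζs.differentiable (by simp)) x).hasDerivAt
  have hd1 : deriv (fun x => ζ x ^ 4) = fun x => 4 * ζ x ^ 3 * deriv ζ x := funext fun x => by
    simpa using ((hd x).fun_pow 4).deriv
  have hd2 : ∀ x, deriv (deriv fun x => ζ x ^ 4) x =
      12 * ζ x ^ 2 * deriv ζ x ^ 2 + 4 * ζ x ^ 3 * deriv (deriv ζ) x := fun x => by
    rw [hd1]
    have := ((((hd x).fun_pow 3).const_mul 4).fun_mul (hζt.hasDerivAt x)).deriv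
    rw [this]
    norm_num
    ring
  refine ⟨fun x => ζ x ^ 4, ζ, 12 * C₁ ^ 2 + 4 * |C₂|, by positivity,
    ⟨hζs.pow 4, fun _ => rfl, hnn, hle, h1, h0, ⟨(hζs.pow 4).deriv', ?_⟩, fun x => ?_,
      fun x => ?_⟩⟩
  · rw [hd1]
    exact hζt.supp.mul_left
  · rw [hd1]
    exact mul_nonpos_of_nonneg_of_nonpos (mul_nonneg (by norm_num) (pow_nonneg (hnn x) 3))
      hanti.deriv_nonpos
  · rw [hd2]
    have e1 : deriv ζ x ^ 2 ≤ C₁ ^ 2 := by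
      rw [← sq_abs]
      exact pow_le_pow_left₀ (abs_nonneg _) (hC₁ x) 2
    have e2 : |deriv (deriv ζ) x| ≤ |C₂| := (hC₂ x).trans (le_abs_self _)
    have e3 : ζ x ^ 3 ≤ ζ x ^ 2 := pow_le_pow_of_le_one (hnn x) (hle x) (by norm_num)
    have e4 : 0 ≤ ζ x ^ 3 := pow_nonneg (hnn x) 3
    calc |12 * ζ x ^ 2 * deriv ζ x ^ 2 + 4 * ζ x ^ 3 * deriv (deriv ζ) x|
        ≤ |12 * ζ x ^ 2 * deriv ζ x ^ 2| + |4 * ζ x ^ 3 * deriv (deriv ζ) x| := abs_add_le _ _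
      _ = 12 * ζ x ^ 2 * deriv ζ x ^ 2 + 4 * (ζ x ^ 3 * |deriv (deriv ζ) x|) := by
          rw [abs_of_nonneg (by positivity), abs_mul, abs_of_nonneg (by positivity)]
          ring
      _ ≤ 12 * ζ x ^ 2 * C₁ ^ 2 + 4 * (ζ x ^ 2 * |C₂|) := by gcongr
      _ = _ := by ring

/-- Differentiation in `t` of the curve `t ↦ κ(s) ρ(s) g(t + σ(s))` in `L²(ℝ)`. -/
theorem hasDerivAt_toL2_profile {κ ρ σ g g' g'' : ℝ → ℝ} (hκ : Continuous κ)
    (hκc : HasCompactSupport κ) (hρ : Continuous ρ) (hσ : Continuous σ)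
    (h1 : ∀ x, HasDerivAt g (g' x) x) (h2 : ∀ x, HasDerivAt g' (g'' x) x) {C : ℝ}
    (hC : ∀ x, |g'' x| ≤ C) (t : ℝ) :
    HasDerivAt (fun t => toL2 fun s => κ s * (ρ s * g (t + σ s)))
      (toL2 fun s => κ s * (ρ s * g' (t + σ s))) t := by
  have hg : Continuous g := continuous_iff_continuousAt.mpr fun x => (h1 x).continuousAt
  have hg' : Continuous g' := continuous_iff_continuousAt.mpr fun x => (h2 x).continuousAt
  refine hasDerivAt_toL2 (k := fun s => C * |κ s * ρ s|) (fun t => ?_) ?_ ?_ fun h _ s => ?_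
  · exact hκc.mul_right.memLp_two (by fun_prop)
  · exact hκc.mul_right.memLp_two (by fun_prop)
  · exact ((hκc.mul_right.memLp_two (hκ.mul hρ)).abs).const_mul C
  · have := abs_taylor_le h1 h2 hC (t + σ s) h
    have e : κ s * (ρ s * g (t + h + σ s)) - κ s * (ρ s * g (t + σ s)) -
        h * (κ s * (ρ s * g' (t + σ s))) =
        κ s * ρ s * (g (t + σ s + h) - g (t + σ s) - h * g' (t + σ s)) := by
      rw [add_right_comm]; ring
    rw [e, abs_mul]
    calc |κ s * ρ s| * _ ≤ |κ s * ρ s| * (C * h ^ 2) :=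
          mul_le_mul_of_nonneg_left this (abs_nonneg _)
      _ = h ^ 2 * (C * |κ s * ρ s|) := by ring

/-- The time delay `σ = -2M log F`. It satisfies `σ' = -4M²/r²`, so that the function
`r η((t + σ)/T)` is an approximate solution of the linear equation near the horizon. -/
def horizonDelay (M s : ℝ) : ℝ := -(2 * M * Real.log (lapseF M s))

section Geometry

variable {M : ℝ} (hM : 0 < M)
include hM

theorem horizonDelay_nonneg (s : ℝ) : 0 ≤ horizonDelay M s := by
  have := Real.log_nonpos (lapseF_pos hM s).le (lapseF_lt_one hM s).le
  unfold horizonDelay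
  nlinarith

theorem contDiff_horizonDelay : ContDiff ℝ ∞ (horizonDelay M) :=
  (contDiff_const.mul ((contDiff_lapseF hM).log fun s => (lapseF_pos hM s).ne')).neg

theorem hasDerivAt_horizonDelay (s : ℝ) :
    HasDerivAt (horizonDelay M) (-(4 * M ^ 2 / areaRadius M s ^ 2)) s := by
  have hF := (lapseF_pos hM s).ne'
  have hr := (areaRadius_pos hM s).ne'
  refine ((((hasDerivAt_lapseF hM s).log hF).const_mul (2 * M)).neg).congr_deriv ?_
  field_simp
  norm_num

theorem exists_horizonDelay_le : ∃ C : ℝ, 0 ≤ C ∧ ∀ s, horizonDelay M s ≤ C + |s| := by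
  obtain ⟨c, hc, h⟩ := exists_lapseF_ge hM
  refine ⟨|2 * M * Real.log c|, abs_nonneg _, fun s => ?_⟩
  have h1 := Real.log_le_log (by positivity) (h s)
  rw [Real.log_mul hc.ne' (Real.exp_pos _).ne', Real.log_exp] at h1
  have h2 : 2 * M * (Real.log c + min s 0 / (2 * M)) ≤ 2 * M * Real.log (lapseF M s) :=
    mul_le_mul_of_nonneg_left h1 (by positivity)
  have h3 : 2 * M * (Real.log c + min s 0 / (2 * M)) = 2 * M * Real.log c + min s 0 := by
    field_simp
  have h4 : -|s| ≤ min s 0 := le_min (neg_abs_le s) (neg_nonpos.mpr (abs_nonneg s))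
  have h5 := neg_abs_le (2 * M * Real.log c)
  unfold horizonDelay
  linarith

/-- The spatial part of the linear wave operator applied to `r g(t + σ)`. The terms with `g'`
cancel because `2 F σ' + r σ'' = 0`. -/
theorem deriv_deriv_areaRadius_mul {g g' g'' : ℝ → ℝ} (h1 : ∀ x, HasDerivAt g (g' x) x)
    (h2 : ∀ x, HasDerivAt g' (g'' x) x) (t s : ℝ) :
    deriv (deriv fun s => areaRadius M s * g (t + horizonDelay M s)) s -
        potentialW M s * (areaRadius M s * g (t + horizonDelay M s)) =
      16 * M ^ 4 / areaRadius M s ^ 3 * g'' (t + horizonDelay M s) := by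
  have hr : ∀ s, areaRadius M s ≠ 0 := fun s => (areaRadius_pos hM s).ne'
  have hc : ∀ {k k' : ℝ → ℝ}, (∀ x, HasDerivAt k (k' x) x) → ∀ s,
      HasDerivAt (fun s => k (t + horizonDelay M s))
        (k' (t + horizonDelay M s) * -(4 * M ^ 2 / areaRadius M s ^ 2)) s := fun hk s =>
    (hk _).comp s ((hasDerivAt_horizonDelay hM s).const_add t)
  have hd1 : deriv (fun s => areaRadius M s * g (t + horizonDelay M s)) = fun s =>
      lapseF M s * g (t + horizonDelay M s) -
        4 * M ^ 2 * ((areaRadius M s)⁻¹ * g' (t + horizonDelay M s)) := funext fun s => by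
    rw [((hasDerivAt_areaRadius hM s).fun_mul (hc h1 s)).deriv]
    have := hr s
    field_simp
    ring
  rw [hd1]
  have h3 := (((hasDerivAt_lapseF hM s).fun_mul (hc h1 s)).fun_sub
    ((((hasDerivAt_areaRadius hM s).fun_inv (hr s)).fun_mul (hc h2 s)).const_mul (4 * M ^ 2))).deriv
  rw [h3, potentialW]
  have := hr s
  field_simp
  ring

/-- With `x = 2M / r` the left-hand side is `1 - x⁴ = (1 - x) (1 + x) (1 + x²)`, and `F = 1 - x`. -/
theorem one_sub_pow_le_lapseF (s : ℝ) :
    |1 - 16 * M ^ 4 / areaRadius M s ^ 4| ≤ 4 * lapseF M s := by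
  have hr := areaRadius_pos hM s
  have hF := lapseF_pos hM s
  set x := 2 * M / areaRadius M s with hx
  have hx0 : 0 < x := by positivity
  have hFx : lapseF M s = 1 - x := rfl
  rw [hFx] at hF ⊢
  have h1 : 16 * M ^ 4 / areaRadius M s ^ 4 = x ^ 4 := by rw [hx, div_pow]; ring
  have hx2 : x ^ 2 < 1 := by nlinarith
  rw [h1, abs_of_nonneg (by nlinarith)]
  have h2 : 1 - x ^ 4 = (1 - x) * ((1 + x) * (1 + x ^ 2)) := by ring
  rw [h2]
  have h3 : (1 + x) * (1 + x ^ 2) ≤ 2 * 2 := by gcongr <;> linarith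
  nlinarith

end Geometry

/-! ### The integral estimates behind blow-up -/

/-- Young's inequality with a weight, the constants `1 / p` and `(p - 1) / p` being dropped. -/
theorem mul_le_weighted_young {a b w p : ℝ} (ha : 0 ≤ a) (hb : 0 ≤ b) (hw : 0 < w) (hp : 1 < p) :
    a * b ≤ w * a ^ p + w ^ (-(1 / (p - 1))) * b ^ (p / (p - 1)) := by
  have hp0 : 0 < p := by linarith
  have hp1 : 0 < p - 1 := by linarith
  have hc : p.HolderConjugate (p / (p - 1)) := Real.HolderConjugate.conjExponent hp
  have h := Real.young_inequality_of_nonneg (a := w ^ (1 / p) * a) (b := w ^ (-(1 / p)) * b)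
    (by positivity) (by positivity) hc
  have e1 : w ^ (1 / p) * a * (w ^ (-(1 / p)) * b) = a * b := by
    have : w ^ (1 / p) * w ^ (-(1 / p)) = 1 := by
      rw [← Real.rpow_add hw, add_neg_cancel, Real.rpow_zero]
    linear_combination a * b * this
  have e2 : (w ^ (1 / p) * a) ^ p = w * a ^ p := by
    rw [Real.mul_rpow (by positivity) ha, ← Real.rpow_mul hw.le, one_div_mul_cancel hp0.ne',
      Real.rpow_one]
  have e3 : (w ^ (-(1 / p)) * b) ^ (p / (p - 1)) =
      w ^ (-(1 / (p - 1))) * b ^ (p / (p - 1)) := by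
    rw [Real.mul_rpow (by positivity) hb, ← Real.rpow_mul hw.le]
    congr 2
    field_simp
  rw [e1, e2, e3] at h
  refine h.trans (add_le_add (div_le_self (by positivity) hp.le)
    (div_le_self (by positivity) ?_))
  rw [one_le_div hp1]
  linarith

theorem abs_le_of_abs_sub_le {s c ρ : ℝ} (h : |s - c| ≤ ρ) : |s| ≤ |c| + ρ := by
  have := abs_add_le (s - c) c
  rw [sub_add_cancel] at this
  linarith

/-- The profile `x ↦ η(x / T)`. -/
def scaled (η : ℝ → ℝ) (T x : ℝ) : ℝ := η (x / T)

section Scaled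

variable {η ζ : ℝ → ℝ} {C T : ℝ}

theorem IsTransition.contDiff_scaled (h : IsTransition η ζ C) : ContDiff ℝ ∞ (scaled η T) :=
  h.smooth.comp (contDiff_id.div_const T)

theorem IsTransition.deriv_scaled (h : IsTransition η ζ C) :
    deriv (scaled η T) = fun x => deriv η (x / T) / T := funext fun x => by
  have h1 : HasDerivAt η (deriv η (x / T)) (x / T) :=
    ((h.smooth.differentiable (by simp)) _).hasDerivAt
  have h2 := (h1.comp x ((hasDerivAt_id x).div_const T)).deriv
  rw [show η ∘ (fun x => id x / T) = scaled η T from rfl] at h2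
  rw [h2]
  ring

theorem IsTransition.deriv_deriv_scaled (h : IsTransition η ζ C) :
    deriv (deriv (scaled η T)) = fun x => deriv (deriv η) (x / T) / T ^ 2 := funext fun x => by
  rw [h.deriv_scaled]
  have h1 := h.isTest_deriv.hasDerivAt (x / T)
  have h2 := ((h1.comp x ((hasDerivAt_id x).div_const T)).div_const T).deriv
  rw [show (fun y => (deriv η ∘ (fun x => id x / T)) y / T) =
    fun x => deriv η (x / T) / T from rfl] at h2
  rw [h2]
  ring

theorem IsTransition.isTest_deriv_scaled (h : IsTransition η ζ C) (hT : 0 < T) :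
    IsTest (deriv (scaled η T)) := by
  refine ⟨h.contDiff_scaled.deriv', ?_⟩
  rw [h.deriv_scaled]
  have h1 : HasCompactSupport fun x : ℝ => deriv η (x * T⁻¹) :=
    h.isTest_deriv.supp.comp_homeomorph (Homeomorph.mulRight₀ T⁻¹ (inv_ne_zero hT.ne'))
  simp only [div_eq_mul_inv]
  exact h1.mul_right

end Scaled

namespace IsWeakWave

variable {M p c R T : ℝ} {u ut utt G : ℝ → L2R}

/-- The duality pairing of a solution with the function `r g(t + σ)`. -/
theorem hasDerivWithinAt_pairing {f : ℝ → ℝ} (hM : 0 < M)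
    (h : IsWeakWave f (potentialW M) p c R T u ut utt G)
    {κ g : ℝ → ℝ} (hκ : IsBump c (R + T + 1) κ) (hg : ContDiff ℝ ∞ g) (hg' : IsTest (deriv g))
    {t : ℝ} (ht : t ∈ Icc 0 T) :
    HasDerivWithinAt
      (fun t => ⟪ut t, toL2 fun s => κ s * (areaRadius M s * g (t + horizonDelay M s))⟫ -
        ⟪u t, toL2 fun s => κ s * (areaRadius M s * deriv g (t + horizonDelay M s))⟫)
      (⟪G t, toL2 fun s => κ s * (areaRadius M s * g (t + horizonDelay M s))⟫ -
        ⟪u t, toL2 fun s => κ s * (areaRadius M s * ((1 - 16 * M ^ 4 / areaRadius M s ^ 4) *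
          deriv (deriv g) (t + horizonDelay M s)))⟫) (Icc 0 T) t := by
  have hr := contDiff_areaRadius hM
  have hσ := contDiff_horizonDelay hM
  have h1 : ∀ x, HasDerivAt g (deriv g x) x := fun x =>
    ((hg.differentiable (by simp)) x).hasDerivAt
  obtain ⟨C₁, hC₁⟩ := hg'.deriv.exists_bound
  obtain ⟨C₂, hC₂⟩ := hg'.deriv.deriv.exists_bound
  have hA := hasDerivAt_toL2_profile hκ.isTest.continuous hκ.isTest.supp hr.continuous
    hσ.continuous h1 hg'.hasDerivAt hC₁ t
  have hB := hasDerivAt_toL2_profile hκ.isTest.continuous hκ.isTest.supp hr.continuous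
    hσ.continuous hg'.hasDerivAt hg'.deriv.hasDerivAt hC₂ t
  have hψ : ContDiff ℝ ∞ fun s => areaRadius M s * g (t + horizonDelay M s) :=
    hr.mul (hg.comp (contDiff_const.add hσ))
  have hc2 : ContDiff ℝ ∞ fun s => deriv (deriv g) (t + horizonDelay M s) :=
    hg'.deriv.smooth.comp (contDiff_const.add hσ)
  have hr0 : ∀ s, areaRadius M s ≠ 0 := fun s => (areaRadius_pos hM s).ne'
  refine (((h.hasDeriv_t t ht).inner ℝ hA.hasDerivWithinAt).fun_sub
    ((h.hasDeriv t ht).inner ℝ hB.hasDerivWithinAt)).congr_deriv ?_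
  rw [h.inner_tt (contDiff_potentialW hM) hκ hψ ht]
  simp only [deriv_deriv_areaRadius_mul hM h1 hg'.hasDerivAt]
  have e : (fun s => κ s * (areaRadius M s * ((1 - 16 * M ^ 4 / areaRadius M s ^ 4) *
          deriv (deriv g) (t + horizonDelay M s)))) = fun s =>
      κ s * (areaRadius M s * deriv (deriv g) (t + horizonDelay M s)) -
        κ s * (16 * M ^ 4 / areaRadius M s ^ 3 * deriv (deriv g) (t + horizonDelay M s)) :=
    funext fun s => by
      have := hr0 s
      field_simp
  have hq : ContDiff ℝ ∞ fun s => 16 * M ^ 4 / areaRadius M s ^ 3 :=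
    contDiff_const.div (hr.pow 3) fun s => pow_ne_zero 3 (hr0 s)
  rw [e, toL2_sub (hκ.isTest.mul_smooth (hr.mul hc2)).memLp
    (hκ.isTest.mul_smooth (hq.mul hc2)).memLp, inner_sub_right]
  ring

/-- Both sides vanish outside the light cone. -/
theorem source_mul_eq_zero {f W : ℝ → ℝ} (hp : 0 < p) (h : IsWeakWave f W p c R T u ut utt G)
    {t : ℝ} (ht : t ∈ Icc 0 T) (k l : ℝ → ℝ) (b : ℝ) :
    ∀ᵐ s : ℝ, s ∉ Icc (c - (R + t)) (c + (R + t)) → u t s * k s ≤ b * (G t s * l s) := by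
  filter_upwards [h.support t ht, h.source t ht] with s h1 h2 hs
  have h3 : R + t < |s - c| := by
    by_contra hcon
    have := abs_le.mp (not_lt.mp hcon)
    exact hs ⟨by linarith [this.1], by linarith [this.2]⟩
  rw [h2, h1 h3]
  simp [Real.zero_rpow hp.ne']

/-- The error made by the approximate solution `r η((t + σ)/T)` is absorbed in the nonlinearity up
to a power of `T`. -/
theorem exists_error_le (hM : 0 < M) (hp : 2 < p) (hR : 0 < R) {η ζ : ℝ → ℝ} {C : ℝ} (hC : 0 ≤ C)
    (hη : IsTransition η ζ C) :
    ∃ K : ℝ, ∀ T, 1 ≤ T → ∀ u ut utt G,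
      IsWeakWave (nonlinWeight M p) (potentialW M) p c R T u ut utt G →
      ∀ κ, IsBump c (R + T + 1) κ → ∀ t ∈ Icc 0 T,
        ⟪u t, toL2 fun s => κ s * (areaRadius M s * ((1 - 16 * M ^ 4 / areaRadius M s ^ 4) *
          deriv (deriv (scaled η T)) (t + horizonDelay M s)))⟫ ≤
        1 / 2 * ⟪G t, toL2 fun s =>
          κ s * (areaRadius M s * scaled η T (t + horizonDelay M s))⟫ +
          K * T ^ (1 - 2 / (p - 1)) := by
  have hr0 := areaRadius_pos hM
  set C₂ := areaRadius M 0 + |c| + R + 1 with hC₂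
  have hC₂0 : 0 < C₂ := by have := hr0 0; positivity
  have hp1 : 0 < p - 1 := by linarith
  set K₀ := (1 / 2 * C₂ ^ (2 - p)) ^ (-(1 / (p - 1))) * (4 * C * C₂) ^ (p / (p - 1)) with hK₀
  have hK₀0 : 0 ≤ K₀ := by positivity
  refine ⟨2 * (R + 1) * K₀, fun T hT u ut utt G h κ hκ t ht => ?_⟩
  have hT0 : 0 < T := by linarith
  have hr := contDiff_areaRadius hM
  have hσ := contDiff_horizonDelay hM
  have hg := hη.isTest_deriv_scaled hT0
  have hm1 : MemLp (fun s => κ s * (areaRadius M s * ((1 - 16 * M ^ 4 / areaRadius M s ^ 4) *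
      deriv (deriv (scaled η T)) (t + horizonDelay M s)))) 2 volume :=
    (hκ.isTest.mul_smooth (hr.mul ((contDiff_const.sub (contDiff_const.div (hr.pow 4)
      fun s => pow_ne_zero 4 (hr0 s).ne')).mul
        (hg.deriv.smooth.comp (contDiff_const.add hσ))))).memLp
  have hm2 : MemLp (fun s => κ s * (areaRadius M s * scaled η T (t + horizonDelay M s))) 2 volume :=
    (hκ.isTest.mul_smooth (hr.mul (hη.contDiff_scaled.comp (contDiff_const.add hσ)))).memLp
  have hYK : (1 / 2 * (C₂ * T) ^ (2 - p)) ^ (-(1 / (p - 1))) *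
      (4 * C * C₂ * T ^ (-1 : ℝ)) ^ (p / (p - 1)) = K₀ * T ^ (-(2 / (p - 1))) := by
    rw [Real.mul_rpow hC₂0.le hT0.le, ← mul_assoc,
      Real.mul_rpow (x := 1 / 2 * C₂ ^ (2 - p)) (by positivity) (by positivity),
      Real.mul_rpow (x := 4 * C * C₂) (by positivity) (by positivity), ← Real.rpow_mul hT0.le,
      ← Real.rpow_mul hT0.le,
      hK₀]
    have e : T ^ (-(2 / (p - 1))) =
        T ^ ((2 - p) * -(1 / (p - 1))) * T ^ (-1 * (p / (p - 1))) := by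
      rw [← Real.rpow_add hT0]
      congr 1
      field_simp
      ring
    rw [e]
    ring
  refine (inner_toL2_le (w := G t) (b := 1 / 2) (S := Icc (c - (R + t)) (c + (R + t)))
    (k := fun _ => K₀ * T ^ (-(2 / (p - 1)))) measurableSet_Icc hm1 hm2
    continuous_const.integrableOn_Icc ?_
    (h.source_mul_eq_zero (by linarith) ht _ _ _)).trans ?_
  · filter_upwards [h.source t ht] with s hG hs
    have hsc : |s - c| ≤ R + t := abs_le.mpr ⟨by linarith [hs.1], by linarith [hs.2]⟩
    have hrs : areaRadius M s ≤ C₂ * T := by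
      have h1 := areaRadius_le hM s
      have h2 := abs_le_of_abs_sub_le hsc
      have h3 := abs_nonneg c
      have := hr0 0
      have h4 : areaRadius M 0 + |c| + R ≤ (areaRadius M 0 + |c| + R) * T :=
        le_mul_of_one_le_right (by positivity) hT
      have := ht.2
      rw [hC₂, add_mul _ 1, one_mul]
      linarith
    have hF := lapseF_pos hM s
    have hF1 := (lapseF_lt_one hM s).le
    have hκs : κ s = 1 := hκ.eq_one s (by linarith [ht.2])
    set x := (t + horizonDelay M s) / T with hx
    have hζ0 := hη.nonneg x
    have hζ1 := hη.le_one x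
    have hrs0 := hr0 s
    rw [hκs, hG, hη.deriv_deriv_scaled, one_mul, one_mul]
    simp only [scaled]
    rw [← hx, hη.eq_pow x]
    -- the left-hand side in absolute value
    have e1 : u t s * (areaRadius M s * ((1 - 16 * M ^ 4 / areaRadius M s ^ 4) *
        (deriv (deriv η) x / T ^ 2))) ≤
        lapseF M s * ((|u t s| * ζ x ^ 2) * (4 * C * C₂ * T ^ (-1 : ℝ))) := by
      refine (le_abs_self _).trans ?_
      rw [abs_mul, abs_mul, abs_mul, abs_div, abs_of_pos hrs0,
        abs_of_pos (by positivity : 0 < T ^ 2)]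
      calc |u t s| * (areaRadius M s * (|1 - 16 * M ^ 4 / areaRadius M s ^ 4| *
            (|deriv (deriv η) x| / T ^ 2)))
          ≤ |u t s| * (C₂ * T * (4 * lapseF M s * (C * ζ x ^ 2 / T ^ 2))) := by
            gcongr
            · exact one_sub_pow_le_lapseF hM s
            · exact hη.abs_deriv_deriv_le x
        _ = _ := by
            rw [Real.rpow_neg_one]
            field_simp
    have e2 := mul_le_weighted_young (a := |u t s| * ζ x ^ 2) (b := 4 * C * C₂ * T ^ (-1 : ℝ))
      (w := 1 / 2 * (C₂ * T) ^ (2 - p)) (p := p) (by positivity) (by positivity) (by positivity)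
      (by linarith)
    rw [hYK] at e2
    have e3 : (|u t s| * ζ x ^ 2) ^ p ≤ |u t s| ^ p * ζ x ^ 4 := by
      rw [Real.mul_rpow (abs_nonneg _) (by positivity)]
      gcongr
      calc (ζ x ^ 2) ^ p ≤ (ζ x ^ 2) ^ (2 : ℝ) :=
            Real.rpow_le_rpow_of_exponent_ge' (by positivity) (pow_le_one₀ hζ0 hζ1) (by norm_num)
              hp.le
        _ = ζ x ^ 4 := by rw [Real.rpow_two]; ring
    have e4 : (C₂ * T) ^ (2 - p) ≤ areaRadius M s ^ (2 - p) :=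
      Real.rpow_le_rpow_of_nonpos hrs0 hrs (by linarith)
    have e5 : areaRadius M s ^ (2 - p) = areaRadius M s ^ (1 - p) * areaRadius M s := by
      rw [← Real.rpow_add_one hrs0.ne']
      congr 1
      ring
    calc _ ≤ _ := e1
      _ ≤ lapseF M s * (1 / 2 * (C₂ * T) ^ (2 - p) * (|u t s| * ζ x ^ 2) ^ p +
            K₀ * T ^ (-(2 / (p - 1)))) := mul_le_mul_of_nonneg_left e2 hF.le
      _ ≤ lapseF M s * (1 / 2 * areaRadius M s ^ (2 - p) * (|u t s| ^ p * ζ x ^ 4)) +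
            1 * (K₀ * T ^ (-(2 / (p - 1)))) := by
          rw [mul_add]
          gcongr
      _ = _ := by
          rw [e5, nonlinWeight]
          ring
  · have hlen : c + (R + t) - (c - (R + t)) = 2 * (R + t) := by ring
    rw [setIntegral_const, Real.volume_real_Icc_of_le (by linarith [ht.1]), hlen, smul_eq_mul]
    have e1 : T ^ (1 - 2 / (p - 1)) = T * T ^ (-(2 / (p - 1))) := by
      rw [sub_eq_add_neg, Real.rpow_add hT0, Real.rpow_one]
    rw [e1]
    have e2 : R + t ≤ (R + 1) * T := by nlinarith [ht.2]
    have e3 : 0 ≤ K₀ * T ^ (-(2 / (p - 1))) := by positivity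
    have := mul_le_mul_of_nonneg_right e2 e3
    linarith

end IsWeakWave

namespace IsWeakWave

variable {M p c R T : ℝ} {u ut utt G : ℝ → L2R}

/-- Exponential growth of the pairing of the solution with an exponential function forces a lower
bound for the nonlinearity. In Young's inequality the weight is a multiple of `f r`, and the power
`p / (p - 1)` of `exp(s/M)` beats the power `1 / (p - 1)` of `1 / F`, which is `O(exp(-s/2M))` at
`-∞`. The remainder therefore concentrates at the outgoing edge `s = t + O(1)` of the light cone and
has an integral bounded by a multiple of `exp(t/M)`. -/
theorem exists_le_source (hM : 0 < M) (hp : 2 < p) (hR : 0 < R) {η ζ : ℝ → ℝ} {C : ℝ}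
    (hη : IsTransition η ζ C) {m : ℝ} (hm : 0 < m) :
    ∃ k T₁ : ℝ, 0 < k ∧ 1 ≤ T₁ ∧ ∀ T, T₁ ≤ T → ∀ u ut utt G,
      IsWeakWave (nonlinWeight M p) (potentialW M) p c R T u ut utt G →
      ∀ κ, IsBump c (R + T + 1) κ → ∀ φ : ℝ → ℝ, ContDiff ℝ ∞ φ →
      (∀ s, 0 ≤ φ s ∧ φ s ≤ 4 / 3 * Real.exp (1 / M * s)) → ∀ t ∈ Icc 0 (T / 8),
      m * Real.exp (1 / M * t) ≤ ⟪u t, toL2 fun s => κ s * φ s⟫ →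
        k * T ^ (2 - p) ≤ ⟪G t, toL2 fun s =>
          κ s * (areaRadius M s * scaled η T (t + horizonDelay M s))⟫ := by
  have hr0 := areaRadius_pos hM
  have hp1 : 0 < p - 1 := by linarith
  obtain ⟨C₅, hC₅, hσle⟩ := exists_horizonDelay_le hM
  obtain ⟨cF, hcF, hF⟩ := exists_lapseF_ge hM
  set ρ := |c| + R with hρ
  have hρ0 : 0 < ρ := by positivity
  set C₂ := areaRadius M 0 + |c| + R + 1 with hC₂
  have hC₂0 : 0 < C₂ := by have := hr0 0; positivity
  set k₁ := cF * C₂ ^ (2 - p) with hk₁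
  have hk₁0 : 0 < k₁ := by positivity
  set a := 1 / (2 * M * (p - 1)) with ha
  have ha0 : 0 < a := by positivity
  set q := p / (p - 1) with hq
  set α := q / M - a with hα
  have hα0 : 0 < α := by
    have : α = (2 * p - 1) / (2 * M * (p - 1)) := by
      rw [hα, hq, ha]
      field_simp
    rw [this]
    exact div_pos (by linarith) (by positivity)
  set B := (4 / 3 : ℝ) ^ q * Real.exp (a * ρ) * (Real.exp (α * ρ) / α) with hB
  have hB0 : 0 < B := by positivity
  -- the weight in Young's inequality, chosen to make the remainder equal to `m / 2`
  set X := (m / (2 * B)) ^ (-(p - 1)) with hX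
  have hX0 : 0 < X := by positivity
  have hXB : X ^ (-(1 / (p - 1))) * B = m / 2 := by
    rw [hX, ← Real.rpow_mul (by positivity)]
    have : -(p - 1) * -(1 / (p - 1)) = 1 := by field_simp
    rw [this, Real.rpow_one]
    field_simp
  refine ⟨m / 2 * (k₁ / X), max 1 (4 * (C₅ + ρ)), by positivity, le_max_left _ _,
    fun T hT u ut utt G h κ hκ φ hφ hφb t ht hy => ?_⟩
  have hT1 : 1 ≤ T := (le_max_left _ _).trans hT
  have hT4 : 4 * (C₅ + ρ) ≤ T := (le_max_right _ _).trans hT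
  have hT0 : 0 < T := by linarith
  have htT : t ∈ Icc 0 T := ⟨ht.1, by linarith [ht.2]⟩
  have hr := contDiff_areaRadius hM
  have hσ := contDiff_horizonDelay hM
  have hm1 : MemLp (fun s => κ s * φ s) 2 volume := (hκ.isTest.mul_smooth hφ).memLp
  have hm2 : MemLp (fun s => κ s * (areaRadius M s * scaled η T (t + horizonDelay M s))) 2 volume :=
    (hκ.isTest.mul_smooth (hr.mul (hη.contDiff_scaled.comp (contDiff_const.add hσ)))).memLp
  set θ := X / k₁ * T ^ (p - 2) with hθ
  have hθ0 : 0 < θ := by positivity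
  set K₁ := X ^ (-(1 / (p - 1))) * ((4 / 3 : ℝ) ^ q * Real.exp (a * ρ)) with hK₁
  have hexp : IntegrableOn (fun s => Real.exp (α * s)) (Iic (t + ρ)) :=
    integrableOn_exp_mul_Iic hα0 _
  have hint : IntegrableOn (fun s => Real.exp (1 / M * t) * K₁ * Real.exp (-(α * t)) *
      Real.exp (α * s)) (Iic (t + ρ)) := hexp.const_mul _
  have hsub : Icc (c - (R + t)) (c + (R + t)) ⊆ Iic (t + ρ) := fun s hs => by
    have := hs.2
    have := le_abs_self c
    show s ≤ t + ρ
    rw [hρ]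
    linarith
  have key := inner_toL2_le (u := u t) (w := G t) (b := θ * Real.exp (1 / M * t))
    (S := Icc (c - (R + t)) (c + (R + t))) (k := fun s => Real.exp (1 / M * t) * K₁ *
      Real.exp (-(α * t)) * Real.exp (α * s)) measurableSet_Icc hm1 hm2 (hint.mono_set hsub) ?_
    (h.source_mul_eq_zero (by linarith) htT _ _ _)
  · have h1 : ∫ s in Icc (c - (R + t)) (c + (R + t)), Real.exp (1 / M * t) * K₁ *
        Real.exp (-(α * t)) * Real.exp (α * s) ≤ m / 2 * Real.exp (1 / M * t) := by
      have h2 : 0 ≤ K₁ := by positivity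
      refine (setIntegral_mono_set hint (Eventually.of_forall fun s => ?_)
        (Eventually.of_forall hsub)).trans (le_of_eq ?_)
      · show 0 ≤ Real.exp (1 / M * t) * K₁ * Real.exp (-(α * t)) * Real.exp (α * s)
        positivity
      · rw [integral_const_mul, integral_exp_mul_Iic hα0, ← hXB, hK₁, hB]
        have : Real.exp (α * (t + ρ)) = Real.exp (α * t) * Real.exp (α * ρ) := by
          rw [← Real.exp_add]; congr 1; ring
        rw [this, Real.exp_neg]
        field_simp
    have hE := Real.exp_pos (1 / M * t)
    set n := ⟪G t, toL2 fun s =>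
          κ s * (areaRadius M s * scaled η T (t + horizonDelay M s))⟫ with hn
    have h3 : m / 2 * Real.exp (1 / M * t) ≤ θ * n * Real.exp (1 / M * t) := by linarith
    have h4 : m / 2 ≤ θ * n := le_of_mul_le_mul_right h3 hE
    have h5 : m / 2 / θ ≤ n := by
      rw [div_le_iff₀ hθ0]
      linarith
    refine le_trans (le_of_eq ?_) h5
    rw [hθ, show 2 - p = -(p - 2) by ring, Real.rpow_neg hT0.le]
    field_simp
  · filter_upwards [h.source t htT] with s hG hs
    have hsc : |s - c| ≤ R + t := abs_le.mpr ⟨by linarith [hs.1], by linarith [hs.2]⟩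
    have hsabs : |s| ≤ ρ + t := by
      have := abs_le_of_abs_sub_le hsc
      rw [hρ]; linarith
    have hrs0 := hr0 s
    have hrs : areaRadius M s ≤ C₂ * T := by
      have h1 := areaRadius_le hM s
      have := hr0 0
      have h4 : areaRadius M 0 + ρ ≤ (areaRadius M 0 + ρ) * T :=
        le_mul_of_one_le_right (by positivity) hT1
      have := htT.2
      have e : C₂ * T = (areaRadius M 0 + ρ) * T + T := by rw [hC₂, hρ]; ring
      rw [e]
      linarith
    have hκs : κ s = 1 := hκ.eq_one s (by linarith [htT.2])
    -- the cut-off in time equals `1` at such an early time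
    have hη1 : scaled η T (t + horizonDelay M s) = 1 := by
      have h1 : (t + horizonDelay M s) / T ≤ 1 / 2 := by
        rw [div_le_iff₀ hT0]
        have := hσle s
        have := ht.2
        linarith
      rw [scaled, hη.eq_pow, hη.eq_one _ h1, one_pow]
    have hmin : -(s - t - ρ) ≥ -min s 0 := by
      have := neg_abs_le s
      rcases le_total s 0 with h0 | h0
      · rw [min_eq_left h0]; linarith [ht.1]
      · rw [min_eq_right h0]; linarith [le_abs_self s]
    set w := X * Real.exp (min s 0 / (2 * M)) with hw
    have e2 := mul_le_weighted_young (a := |u t s|) (b := 4 / 3 * Real.exp (1 / M * (s - t)))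
      (w := w) (p := p) (abs_nonneg _) (by positivity) (by positivity) (by linarith)
    have e3 : w ^ (-(1 / (p - 1))) * (4 / 3 * Real.exp (1 / M * (s - t))) ^ (p / (p - 1)) ≤
        K₁ * Real.exp (-(α * t)) * Real.exp (α * s) := by
      rw [hw, Real.mul_rpow hX0.le (Real.exp_pos _).le, Real.mul_rpow (by norm_num)
        (Real.exp_pos _).le, ← Real.exp_mul, ← Real.exp_mul, hK₁, ← hq]
      have e4 : Real.exp (min s 0 / (2 * M) * -(1 / (p - 1))) ≤
          Real.exp (a * ρ) * Real.exp (-(a * (s - t))) := by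
        rw [← Real.exp_add]
        refine Real.exp_le_exp.mpr ?_
        have : min s 0 / (2 * M) * -(1 / (p - 1)) = a * -min s 0 := by
          rw [ha]; field_simp
        rw [this]
        have := mul_le_mul_of_nonneg_left hmin ha0.le
        linarith
      have e5 : Real.exp (-(a * (s - t))) * Real.exp (1 / M * (s - t) * q) =
          Real.exp (-(α * t)) * Real.exp (α * s) := by
        rw [← Real.exp_add, ← Real.exp_add, hα]
        congr 1
        ring
      calc X ^ (-(1 / (p - 1))) * Real.exp (min s 0 / (2 * M) * -(1 / (p - 1))) *
            ((4 / 3) ^ q * Real.exp (1 / M * (s - t) * q))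
          ≤ X ^ (-(1 / (p - 1))) * (Real.exp (a * ρ) * Real.exp (-(a * (s - t)))) *
            ((4 / 3) ^ q * Real.exp (1 / M * (s - t) * q)) := by gcongr
        _ = X ^ (-(1 / (p - 1))) * ((4 / 3) ^ q * Real.exp (a * ρ)) *
            (Real.exp (-(a * (s - t))) * Real.exp (1 / M * (s - t) * q)) := by ring
        _ = _ := by rw [e5]; ring
    have e6 : w * |u t s| ^ p ≤ θ * (nonlinWeight M p s * |u t s| ^ p * areaRadius M s) := by
      have e7 : areaRadius M s ^ (2 - p) = areaRadius M s ^ (1 - p) * areaRadius M s := by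
        rw [← Real.rpow_add_one hrs0.ne']
        congr 1
        ring
      have e8 : (C₂ * T) ^ (2 - p) ≤ areaRadius M s ^ (2 - p) :=
        Real.rpow_le_rpow_of_nonpos hrs0 hrs (by linarith)
      have e9 : w = θ * (cF * Real.exp (min s 0 / (2 * M)) * (C₂ * T) ^ (2 - p)) := by
        rw [hw, hθ, Real.mul_rpow hC₂0.le hT0.le, hk₁]
        have : T ^ (p - 2) * T ^ (2 - p) = 1 := by
          rw [← Real.rpow_add hT0]
          simp
        field_simp
        linear_combination -this
      calc w * |u t s| ^ p ≤ θ * (lapseF M s * areaRadius M s ^ (2 - p)) * |u t s| ^ p := by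
            rw [e9]
            have := (lapseF_pos hM s).le
            gcongr
            exact hF s
        _ = _ := by rw [e7, nonlinWeight]; ring
    rw [hκs, hG, hη1, one_mul, one_mul, mul_one]
    have hE : Real.exp (1 / M * s) = Real.exp (1 / M * (s - t)) * Real.exp (1 / M * t) := by
      rw [← Real.exp_add]; congr 1; ring
    calc u t s * φ s ≤ |u t s| * (4 / 3 * Real.exp (1 / M * s)) := by
          refine (le_abs_self _).trans ?_
          rw [abs_mul, abs_of_nonneg (hφb s).1]
          exact mul_le_mul_of_nonneg_left (hφb s).2 (abs_nonneg _)
      _ = |u t s| * (4 / 3 * Real.exp (1 / M * (s - t))) * Real.exp (1 / M * t) := by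
          rw [hE]; ring
      _ ≤ (θ * (nonlinWeight M p s * |u t s| ^ p * areaRadius M s) +
            K₁ * Real.exp (-(α * t)) * Real.exp (α * s)) * Real.exp (1 / M * t) :=
          mul_le_mul_of_nonneg_right (e2.trans (add_le_add e6 e3)) (Real.exp_pos _).le
      _ = _ := by ring

end IsWeakWave

/-! ### Non-existence of solutions on long time intervals -/

/-- This is where the condition `p < 1 + √2` enters. -/
theorem exists_rpow_gt {p : ℝ} (hp : 2 < p) (hp' : p < 1 + Real.sqrt 2) {k : ℝ} (hk : 0 < k)
    (K T₁ : ℝ) (hT₁ : 1 ≤ T₁) :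
    ∃ T, T₁ ≤ T ∧ K * T ^ (1 - 2 / (p - 1)) < 1 / 2 * (k * T ^ (2 - p)) / 8 := by
  have hp1 : 0 < p - 1 := by linarith
  set δ := 1 - p + 2 / (p - 1) with hδ
  have hδ0 : 0 < δ := by
    have h2 : (p - 1) ^ 2 < 2 := by
      have h3 : p - 1 < Real.sqrt 2 := by linarith
      calc (p - 1) ^ 2 < Real.sqrt 2 ^ 2 := pow_lt_pow_left₀ h3 hp1.le (by norm_num)
        _ = 2 := Real.sq_sqrt (by norm_num)
    have : δ = (2 - (p - 1) ^ 2) / (p - 1) := by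
      rw [hδ]
      field_simp
      ring
    rw [this]
    exact div_pos (by linarith) hp1
  obtain ⟨T, hT1, hT2⟩ := (((tendsto_rpow_atTop hδ0).eventually_gt_atTop (16 * K / k)).and
    (eventually_ge_atTop T₁)).exists
  have hT0 : 0 < T := by linarith
  refine ⟨T, hT2, ?_⟩
  have e : T ^ (2 - p) = T ^ δ * T ^ (1 - 2 / (p - 1)) := by
    rw [← Real.rpow_add hT0]
    congr 1
    rw [hδ]
    ring
  have h3 : 0 < T ^ (1 - 2 / (p - 1)) := Real.rpow_pos_of_pos hT0 _
  rw [div_lt_iff₀ hk] at hT1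
  rw [e]
  nlinarith [mul_lt_mul_of_pos_right hT1 h3]

theorem IsAdmissibleDatum.inner_ge {c R ε : ℝ} {h : L2R} (hh : IsAdmissibleDatum c R ε h)
    (hε : 0 < ε) {g : ℝ → ℝ} (hg : MemLp g 2 volume) {e : ℝ} (he : 0 ≤ e)
    (hge : ∀ s, |s - c| ≤ R → e ≤ g s) : e * ε ≤ ⟪h, toL2 g⟫ := by
  -- a function that is not integrable would have integral zero
  have hi : Integrable h := by
    by_contra hcon
    have := hh.integral_ge
    rw [integral_undef hcon] at this
    linarith
  rw [inner_toL2 h hg]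
  calc e * ε ≤ e * ∫ s, h s := mul_le_mul_of_nonneg_left hh.integral_ge he
    _ = ∫ s, e * h s := (integral_const_mul _ _).symm
    _ ≤ ∫ s, h s * g s := by
        refine integral_mono_ae (hi.const_mul e) (integrable_mul_of_memLp h hg) ?_
        filter_upwards [hh.nonneg, hh.support] with s h1 h2
        rcases le_or_gt |s - c| R with h3 | h3
        · rw [mul_comm]
          exact mul_le_mul_of_nonneg_left (hge s h3) h1
        · rw [h2 h3, mul_zero, zero_mul]

/-- A solution whose data have mass at least `ε` does not exist on a long time interval. -/
theorem exists_not_isWeakWave {M p c R ε : ℝ} (hM : 0 < M) (hp : 2 < p)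
    (hp' : p < 1 + Real.sqrt 2) (hR : 0 < R) (hε : 0 < ε) {u₀ u₁ : L2R}
    (h₀ : IsAdmissibleDatum c R ε u₀) (h₁ : IsAdmissibleDatum c R ε u₁) :
    ∃ T, 0 < T ∧ ∀ u ut utt G, u 0 = u₀ → ut 0 = u₁ →
      ¬ IsWeakWave (nonlinWeight M p) (potentialW M) p c R T u ut utt G := by
  obtain ⟨φ, hφs, hφ, hφb⟩ := exists_exponential_solution (μ := 1 / M) (by positivity)
    (contDiff_potentialW hM) (integrable_potentialW hM).1 (potentialW_nonneg hM)
    (integrable_potentialW hM).2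
  have hφ0 : ∀ s, 0 ≤ φ s := fun s => (by positivity : (0 : ℝ) ≤ _).trans (hφb s).1
  obtain ⟨η, ζ, C, hC, hη⟩ := exists_isTransition
  set e := 2 / 3 * Real.exp (1 / M * (c - R)) with he
  have he0 : 0 < e := by positivity
  obtain ⟨K, hK⟩ := IsWeakWave.exists_error_le (c := c) hM hp hR hC hη
  obtain ⟨k, T₁, hk, hT₁, hk'⟩ := IsWeakWave.exists_le_source (c := c) hM hp hR hη
    (m := e * ε / 2) (by positivity)
  obtain ⟨T, hT, hlt⟩ := exists_rpow_gt hp hp' hk K T₁ hT₁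
  have hT1 : 1 ≤ T := hT₁.trans hT
  have hT0 : 0 < T := by linarith
  refine ⟨T, hT0, fun u ut utt G hu0 hut0 h => ?_⟩
  obtain ⟨κ, hκ⟩ := exists_isBump c (by linarith : 0 < R + T + 1)
  have hr := contDiff_areaRadius hM
  have hr0 := areaRadius_pos hM
  have hσ := contDiff_horizonDelay hM
  have hσ0 := horizonDelay_nonneg hM
  have hg := hη.contDiff_scaled (T := T)
  have hg' := hη.isTest_deriv_scaled hT0
  have hf : ∀ s, 0 ≤ nonlinWeight M p s := fun s => (nonlinWeight_pos hM p s).le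
  have hmA : ∀ t, MemLp (fun s => κ s * (areaRadius M s * scaled η T (t + horizonDelay M s))) 2
      volume := fun t =>
    (hκ.isTest.mul_smooth (hr.mul (hg.comp (contDiff_const.add hσ)))).memLp
  have hmB : ∀ t, MemLp (fun s => κ s * (areaRadius M s *
      deriv (scaled η T) (t + horizonDelay M s))) 2 volume := fun t =>
    (hκ.isTest.mul_smooth (hr.mul (hg'.smooth.comp (contDiff_const.add hσ)))).memLp
  have hA0 : ∀ t s, 0 ≤ κ s * (areaRadius M s * scaled η T (t + horizonDelay M s)) := fun t s => by
    refine mul_nonneg (hκ.nonneg s) (mul_nonneg (hr0 s).le ?_)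
    rw [scaled, hη.eq_pow]
    exact pow_nonneg (hη.nonneg _) 4
  set n : ℝ → ℝ := fun t => ⟪G t, toL2 fun s =>
    κ s * (areaRadius M s * scaled η T (t + horizonDelay M s))⟫ with hn
  have hn0 : ∀ t ∈ Icc 0 T, 0 ≤ n t := fun t ht => h.source_nonneg hf ht (hmA t) (hA0 t)
  -- the lower bound for the source at early times
  have hn1 : ∀ t ∈ Icc 0 (T / 8), k * T ^ (2 - p) ≤ n t := fun t ht => by
    have htT : t ∈ Icc 0 T := ⟨ht.1, by linarith [ht.2]⟩
    refine hk' T hT u ut utt G h κ hκ φ hφs (fun s => ⟨hφ0 s, (hφb s).2⟩) t ht ?_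
    have h2 := h.exp_growth (contDiff_potentialW hM) hf hκ hφs hφ0 hφ (hu0 ▸ h₀.nonneg)
      (hut0 ▸ h₁.nonneg) htT
    have h3 : e * ε ≤ ⟪u 0, toL2 fun s => κ s * φ s⟫ := by
      rw [hu0]
      refine h₀.inner_ge hε (hκ.isTest.mul_smooth hφs).memLp he0.le fun s hs => ?_
      rw [hκ.eq_one s (by linarith), one_mul]
      refine le_trans ?_ (hφb s).1
      have := (abs_le.mp hs).1
      rw [he]
      gcongr
      linarith
    refine le_trans ?_ h2
    gcongr
  set I : ℝ → ℝ := fun t =>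
    ⟪ut t, toL2 fun s => κ s * (areaRadius M s * scaled η T (t + horizonDelay M s))⟫ -
      ⟪u t, toL2 fun s => κ s * (areaRadius M s * deriv (scaled η T) (t + horizonDelay M s))⟫
    with hI
  set E : ℝ → ℝ := fun t => ⟪u t, toL2 fun s => κ s * (areaRadius M s *
    ((1 - 16 * M ^ 4 / areaRadius M s ^ 4) *
      deriv (deriv (scaled η T)) (t + horizonDelay M s)))⟫ with hE
  have hd : ∀ t ∈ Icc 0 T, HasDerivWithinAt I (n t - E t) (Icc 0 T) t := fun t ht =>
    h.hasDerivWithinAt_pairing hM hκ hg hg' ht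
  set L := K * T ^ (1 - 2 / (p - 1)) with hL
  have hE1 : ∀ t ∈ Icc 0 T, E t ≤ 1 / 2 * n t + L := fun t ht => hK T hT1 u ut utt G h κ hκ t ht
  have hI0 : 0 ≤ I 0 := by
    have h1 : 0 ≤ ⟪ut 0, toL2 fun s =>
        κ s * (areaRadius M s * scaled η T (0 + horizonDelay M s))⟫ :=
      inner_toL2_nonneg (hmA 0) (by
        rw [hut0]
        filter_upwards [h₁.nonneg] with s hs using mul_nonneg hs (hA0 0 s))
    have h2 : ⟪u 0, toL2 fun s =>
        κ s * (areaRadius M s * deriv (scaled η T) (0 + horizonDelay M s))⟫ ≤ 0 := by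
      rw [inner_toL2 _ (hmB 0), hu0]
      refine integral_nonpos_of_ae ?_
      filter_upwards [h₀.nonneg] with s hs
      refine mul_nonpos_of_nonneg_of_nonpos hs (mul_nonpos_of_nonneg_of_nonpos (hκ.nonneg s)
        (mul_nonpos_of_nonneg_of_nonpos (hr0 s).le ?_))
      rw [hη.deriv_scaled]
      exact div_nonpos_of_nonpos_of_nonneg (hη.deriv_nonpos _) hT0.le
    simp only [hI]
    linarith
  -- the test function vanishes at the final time
  have hIT : I T = 0 := by
    have h1 : ∀ s, 1 ≤ (T + horizonDelay M s) / T := fun s => by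
      rw [le_div_iff₀ hT0]
      linarith [hσ0 s]
    have h2 : ∀ s, scaled η T (T + horizonDelay M s) = 0 := fun s => by
      rw [scaled, hη.eq_pow, hη.eq_zero _ (h1 s)]
      norm_num
    have h3 : ∀ s, deriv (scaled η T) (T + horizonDelay M s) = 0 := fun s => by
      -- at its minimum `0` the derivative of `η` vanishes
      refine IsLocalMin.deriv_eq_zero (Eventually.of_forall fun x => ?_)
      rw [h2 s, scaled, hη.eq_pow]
      exact pow_nonneg (hη.nonneg _) 4
    simp only [hI]
    rw [inner_toL2 _ (hmA T), inner_toL2 _ (hmB T)]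
    simp only [h2, h3, mul_zero, integral_zero, sub_zero]
  have hlin : ∀ (a t : ℝ) (S : Set ℝ), HasDerivWithinAt (fun t : ℝ => a * t) a S t :=
    fun a t S => by simpa using ((hasDerivAt_id t).const_mul a).hasDerivWithinAt
  have hm1 : MonotoneOn (fun t => I t + L * t) (Icc 0 T) :=
    monotoneOn_Icc_of_hasDerivWithinAt (fun t ht => (hd t ht).fun_add (hlin L t _)) fun t ht => by
      linarith [hE1 t ht, hn0 t ht]
  have hsub : Icc 0 (T / 8) ⊆ Icc 0 T := Icc_subset_Icc_right (by linarith)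
  have hm2 : MonotoneOn (fun t => I t + (L - 1 / 2 * (k * T ^ (2 - p))) * t) (Icc 0 (T / 8)) :=
    monotoneOn_Icc_of_hasDerivWithinAt
      (fun t ht => ((hd t (hsub ht)).mono hsub).fun_add (hlin _ t _)) fun t ht => by
      linarith [hE1 t (hsub ht), hn1 t ht]
  have i1 := hm2 (left_mem_Icc.mpr (by positivity)) (right_mem_Icc.mpr (by positivity))
    (by positivity : (0 : ℝ) ≤ T / 8)
  have i2 := hm1 (hsub (right_mem_Icc.mpr (by positivity))) (right_mem_Icc.mpr hT0.le)
    (by linarith : T / 8 ≤ T)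
  simp only [mul_zero, add_zero, hIT, zero_add] at i1 i2
  nlinarith [mul_lt_mul_of_pos_right hlt hT0]

/-! ### Blow-up of the local solution -/

theorem inner_D_two (V : SobolevH 2) {ψ : ℝ → ℝ} (hψ : IsTest ψ) :
    ⟪SobolevH.D 2 V, toL2 ψ⟫ = ⟪SobolevH.D 0 V, toL2 (deriv (deriv ψ))⟫ := by
  have h1 : IsWeakDeriv (SobolevH.D 0 V) (SobolevH.D 1 V) := V.2 0
  have h2 : IsWeakDeriv (SobolevH.D 1 V) (SobolevH.D 2 V) := V.2 1
  rw [isWeakDeriv_iff.mp h1 _ hψ.deriv, isWeakDeriv_iff.mp h2 _ hψ, neg_neg]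

/-- Strong solutions with support in the light cone are weak solutions. -/
theorem IsStrongWave.isWeakWave {f W : ℝ → ℝ} {p c R T : ℝ} (hf : IsBddC1 f) (hW : IsBddC1 W)
    (hp : 2 < p) {V : ℝ → SobolevH 2} {Vt : ℝ → SobolevH 1} {Vtt : ℝ → L2R}
    (h : IsStrongWave (nlinH1 hf hW hp) (Icc 0 T) V Vt Vtt)
    (hs : ∀ t ∈ Icc 0 T, ∀ᵐ s : ℝ, R + t < |s - c| → SobolevH.D 0 (V t) s = 0) :
    IsWeakWave f W p c R T (fun t => SobolevH.D 0 (V t)) (fun t => SobolevH.D 0 (Vt t)) Vtt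
      (fun t => toL2 fun s => f s * |SobolevH.D 0 (V t) s| ^ p) := by
  obtain ⟨CW, hCW⟩ := hW.bound
  have hWm : ∀ v : L2R, MemLp (fun s => W s * v s) 2 volume := fun v => by
    refine ((Lp.memLp v).norm.const_mul CW).mono'
      (hW.contDiff.continuous.aestronglyMeasurable.mul (Lp.aestronglyMeasurable v))
      (Eventually.of_forall fun s => ?_)
    rw [norm_mul]
    exact mul_le_mul_of_nonneg_right (hCW s).1 (norm_nonneg _)
  have hfm : ∀ t, MemLp (fun s => f s * |SobolevH.D 0 (V t) s| ^ p) 2 volume := fun t => by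
    refine ((memLp_nlin hf hW hp (SobolevH.incl 1 (V t))).add (hWm (SobolevH.D 0 (V t)))).ae_eq
      (Eventually.of_forall fun s => ?_)
    exact sub_add_cancel _ _
  refine ⟨fun t ht => (h.hasDeriv t ht).clm_image (SobolevH.D 0), h.hasDeriv_t,
    fun t ht ψ hψ => ?_, fun t _ => coeFn_toL2 (hfm t), hs⟩
  have hWψ : MemLp (fun s => W s * ψ s) 2 volume :=
    hψ.supp.mul_left.memLp_two (hW.contDiff.continuous.mul hψ.continuous)
  rw [h.equation t ht, inner_add_left, inner_D_two _ hψ, toL2_sub hψ.deriv.deriv.memLp hWψ,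
    inner_sub_right, sub_add, sub_eq_add_neg]
  congr 1
  rw [inner_toL2 _ hψ.memLp, inner_toL2 _ hWψ, inner_toL2 _ hψ.memLp, neg_sub, ← integral_sub
    (integrable_mul_of_memLp _ hψ.memLp) (integrable_mul_of_memLp _ hWψ)]
  refine integral_congr_ae ?_
  filter_upwards [coeFn_D_zero_nlinH1 hf hW hp (SobolevH.incl 1 (V t)), coeFn_toL2 (hfm t)]
    with s h1 h2
  rw [h1, h2, nlin]
  have e : SobolevH.D 0 (SobolevH.incl 1 (V t)) = SobolevH.D 0 (V t) := rfl
  rw [e]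
  ring

theorem exists_abs_nlinH1_le {f W : ℝ → ℝ} {p : ℝ} (hf : IsBddC1 f) (hW : IsBddC1 W) (hp : 2 < p)
    {B : ℝ} (hB : 0 ≤ B) : ∃ K : ℝ, 0 ≤ K ∧ ∀ u : SobolevH 1, ‖u‖ ≤ B →
      ∀ᵐ s : ℝ, |SobolevH.D 0 (nlinH1 hf hW hp u) s| ≤ K * |SobolevH.D 0 u s| := by
  obtain ⟨K, hK0, hK⟩ := exists_nlin_bound hf hW hp hB
  refine ⟨K, hK0, fun u hu => ?_⟩
  filter_upwards [coeFn_D_zero_nlinH1 hf hW hp u, SobolevH.ae_abs_le_norm u] with s h1 h2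
  have h3 := (hK (SobolevH.D 0 u) 0 0 0 s (h2.trans hu) (by simpa using hB)).1
  rw [nlin_zero hp, sub_zero, Pi.zero_apply, sub_zero] at h3
  rw [h1]
  exact h3

/-- A strong solution exists only on intervals `[0, T]` of bounded length. -/
theorem exists_not_isIntegralCurveOn {M p c R ε : ℝ} (hM : 0 < M) (hp : 2 < p)
    (hp' : p < 1 + Real.sqrt 2) (hR : 0 < R) (hε : 0 < ε) {v₀ : SobolevH 2} {v₁ : SobolevH 1}
    (hv₀ : IsAdmissibleDatum c R ε (SobolevH.D 0 v₀))
    (hv₁ : IsAdmissibleDatum c R ε (SobolevH.D 0 v₁))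
    (hf : IsBddC1 (nonlinWeight M p)) (hW : IsBddC1 (potentialW M)) :
    ∃ T : ℝ, ¬ ∃ x, x 0 = waveInit v₀ v₁ ∧
      IsIntegralCurveOn x (waveField (nlinH1 hf hW hp)) (Icc 0 T) := by
  obtain ⟨T, hT, h⟩ := exists_not_isWeakWave hM hp hp' hR hε hv₀ hv₁
  refine ⟨T, fun ⟨x, hx0, hx⟩ => ?_⟩
  obtain ⟨V, Vt, Vtt, hV, hV0, hVt0, hVx, -⟩ := exists_isStrongWave (continuous_nlinH1 hf hW hp)
    (convex_Icc 0 T) (left_mem_Icc.mpr hT.le) hx0 hx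
  -- the initial data of the characteristic unknowns vanish outside the interval
  have h0 : ∀ᵐ s : ℝ, s ∈ outside c R → SobolevH.D 0 v₀ s = 0 := hv₀.support
  have h1 : ∀ᵐ s : ℝ, s ∈ outside c R → SobolevH.D 0 v₁ s = 0 := hv₁.support
  have h0' : ∀ᵐ s : ℝ, s ∈ outside c R → SobolevH.D 1 v₀ s = 0 :=
    IsWeakDeriv.eq_zero_on (v₀.2 0) (isOpen_outside c R) h0
  have hA : SobolevH.D 0 (x 0).1 = SobolevH.D 0 v₁ + SobolevH.D 1 v₀ := by rw [hx0]; rfl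
  have hB : SobolevH.D 0 (x 0).2.1 = SobolevH.D 0 v₁ - SobolevH.D 1 v₀ := by rw [hx0]; rfl
  have hC : SobolevH.D 0 (x 0).2.2 = SobolevH.D 0 v₀ := by rw [hx0]; rfl
  have hsupp := IsIntegralCurveOn.eq_zero_outside
    (fun B hB => exists_abs_nlinH1_le hf hW hp hB) hx (c := c) (R := R)
    (by
      rw [hA]
      filter_upwards [Lp.coeFn_add (SobolevH.D 0 v₁) (SobolevH.D 1 v₀), h1, h0']
        with s e1 e2 e3 hs
      rw [e1, Pi.add_apply, e2 hs, e3 hs, add_zero])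
    (by
      rw [hB]
      filter_upwards [Lp.coeFn_sub (SobolevH.D 0 v₁) (SobolevH.D 1 v₀), h1, h0']
        with s e1 e2 e3 hs
      rw [e1, Pi.sub_apply, e2 hs, e3 hs, sub_zero])
    (by rw [hC]; exact h0)
  refine h _ _ _ _ (congrArg (SobolevH.D 0) hV0) (congrArg (SobolevH.D 0) hVt0)
    (hV.isWeakWave hf hW hp fun t ht => ?_)
  have e : SobolevH.D 0 (V t) = SobolevH.D 0 (x t).2.2 := by rw [← hVx t ht]; rfl
  rw [e]
  exact hsupp t ht

section Solution

variable {T : ℝ} {N : SobolevH 1 → SobolevH 1} {V : ℝ → SobolevH 2} {Vt : ℝ → SobolevH 1}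
  {Vtt : ℝ → L2R}

theorem IsStrongWave.timeDeriv_eq (h : IsStrongWave N (Ico 0 T) V Vt Vtt) {t : ℝ}
    (ht : t ∈ Ico 0 T) : timeDeriv T V t = Vt t :=
  (h.hasDeriv t ht).derivWithin (uniqueDiffOn_Ico 0 T t ht)

theorem IsStrongWave.derivWithin_D_zero (h : IsStrongWave N (Ico 0 T) V Vt Vtt) {t : ℝ}
    (ht : t ∈ Ico 0 T) :
    derivWithin (fun τ => SobolevH.D 0 (V τ)) (Ico 0 T) t = SobolevH.D 0 (Vt t) :=
  ((h.hasDeriv t ht).clm_image (SobolevH.D 0)).derivWithin (uniqueDiffOn_Ico 0 T t ht)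

theorem IsStrongWave.timeDeriv2_eq (h : IsStrongWave N (Ico 0 T) V Vt Vtt) {t : ℝ}
    (ht : t ∈ Ico 0 T) : timeDeriv2 T V t = Vtt t := by
  rw [timeDeriv2, iteratedDerivWithin_succ, iteratedDerivWithin_one]
  rw [derivWithin_congr (fun τ hτ => h.derivWithin_D_zero hτ) (h.derivWithin_D_zero ht)]
  exact (h.hasDeriv_t t ht).derivWithin (uniqueDiffOn_Ico 0 T t ht)

theorem ContDiffOn.of_hasDerivWithinAt {E : Type*} [NormedAddCommGroup E] [NormedSpace ℝ E]
    {g g' : ℝ → E} {s : Set ℝ} (hs : UniqueDiffOn ℝ s) {n : ℕ}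
    (hg : ∀ t ∈ s, HasDerivWithinAt g (g' t) s t) (hg' : ContDiffOn ℝ n g' s) :
    ContDiffOn ℝ (n + 1) g s := by
  rw [contDiffOn_succ_iff_derivWithin hs]
  exact ⟨fun t ht => (hg t ht).differentiableWithinAt, by simp,
    hg'.congr fun t ht => (hg t ht).derivWithin (hs t ht)⟩

theorem IsStrongWave.isSolution {M p : ℝ} (hf : IsBddC1 (nonlinWeight M p))
    (hW : IsBddC1 (potentialW M)) (hp : 2 < p) (hT : 0 < T)
    (h : IsStrongWave (nlinH1 hf hW hp) (Ico 0 T) V Vt Vtt) :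
    IsSolution M p T (V 0) (Vt 0) V := by
  have hu := uniqueDiffOn_Ico (0 : ℝ) T
  refine ⟨h.continuousOn, ?_, ?_, fun t ht => ?_, rfl, h.timeDeriv_eq ⟨le_rfl, hT⟩⟩
  · have := ContDiffOn.of_hasDerivWithinAt (n := 0) hu h.hasDeriv
      (by simpa using h.continuousOn_t)
    simpa using this
  · have h1 := ContDiffOn.of_hasDerivWithinAt (n := 0) hu h.hasDeriv_t
      (by simpa using h.continuousOn_tt)
    have h2 := ContDiffOn.of_hasDerivWithinAt (n := 1) hu
      (fun t ht => (h.hasDeriv t ht).clm_image (SobolevH.D 0)) (by simpa using h1)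
    exact h2.of_le (by norm_num [one_add_one_eq_two])
  · have e : SobolevH.D 0 (SobolevH.incl 1 (V t)) = SobolevH.D 0 (V t) := rfl
    rw [h.timeDeriv2_eq ht, h.equation t ht]
    filter_upwards [Lp.coeFn_add (SobolevH.D 2 (V t))
      (SobolevH.D 0 (nlinH1 hf hW hp (SobolevH.incl 1 (V t)))),
      coeFn_D_zero_nlinH1 hf hW hp (SobolevH.incl 1 (V t))] with s h1 h2
    rw [h1, Pi.add_apply, h2, nlin, e]
    ring

end Solution

end

theorem mainTheorem3 (M p R : ℝ) (hM : 0 < M) (hp : 2 < p) (hp' : p < 1 + Real.sqrt 2)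
    (hR : 0 < R) (s₀ : ℝ → ℝ) (hs₀ : ∀ ε : ℝ, 0 < ε → s₀ ε < 0)
    (hlim : ∀ A : ℝ, 0 < A → Tendsto (fun ε : ℝ => ε ^ A * |s₀ ε|) (𝓝[>] 0) atTop)
    (ε : ℝ) (hε : 0 < ε) (v₀ : SobolevH 2) (v₁ : SobolevH 1)
    (hv₀ : IsAdmissibleDatum (s₀ ε) R ε (SobolevH.D 0 v₀))
    (hv₁ : IsAdmissibleDatum (s₀ ε) R ε (SobolevH.D 0 v₁)) :
    ∃ T : ℝ, 0 < T ∧ ∃ v : ℝ → SobolevH 2, IsSolution M p T v₀ v₁ v ∧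
      Tendsto (fun t => ‖v t‖ + ‖timeDeriv T v t‖ + ‖timeDeriv2 T v t‖) (𝓝[<] T) atTop := by
  have hf : IsBddC1 (nonlinWeight M p) := ⟨(contDiff_nonlinWeight hM p).of_le (by simp),
    exists_nonlinWeight_bound hM (by linarith)⟩
  have hW : IsBddC1 (potentialW M) := ⟨(contDiff_potentialW hM).of_le (by simp),
    exists_potentialW_bound hM⟩
  have hN := fun (B : ℝ) (hB : 0 ≤ B) => exists_nlinH1_lipschitz hf hW hp hB
  obtain ⟨T', hno⟩ := exists_not_isIntegralCurveOn hM hp hp' hR hε hv₀ hv₁ hf hW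
  obtain ⟨T, hT, x, hx0, hx, hblow⟩ := exists_isIntegralCurveOn_tendsto_norm_atTop
    continuous_waveField (waveField_lipschitzOnWith hN) (waveField_norm_le hN) (waveInit v₀ v₁) hno
  obtain ⟨V, Vt, Vtt, hV, rfl, rfl, -, hnorm⟩ := exists_isStrongWave
    (continuous_nlinH1 hf hW hp) (convex_Ico 0 T) ⟨le_rfl, hT⟩ hx0 hx
  refine ⟨T, hT, V, hV.isSolution hf hW hp hT, ?_⟩
  refine tendsto_atTop_mono' _ ?_ (hblow.const_mul_atTop (by norm_num : (0 : ℝ) < 1 / 2))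
  filter_upwards [Ico_mem_nhdsLT hT] with t ht
  have h1 := hnorm t ht
  have h2 := norm_nonneg (timeDeriv2 T V t)
  rw [hV.timeDeriv_eq ht]
  linarith
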